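/- Let $B$ be a smooth manifold (for instance a complex manifold), let $\mathcal H_{\mathbb Z}$ be a local system of free abelian groups of rank $r$ on $B$, put $\mathcal H_{\mathbb R}=\mathcal H_{\mathbb Z}\otimes\mathbb R$, and let $M\colon\mathcal H_{\mathbb R}\otimes\mathcal H_{\mathbb R}\to\mathbb R$ be a parallel alternating bilinear form. (The main example: $\mathcal H_{\mathbb Z}$ is the local system of first homology groups of the fibres of a family of compact Riemann surfaces of genus $g$ over $B$, $r=2g$, and $M$ is the intersection form.) Let $q\colon\mathcal J=\mathcal H_{\mathbb R}/\mathcal H_{\mathbb Z}\to B$ be the associated (Jacobian) torus bundle. For an integer $k\ge 0$ let $\mathcal J_k=\bigwedge^{2k+1}\mathcal H_{\mathbb R}/\bigwedge^{2k+1}\mathcal H_{\mathbb Z}$, let $M_k$ be the alternating form on $\bigwedge^{2k+1}\mathcal H_{\mathbb R}$ with $M_k(a_1\wedge\dots\wedge a_{2k+1},b_1\wedge\dots\wedge b_{2k+1})=\det(M(a_i,b_j))$, and let $\omega_k$ be the parallel $2$-form on $\mathcal J_k$ given by $M_k$. Let $\omega_k^\natural$ be the parallel $(4k+2)$-form on $\mathcal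 J\times_B\mathcal J$ that is one half of the image of $M_k$ under $\lambda\otimes\mu\mapsto\lambda(u)\wedge\mu(v)$, where $u,v$ denote the two components; thus if $M$ is nondegenerate and $(\lambda_1,\dots,\lambda_{2g})$ is dual to a local symplectic frame, with $\lambda_{2g+j}=-\lambda_j$, $$2\,\omega_k^\natural=\sum_{1\le i_1<\dots<i_{2k+1}\le 2g}\lambda_{i_1}(u)\wedge\dots\wedge\lambda_{i_{2k+1}}(u)\wedge\lambda_{g+i_1}(v)\wedge\dots\wedge\lambda_{g+i_{2k+1}}(v).$$ Let $\Gamma=(\Gamma_b)_{b\in B}$ be a smooth family of homologically trivial $2k$-cycles in the fibres of $\mathcal J$: each $\Gamma_b$ is a smooth singular $2k$-cycle in $\mathcal J_b$ that bounds a smooth chain, and every point of $B$ has a neighbourhood $U$ on which $\Gamma$ is represented by a finite sum $\sum_j m_j\sigma_j$ with $m_j\in\mathbb Z$ and smooth maps $\sigma_j\colon U\times\Delta^{2k}\to\mathcal J$ over $U$, in the sense that for every $b\in U$ the chain $\Gamma_b-\sum_j m_j\sigma_{j}(b,\cdot)$ is the boundary of a smooth $(2k+1)$-chain all of whose simplices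 have rank less than $2k+1$ everywhere. Let $\gamma$ be the section of $\mathcal J_k$ obtained by applying Griffiths's Abel-Jacobi construction fibrewise: $\gamma(b)$ is the class of the functional $\alpha\mapsto\int_{\tilde\Gamma_b}\alpha$ on translation-invariant $(2k+1)$-forms on $\mathcal J_b$, viewed as an element of $\bigwedge^{2k+1}\mathcal H_{\mathbb R,b}$, where $\tilde\Gamma_b$ is a smooth chain with $\partial\tilde\Gamma_b=\Gamma_b$. Then $\gamma$ is smooth, and with its first variation $d\gamma\in A^1(B,\bigwedge^{2k+1}\mathcal H_{\mathbb R})$ the equalities $$\gamma^*\omega_k=M_k(d\gamma)^{\otimes2}=\int_Q\omega_k^\natural\wedge\delta_{\Gamma\times_B\Gamma}$$ of $2$-forms on $B$ hold. Here $Q\colon\mathcal J\times_B\mathcal J\to B$ is the projection, $M_k(d\gamma)^{\otimes 2}$ is the form $(X,Y)\mapsto M_k(d\gamma(X),d\gamma(Y))$, and the right hand side is given on $U$ by the fibre integral $$\sum_{j,l}m_jm_l\int_{\Delta^{2k}\times\Delta^{2k}}(\sigma_j\times_U\sigma_l)^*\omega_k^\natural$$ for any local representation $\sum_j m_j\sigma_j$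 of $\Gamma$ on $U$. -/

import Mathlib

open scoped TensorProduct ContDiff Manifold Topology
open MeasureTheory

set_option linter.checkUnivs false

noncomputable section

namespace TorusBundle

universe u v w x

/-! ### Local systems of lattices and their tori -/

/-- A local system of free abelian groups of rank `r` on `B`: a family of groups `Fiber b`, with
local frames over the members `dom i` of an open cover whose transition matrices are locally
constant.  (For a family of compact Riemann surfaces of genus `g` over `B` one has the local system
with fibres `H₁(C_b, ℤ)`, `r = 2 g`.)  `indexAt b` is a preferred frame near `b`; the values of
`frame i` outside `dom i` play no role. -/
structure LatticeSystem (B : Type u) [TopologicalSpace B] (r : ℕ) where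
  Fiber : B → Type v
  [group : ∀ b, AddCommGroup (Fiber b)]
  ι : Type w
  dom : ι → Set B
  isOpen_dom : ∀ i, IsOpen (dom i)
  indexAt : B → ι
  mem_dom : ∀ b, b ∈ dom (indexAt b)
  frame : ∀ (_ : ι) (b : B), Module.Basis (Fin r) ℤ (Fiber b)
  locally_constant : ∀ i j b, b ∈ dom i → b ∈ dom j → ∀ᶠ b' in 𝓝 b, ∀ a c,
    (frame i b').repr (frame j b' c) a = (frame i b).repr (frame j b c) a

attribute [instance] LatticeSystem.group

section Fibres

variable {B : Type u} [TopologicalSpace B] {r : ℕ} (S : LatticeSystem.{u, v, w} B r)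

/-- The fibre at `b` of the real local system `H_ℝ = H_ℤ ⊗ ℝ`. -/
abbrev HR (b : B) : Type v := ℝ ⊗[ℤ] S.Fiber b

/-- The parallel frame of `H_ℝ` over `dom i` given by the frame `i` of `H_ℤ`. -/
def frameR (i : S.ι) (b : B) : Module.Basis (Fin r) ℝ (HR S b) :=
  Module.Basis.baseChange ℝ (S.frame i b)

/-- The vector of `H_ℝ` with given coordinates in the frame `i`. -/
def ofCoords (i : S.ι) (b : B) : (Fin r → ℝ) →ₗ[ℝ] HR S b :=
  (frameR S i b).equivFun.symm.toLinearMap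

/-- The lattice `H_ℤ` in `H_ℝ`. -/
def lattice (b : B) : AddSubgroup (HR S b) :=
  AddSubgroup.closure (Set.range fun a : S.Fiber b => (1 : ℝ) ⊗ₜ[ℤ] a)

/-- The fibre at `b` of the torus bundle `J = H_ℝ / H_ℤ`. -/
abbrev Torus (b : B) : Type v := HR S b ⧸ lattice S b

/-- The fibre at `b` of `⋀ⁿ H_ℝ`. -/
abbrev WedgeR (n : ℕ) (b : B) : Type v := ⋀[ℝ]^n (HR S b)

/-- The lattice `⋀ⁿ H_ℤ` in `⋀ⁿ H_ℝ`: it is generated by the exterior products of lattice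
vectors. -/
def wedgeLattice (n : ℕ) (b : B) : AddSubgroup (WedgeR S n b) :=
  AddSubgroup.closure (Set.range fun a : Fin n → S.Fiber b =>
    exteriorPower.ιMulti ℝ n (fun m => (1 : ℝ) ⊗ₜ[ℤ] a m))

/-- The fibre at `b` of the torus bundle `⋀ⁿ H_ℝ / ⋀ⁿ H_ℤ`; the `k`-th higher jacobian is the case
`n = 2 k + 1`. -/
abbrev WedgeTorus (n : ℕ) (b : B) : Type v := WedgeR S n b ⧸ wedgeLattice S n b

/-- The element `∑ f_a e_{a 0} ∧ … ∧ e_{a (n-1)}` of `⋀ⁿ H_ℝ`, where `e` is the frame `i` and `a` runs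
through all multi-indices (so these coordinates are redundant). -/
def ofWedgeCoords (i : S.ι) (n : ℕ) (b : B) : ((Fin n → Fin r) → ℝ) →ₗ[ℝ] WedgeR S n b :=
  ∑ a : Fin n → Fin r,
    (LinearMap.proj a : ((Fin n → Fin r) → ℝ) →ₗ[ℝ] ℝ).smulRight
      (exteriorPower.ιMulti ℝ n (fun m => frameR S i b (a m)))

/-! ### The pairing -/

/-- A parallel alternating bilinear form `M` on `H_ℝ` (such as the intersection form on the first
homology of a family of compact Riemann surfaces). -/
structure ParallelPairing where
  form : ∀ b, HR S b →ₗ[ℝ] HR S b →ₗ[ℝ] ℝ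
  alternating : ∀ b x, form b x x = 0
  locally_constant : ∀ i b, b ∈ S.dom i → ∀ᶠ b' in 𝓝 b, ∀ a c,
    form b' (frameR S i b' a) (frameR S i b' c) = form b (frameR S i b a) (frameR S i b c)

variable {S}

/-- The form induced by `M` on `⋀ⁿ H_ℝ`; it is characterised by `wedgePairing_ιMulti`. -/
def wedgePairing (M : ParallelPairing S) (n : ℕ) (b : B) :
    WedgeR S n b →ₗ[ℝ] WedgeR S n b →ₗ[ℝ] ℝ :=
  exteriorPower.pairingDual ℝ (HR S b) n ∘ₗ exteriorPower.map n (M.form b)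

theorem wedgePairing_ιMulti (M : ParallelPairing S) (n : ℕ) (b : B) (p q : Fin n → HR S b) :
    wedgePairing M n b (exteriorPower.ιMulti ℝ n p) (exteriorPower.ιMulti ℝ n q) =
      (Matrix.of fun i j => M.form b (p i) (q j)).det := by
  rw [wedgePairing, LinearMap.comp_apply, exteriorPower.map_apply_ιMulti,
    exteriorPower.pairingDual_ιMulti_ιMulti, ← Matrix.det_transpose]
  rfl

theorem ParallelPairing.antisymm (M : ParallelPairing S) (b : B) (p q : HR S b) :
    M.form b p q = - M.form b q p := by
  have h := M.alternating b (p + q)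
  simp only [map_add, LinearMap.add_apply, M.alternating] at h
  linarith

theorem wedgePairing_antisymm (M : ParallelPairing S) (k : ℕ) (b : B) :
    wedgePairing M (2 * k + 1) b = - (wedgePairing M (2 * k + 1) b).flip := by
  refine exteriorPower.linearMap_ext ?_
  ext p : 1
  refine exteriorPower.linearMap_ext ?_
  ext q
  simp only [LinearMap.compAlternatingMap_apply, LinearMap.neg_apply, LinearMap.flip_apply,
    wedgePairing_ιMulti]
  rw [← Matrix.det_transpose]
  have : (Matrix.of fun i j => M.form b (p i) (q j)).transpose =
      - (Matrix.of fun i j => M.form b (q i) (p j)) := by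
    ext i j
    simp [M.antisymm b (p j) (q i)]
  rw [this, Matrix.det_neg]
  simp [pow_succ, pow_mul]

/-- `M_k`, as an alternating `2`-form on the vector space `⋀^{2k+1} H_ℝ`. -/
def wedgeForm (M : ParallelPairing S) (k : ℕ) (b : B) :
    WedgeR S (2 * k + 1) b [⋀^Fin 2]→ₗ[ℝ] ℝ where
  toFun z := wedgePairing M (2 * k + 1) b (z 0) (z 1)
  map_update_add' z i p q := by
    fin_cases i <;> simp
  map_update_smul' z i c p := by
    fin_cases i <;> simp
  map_eq_zero_of_eq' z i j h hij := by
    have key : ∀ p, wedgePairing M (2 * k + 1) b p p = 0 := fun p => by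
      have := congrArg (fun f => f p p) (wedgePairing_antisymm M k b)
      simp only [LinearMap.neg_apply, LinearMap.flip_apply] at this
      linarith
    have h01 : z 0 = z 1 := by
      fin_cases i <;> fin_cases j <;> simp_all
    rw [h01]
    exact key _

end Fibres

/-! ### Differential forms and sections -/

section Manifold

variable {E : Type x} [NormedAddCommGroup E] [NormedSpace ℝ E]
  {B : Type u} [TopologicalSpace B] [ChartedSpace E B] {r : ℕ}

local notation "TB" => TangentSpace (modelWithCornersSelf ℝ E)

variable (E) in
/-- `2`-forms on `B`. -/
abbrev TwoForm (B : Type u) [TopologicalSpace B] [ChartedSpace E B] : Type _ :=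
  ∀ b : B, (TB b) [⋀^Fin 2]→ₗ[ℝ] ℝ

variable (E) in
/-- `2`-forms on the total space of `⋀ⁿ H_ℝ / ⋀ⁿ H_ℤ → B`.  The parallel structure
identifies the tangent space at a point over `b` with `T_b B × ⋀ⁿ H_{ℝ,b}`. -/
abbrev TwoFormOnWedgeTorus (S : LatticeSystem.{u, v, w} B r) (n : ℕ) : Type _ :=
  ∀ b : B, WedgeTorus S n b → ((TB b) × WedgeR S n b) [⋀^Fin 2]→ₗ[ℝ] ℝ

variable (E) in
/-- Forms of degree `d` on `J ×_B J`.  The parallel structure identifies the tangent space at a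
point over `b` with `T_b B × H_{ℝ,b} × H_{ℝ,b}`. -/
abbrev FormOnSquare (S : LatticeSystem.{u, v, w} B r) (d : ℕ) : Type _ :=
  ∀ b : B, Torus S b → Torus S b → ((TB b) × HR S b × HR S b) [⋀^Fin d]→ₗ[ℝ] ℝ

variable {S : LatticeSystem.{u, v, w} B r}

variable (E) in
/-- The parallel `2`-form `ω_k` on the `k`-th higher jacobian bundle. -/
def omega (M : ParallelPairing S) (k : ℕ) : TwoFormOnWedgeTorus E S (2 * k + 1) :=
  fun b _ => (wedgeForm M k b).compLinearMap
    (LinearMap.snd ℝ (TB b) (WedgeR S (2 * k + 1) b))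

variable (E) in
/-- The parallel form `ω_k^♮` of degree `4 k + 2` on `J ×_B J`.  The first component of `J ×_B J`
is `u`, the second is `v`; the form is one half of the image of `M_k` under
`(⋀^{2k+1} H_ℝ^*) ⊗ (⋀^{2k+1} H_ℝ^*) → ⋀^{4k+2} (H_ℝ^* ⊕ H_ℝ^*)`, `λ ⊗ μ ↦ λ(u) ∧ μ(v)`, so that in
a symplectic frame `2 ω_k^♮ = ∑_I λ_I(u) ∧ λ_{g+I}(v)`, and `ω_k^♮` restricts to `ω_k` on the
diagonal.  (`domCoprod` is the exterior product, a sum over shuffles.) -/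
def omegaNat (M : ParallelPairing S) (k : ℕ) : FormOnSquare E S (2 + (2 * k + 2 * k)) :=
  fun b _ _ =>
    let U : ((TB b) × HR S b × HR S b) [⋀^Fin (2 * k + 1)]→ₗ[ℝ] WedgeR S (2 * k + 1) b :=
      (exteriorPower.ιMulti ℝ (2 * k + 1)).compLinearMap
        (LinearMap.fst ℝ (HR S b) (HR S b) ∘ₗ LinearMap.snd ℝ (TB b) (HR S b × HR S b))
    let V : ((TB b) × HR S b × HR S b) [⋀^Fin (2 * k + 1)]→ₗ[ℝ] WedgeR S (2 * k + 1) b :=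
      (exteriorPower.ιMulti ℝ (2 * k + 1)).compLinearMap
        (LinearMap.snd ℝ (HR S b) (HR S b) ∘ₗ LinearMap.snd ℝ (TB b) (HR S b × HR S b))
    (1 / 2 : ℝ) • ((TensorProduct.lift (wedgePairing M (2 * k + 1) b)).compAlternatingMap
      (U.domCoprod V)).domDomCongr
        (finSumFinEquiv.trans (finCongr (by omega)))

/-- `f` is, over the open set `U ⊆ dom i`, the coordinate function of a smooth lift to `⋀ⁿ H_ℝ` of
the section `γ` of `⋀ⁿ H_ℝ / ⋀ⁿ H_ℤ`. -/
def IsSmoothLift {n : ℕ} (γ : ∀ b, WedgeTorus S n b) (i : S.ι) (U : Set B)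
    (f : B → (Fin n → Fin r) → ℝ) : Prop :=
  IsOpen U ∧ U ⊆ S.dom i ∧
    ContMDiffOn (modelWithCornersSelf ℝ E) (modelWithCornersSelf ℝ ((Fin n → Fin r) → ℝ)) ∞ f U ∧
    ∀ b ∈ U, γ b = QuotientAddGroup.mk (ofWedgeCoords S i n b (f b))

variable (E) in
/-- `γ` is a smooth section: it locally has smooth lifts. -/
def IsSmoothSection {n : ℕ} (γ : ∀ b, WedgeTorus S n b) : Prop :=
  ∀ b : B, ∃ i U f, b ∈ U ∧ IsSmoothLift (E := E) γ i U f

open Classical in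
variable (E) in
/-- The first variation `dγ ∈ A¹(B, ⋀ⁿ H_ℝ)` of a smooth section: the derivative, with respect to
parallel frames, of a local lift (it does not depend on the lift). -/
def firstVariation {n : ℕ} (γ : ∀ b, WedgeTorus S n b) (b : B) : (TB b) →ₗ[ℝ] WedgeR S n b :=
  if h : ∃ (i : S.ι) (f : B → (Fin n → Fin r) → ℝ),
      ∃ U, b ∈ U ∧ IsSmoothLift (E := E) γ i U f then
    ofWedgeCoords S h.choose n b ∘ₗ
      (mfderiv (modelWithCornersSelf ℝ E) (modelWithCornersSelf ℝ ((Fin n → Fin r) → ℝ))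
        h.choose_spec.choose b).toLinearMap
  else 0

/-- The pullback of a `2`-form along a section `γ`.  The derivative of `γ`, as a map from `B` to the
total space, is `X ↦ (X, dγ X)`. -/
def pullback {n : ℕ} (γ : ∀ b, WedgeTorus S n b) (Ω : TwoFormOnWedgeTorus E S n) : TwoForm E B :=
  fun b => (Ω b (γ b)).compLinearMap (LinearMap.prod LinearMap.id (firstVariation E γ b))

/-- `M_k (dγ)^{⊗2}`: the contraction with `M_k` of `(X, Y) ↦ dγ X ⊗ dγ Y`. -/
def contractSquare (M : ParallelPairing S) (k : ℕ) (γ : ∀ b, WedgeTorus S (2 * k + 1) b) :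
    TwoForm E B :=
  fun b => (wedgeForm M k b).compLinearMap (firstVariation E γ b)

end Manifold

/-! ### Smooth singular chains in the fibres of `J` -/

section Chains

variable {B : Type u} [TopologicalSpace B] {r : ℕ} (S : LatticeSystem.{u, v, w} B r)

/-- Singular chains in `J_b`: the free abelian group on the maps from the standard simplex to
`J_b`.  (Only smooth ones are used below.) -/
abbrev Chain (n : ℕ) (b : B) : Type _ := (stdSimplex ℝ (Fin (n + 1)) → Torus S b) →₀ ℤ

variable {S}

/-- The boundary of a singular chain. -/
def boundary {n : ℕ} {b : B} (c : Chain S (n + 1) b) : Chain S n b :=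
  c.sum fun σ m => ∑ j : Fin (n + 2),
    Finsupp.single (fun t => σ (stdSimplex.map (Fin.succAbove j) t)) ((-1) ^ (j : ℕ) * m)

/-- A chain is a cycle if its boundary is zero (no condition in degree `0`). -/
def IsCycle {b : B} : ∀ {n : ℕ}, Chain S n b → Prop
  | 0, _ => True
  | _ + 1, c => boundary c = 0

/-- `s` is a smooth lift to `H_ℝ`, in coordinates, of the singular simplex `σ`. -/
def IsLift {n : ℕ} {b : B} (σ : stdSimplex ℝ (Fin (n + 1)) → Torus S b)
    (s : (Fin (n + 1) → ℝ) → Fin r → ℝ) : Prop :=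
  ContDiff ℝ ∞ s ∧ ∀ t : stdSimplex ℝ (Fin (n + 1)),
    σ t = QuotientAddGroup.mk (ofCoords S (S.indexAt b) b (s t))

/-- A chain is smooth if each of its simplices has a smooth lift, that is, is smooth. -/
def IsSmoothChain {n : ℕ} {b : B} (c : Chain S n b) : Prop :=
  ∀ σ ∈ c.support, ∃ s, IsLift σ s

/-- The domain of the coordinates on the standard simplex. -/
def coordSimplex (n : ℕ) : Set (Fin n → ℝ) := {y | (∀ i, 0 ≤ y i) ∧ ∑ i, y i ≤ 1}

/-- The parametrisation of the standard simplex by `coordSimplex n`. -/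
def param {n : ℕ} (y : Fin n → ℝ) : Fin (n + 1) → ℝ := Fin.cons (1 - ∑ i, y i) y

/-- The partial derivatives of a map from the standard simplex. -/
def partialDeriv {n : ℕ} (s : (Fin (n + 1) → ℝ) → Fin r → ℝ) (y : Fin n → ℝ) (m : Fin n) :
    Fin r → ℝ :=
  fderiv ℝ (fun y' => s (param y')) y (Pi.single m 1)

open Classical in
/-- The integral over a smooth singular simplex of the translation-invariant form `α`; it does not
depend on the lift. -/
def simplexIntegral {n : ℕ} {b : B} (σ : stdSimplex ℝ (Fin (n + 1)) → Torus S b)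
    (α : HR S b [⋀^Fin n]→ₗ[ℝ] ℝ) : ℝ :=
  if h : ∃ s, IsLift σ s then
    ∫ y in coordSimplex n, α fun m => ofCoords S (S.indexAt b) b (partialDeriv h.choose y m)
  else 0

/-- The integral of a translation-invariant form over a smooth singular chain. -/
def chainIntegral {n : ℕ} {b : B} (c : Chain S n b) (α : HR S b [⋀^Fin n]→ₗ[ℝ] ℝ) : ℝ :=
  c.sum fun σ m => (m : ℝ) * simplexIntegral σ α

/-- A smooth chain of degree `n` is thin if each of its simplices has rank less than `n`
everywhere (so that it is zero as a current). -/
def IsThin {n : ℕ} {b : B} (c : Chain S n b) : Prop :=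
  ∀ σ ∈ c.support, ∃ s, IsLift σ s ∧
    ∀ y ∈ coordSimplex n, ¬ LinearIndependent ℝ (partialDeriv s y)

/-- `x` is the Griffiths Abel-Jacobi class of the smooth cycle `z`: one has `z = ∂ G` for a smooth
chain `G`, and `x` is the class of the functional `∫_G` on translation-invariant forms, as an
element of `⋀^{n+1} H_ℝ`. -/
def IsAbelJacobiClass {n : ℕ} {b : B} (z : Chain S n b) (x : WedgeTorus S (n + 1) b) : Prop :=
  ∃ G : Chain S (n + 1) b, IsSmoothChain G ∧ boundary G = z ∧
    ∃ ξ : WedgeR S (n + 1) b, x = QuotientAddGroup.mk ξ ∧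
      ∀ α : HR S b [⋀^Fin (n + 1)]→ₗ[ℝ] ℝ,
        exteriorPower.alternatingMapLinearEquiv α ξ = chainIntegral G α

end Chains

/-! ### Families of cycles and fibre integrals -/

section Families

variable {E : Type x} [NormedAddCommGroup E] [NormedSpace ℝ E]
  {B : Type u} [TopologicalSpace B] [ChartedSpace E B] {r : ℕ}

local notation "TB" => TangentSpace (modelWithCornersSelf ℝ E)

variable (E) in
/-- A smooth family of `n`-chains over an open set `U ⊆ dom i`: a formal sum `∑ coeff_j σ_j` of maps
`σ_j : U × Δⁿ → J` over `U`, given by smooth lifts in the coordinates of the frame `i`. -/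
structure LocalFamily (S : LatticeSystem.{u, v, w} B r) (n : ℕ) where
  i : S.ι
  U : Set B
  isOpen_U : IsOpen U
  subset_dom : U ⊆ S.dom i
  N : ℕ
  coeff : Fin N → ℤ
  lift : Fin N → B → (Fin (n + 1) → ℝ) → Fin r → ℝ
  smooth_lift : ∀ j, ContMDiffOn
    ((modelWithCornersSelf ℝ E).prod (modelWithCornersSelf ℝ (Fin (n + 1) → ℝ)))
    (modelWithCornersSelf ℝ (Fin r → ℝ)) ∞ (Function.uncurry (lift j)) (U ×ˢ Set.univ)

variable {S : LatticeSystem.{u, v, w} B r}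

/-- The `j`-th map `U × Δⁿ → J` of the family, at `b`. -/
def LocalFamily.simplex {n : ℕ} (c : LocalFamily E S n) (j : Fin c.N) (b : B)
    (t : Fin (n + 1) → ℝ) : Torus S b :=
  QuotientAddGroup.mk (ofCoords S c.i b (c.lift j b t))

/-- The chain at `b` of a local family. -/
def LocalFamily.chainAt {n : ℕ} (c : LocalFamily E S n) (b : B) : Chain S n b :=
  ∑ j, Finsupp.single (fun t : stdSimplex ℝ (Fin (n + 1)) => c.simplex j b t) (c.coeff j)

/-- The vertical part of the derivative of the `j`-th map in the direction `X` of the base. -/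
def LocalFamily.baseDeriv {n : ℕ} (c : LocalFamily E S n) (j : Fin c.N) (b : B)
    (t : Fin (n + 1) → ℝ) (X : TB b) : HR S b :=
  ofCoords S c.i b
    (mfderiv (modelWithCornersSelf ℝ E) (modelWithCornersSelf ℝ (Fin r → ℝ))
      (fun b' => c.lift j b' t) b X : Fin r → ℝ)

/-- The partial derivatives of the `j`-th map along the simplex. -/
def LocalFamily.fiberDeriv {n : ℕ} (c : LocalFamily E S n) (j : Fin c.N) (b : B)
    (y : Fin n → ℝ) (m : Fin n) : HR S b :=
  ofCoords S c.i b (partialDeriv (c.lift j b) y m)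

/-- The fibre integral of `η` over `c ×_B c`, evaluated at `b` and `X, Y ∈ T_b B`: for each pair
`(j, l)` the pullback of `η` along
`U × Δⁿ × Δⁿ → J ×_B J`, `(b, p, q) ↦ (σ_j (b, p), σ_l (b, q))`,
is integrated over `Δⁿ × Δⁿ`.  (For even `n`, the ordering of the base and the two simplices does
not matter.) -/
def LocalFamily.fiberIntegral {n : ℕ} (c : LocalFamily E S n)
    (η : FormOnSquare E S (2 + (n + n))) (b : B) (X Y : TB b) : ℝ :=
  ∑ j, ∑ l, (c.coeff j : ℝ) * (c.coeff l : ℝ) *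
    ∫ z in coordSimplex n ×ˢ coordSimplex n,
      η b (c.simplex j b (param z.1)) (c.simplex l b (param z.2))
        (Fin.append
          ![(X, c.baseDeriv j b (param z.1) X, c.baseDeriv l b (param z.2) X),
            (Y, c.baseDeriv j b (param z.1) Y, c.baseDeriv l b (param z.2) Y)]
          (Fin.append
            (fun m => ((0 : TB b), c.fiberDeriv j b z.1 m, (0 : HR S b)))
            (fun m => ((0 : TB b), (0 : HR S b), c.fiberDeriv l b z.2 m))))

/-- The local family `c` represents the family of chains `Γ`: they agree in each fibre up to the
boundary of a thin chain (as the fundamental chains of two triangulations of the same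
submanifold do). -/
def LocalFamily.Represents {n : ℕ} (c : LocalFamily E S n) (Γ : ∀ b, Chain S n b) : Prop :=
  ∀ b ∈ c.U, ∃ D : Chain S (n + 1) b, IsThin D ∧ Γ b - c.chainAt b = boundary D

variable (E) in
/-- A smooth family of fibrewise `n`-cycles in `J`: a smooth singular cycle in each fibre, such that
locally on `B` these are represented by smooth families of chains. -/
structure CycleFamily (S : LatticeSystem.{u, v, w} B r) (n : ℕ) where
  cycle : ∀ b, Chain S n b
  isSmooth : ∀ b, IsSmoothChain (cycle b)
  isCycle : ∀ b, IsCycle (cycle b)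
  exists_local : ∀ b, ∃ c : LocalFamily E S n, b ∈ c.U ∧ c.Represents cycle

/-- Every fibre of `Γ` is homologically trivial. -/
def CycleFamily.IsHomologicallyTrivial {n : ℕ} (Γ : CycleFamily E S n) : Prop :=
  ∀ b, ∃ G : Chain S (n + 1) b, IsSmoothChain G ∧ boundary G = Γ.cycle b

/-- The fibre integral `∫_Q η ∧ δ_{Γ ×_B Γ}` at `b` and `X, Y ∈ T_b B`, computed with a local
family representing `Γ` near `b`. -/
def CycleFamily.fiberIntegral {n : ℕ} (Γ : CycleFamily E S n)
    (η : FormOnSquare E S (2 + (n + n))) (b : B) (X Y : TB b) : ℝ :=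
  (Γ.exists_local b).choose.fiberIntegral η b X Y

end Families

end TorusBundle

end

/-!
The coordinates of the Abel-Jacobi class `γ b` are the integrals of the forms `dx_I` over a chain
bounding `Γ b`, modulo integers.  Since nothing is known about the dependence of the bounding chain
on `b`, these integrals are first expressed by `Γ b` itself.  On the universal cover of a torus,
`dx_I` has the primitives `(x_{I 0} - c) dx_{I 1} ∧ … ∧ dx_{I n}`, which are not invariant under
integral translations.  Taking for `c` the rounded coordinate of the first vertex of a simplex makes
the integral of the primitive over the simplex invariant; by Stokes' theorem its coboundary is then
the integral of `dx_I`, up to the cup product of an integral `1`-cocycle with the integral of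
`dx_{I 1} ∧ … ∧ dx_{I n}`, which is treated recursively.  The result is an explicit cochain
(`cochain`) on the simplices in the torus, whose coboundary is the integral of `dx_I` modulo integers
(`formIntegral_eq_sum_cochain_add_int`).  Hence the coordinates of `γ b` are, modulo integers, the
values of this cochain on any local family of chains representing `Γ`
(`LocalFamily.Represents.chainIntegral_eq`), and these are smooth functions of `b` as long as the
rounded vertices do not jump, which a generic shift `θ` of the rounding achieves near a given point.

By Cartan's formula and Stokes' theorem, the derivative of this function in a direction `X` is the
integral of the contraction of `dx_I` with the velocity of the family, plus the values of another
cochain (`cochainVar`) on the faces of the simplices (`fderiv_cochain`).  The faces cancel in each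
fibre, but the way in which they cancel may depend on `b`, and `cochainVar` involves the velocities.
However, some pattern of coincidences occurs along a sequence of parameters approaching the given
one in the direction `X`, and faces that coincide along such a sequence have the same velocity.  So
the extra terms cancel too (`sum_mul_cochainVar_eq_zero`), and `dγ X` is the sum of the integrals of
`X ∧ ∂₁ ∧ … ∧ ∂ₙ` over the moving simplices (`LocalFamily.Represents.firstVariation_eq`).

On vectors `X`, `Y` of the base and blocks `p`, `q` of `2 k` vectors tangent to the two simplices,
only two shuffles contribute to `ω_k^♮`, and its value is
`(M_k (X ∧ p, Y ∧ q) - M_k (Y ∧ p, X ∧ q)) / 2` (`omegaNat_apply`).  Fubini's theorem and the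
antisymmetry of `M_k` identify the fibre integral with `M_k (dγ X, dγ Y)`
(`LocalFamily.fiberIntegral_omegaNat`).
-/

open scoped TensorProduct ContDiff Manifold Topology
open MeasureTheory

set_option linter.checkUnivs false

noncomputable section

namespace TorusBundle

universe u v w x

/-! ### Integration over the simplex -/

theorem isClosed_coordSimplex (n : ℕ) : IsClosed (coordSimplex n) := by
  have : coordSimplex n = (⋂ i, {y | 0 ≤ y i}) ∩ {y | ∑ i, y i ≤ 1} := by
    ext y; simp [coordSimplex]
  rw [this]
  refine IsClosed.inter (isClosed_iInter fun i => isClosed_le continuous_const (continuous_apply i))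
    (isClosed_le (by fun_prop) continuous_const)

theorem isCompact_coordSimplex (n : ℕ) : IsCompact (coordSimplex n) := by
  refine (isCompact_univ_pi fun _ : Fin n =>
    isCompact_Icc (a := (0 : ℝ)) (b := 1)).of_isClosed_subset
      (isClosed_coordSimplex n) fun y hy i _ => ⟨hy.1 i, ?_⟩
  exact (Finset.single_le_sum (fun j _ => hy.1 j) (Finset.mem_univ i)).trans hy.2

theorem convex_coordSimplex (n : ℕ) : Convex ℝ (coordSimplex n) := by
  intro x hx y hy a b ha hb hab
  refine ⟨fun i => ?_, ?_⟩
  · have := hx.1 i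
    have := hy.1 i
    simp only [Pi.add_apply, Pi.smul_apply, smul_eq_mul]
    positivity
  · simp only [Pi.add_apply, Pi.smul_apply, smul_eq_mul, Finset.sum_add_distrib, ← Finset.mul_sum]
    nlinarith [hx.2, hy.2]

theorem measurableSet_coordSimplex (n : ℕ) : MeasurableSet (coordSimplex n) :=
  (isClosed_coordSimplex n).measurableSet

theorem _root_.Continuous.integrableOn_coordSimplex {F : Type*} [NormedAddCommGroup F] {n : ℕ}
    {f : (Fin n → ℝ) → F} (hf : Continuous f) : IntegrableOn f (coordSimplex n) :=
  hf.continuousOn.integrableOn_compact (isCompact_coordSimplex n)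

theorem insertNth_mem_coordSimplex {n : ℕ} (i : Fin (n + 1)) (a : ℝ) (y : Fin n → ℝ) :
    (i.insertNth a y : Fin (n + 1) → ℝ) ∈ coordSimplex (n + 1) ↔
      y ∈ coordSimplex n ∧ a ∈ Set.Icc 0 (1 - ∑ j, y j) := by
  simp only [coordSimplex, Set.mem_ofPred_eq, Set.mem_Icc, Fin.forall_iff_succAbove i,
    Fin.insertNth_apply_same, Fin.insertNth_apply_succAbove, Fin.sum_univ_succAbove _ i]
  constructor
  · rintro ⟨⟨h1, h2⟩, h3⟩
    exact ⟨⟨h2, by linarith⟩, h1, by linarith⟩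
  · rintro ⟨⟨h1, h2⟩, h3, h4⟩
    exact ⟨⟨h3, h1⟩, by linarith⟩

/-- Fubini's theorem for the simplex, integrating first over the `i`-th coordinate. -/
theorem integral_coordSimplex_succ {n : ℕ} (i : Fin (n + 1)) {f : (Fin (n + 1) → ℝ) → ℝ}
    (hf : Continuous f) :
    ∫ y in coordSimplex (n + 1), f y =
      ∫ y in coordSimplex n, ∫ a in (0 : ℝ)..(1 - ∑ j, y j), f (i.insertNth a y) := by
  have hmp := (volume_preserving_piFinSuccAbove (fun _ : Fin (n + 1) => ℝ) i).symm
  rw [← hmp.setIntegral_preimage_emb (MeasurableEquiv.measurableEmbedding _)]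
  rw [← integral_indicator ((measurableSet_coordSimplex _).preimage (MeasurableEquiv.measurable _)),
    Measure.volume_eq_prod, integral_prod_symm, ← integral_indicator (measurableSet_coordSimplex _)]
  · congr 1
    ext y
    by_cases hy : y ∈ coordSimplex n
    · have h0 : (0 : ℝ) ≤ 1 - ∑ j, y j := by linarith [hy.2]
      rw [Set.indicator_of_mem hy, intervalIntegral.integral_of_le h0,
        ← integral_Icc_eq_integral_Ioc, ← integral_indicator measurableSet_Icc]
      congr 1
      ext a
      by_cases ha : a ∈ Set.Icc 0 (1 - ∑ j, y j)
      · rw [Set.indicator_of_mem ha, Set.indicator_of_mem]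
        · rfl
        · exact (insertNth_mem_coordSimplex i a y).2 ⟨hy, ha⟩
      · rw [Set.indicator_of_notMem ha, Set.indicator_of_notMem]
        exact fun h => ha ((insertNth_mem_coordSimplex i a y).1 h).2
    · rw [Set.indicator_of_notMem hy]
      refine integral_eq_zero_of_ae (ae_of_all _ fun a => ?_)
      refine Set.indicator_of_notMem ?_ _
      exact fun h => hy ((insertNth_mem_coordSimplex i a y).1 h).1
  · rw [integrable_indicator_iff ((measurableSet_coordSimplex _).preimage
      (MeasurableEquiv.measurable _)), ← Measure.volume_eq_prod]
    exact (hmp.integrableOn_comp_preimage (MeasurableEquiv.measurableEmbedding _)).2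
      hf.integrableOn_coordSimplex

/-- The facet `∑ y = 1` of the simplex is parametrised by leaving out any one of the coordinates;
the measure is the same for all of them. -/
theorem integral_insertNth_one_sub_sum {n : ℕ} (i : Fin (n + 1)) {g : (Fin (n + 1) → ℝ) → ℝ}
    (hg : Continuous g) :
    ∫ y in coordSimplex n, g (i.insertNth (1 - ∑ j, y j) y) =
      ∫ y in coordSimplex n, g (Fin.cons (1 - ∑ j, y j) y) := by
  have hins : ∀ {m : ℕ} (j : Fin (m + 1)), Continuous fun p : ℝ × (Fin m → ℝ) =>
      (j.insertNth p.1 p.2 : Fin (m + 1) → ℝ) := fun j => by fun_prop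
  have hcons : ∀ {m : ℕ}, Continuous fun p : ℝ × (Fin m → ℝ) =>
      (Fin.cons p.1 p.2 : Fin (m + 1) → ℝ) := fun {m} => by
    simpa [Fin.insertNth_zero'] using hins (0 : Fin (m + 1))
  induction i using Fin.cases with
  | zero => simp
  | succ j =>
    cases n with
    | zero => exact j.elim0
    | succ n =>
      have hs : Continuous fun y : Fin (n + 1) → ℝ => 1 - ∑ j, y j := by fun_prop
      have h1 : Continuous fun y : Fin (n + 1) → ℝ => g (j.succ.insertNth (1 - ∑ j, y j) y) :=
        hg.comp ((hins j.succ).comp (hs.prodMk continuous_id))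
      have h2 : Continuous fun y : Fin (n + 1) → ℝ => g (Fin.cons (1 - ∑ j, y j) y) :=
        hg.comp (hcons.comp (hs.prodMk continuous_id))
      rw [integral_coordSimplex_succ 0 h1, integral_coordSimplex_succ j h2]
      refine setIntegral_congr_fun (measurableSet_coordSimplex n) fun y _ => ?_
      -- Both sides are integrals over the coordinates other than the first and the `j`-th of the
      -- integral over a segment, which is parametrised in opposite directions.
      have := intervalIntegral.integral_comp_sub_left (a := 0) (b := 1 - ∑ j, y j)
        (fun a => g (Fin.cons (1 - ∑ l, y l - a) (j.insertNth a y : Fin (n + 1) → ℝ)))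
        (1 - ∑ j, y j)
      rw [sub_self, sub_zero] at this
      have hj : ∀ a : ℝ, ∑ l, (j.insertNth a y : Fin (n + 1) → ℝ) l = a + ∑ l, y l := fun a => by
        simp [Fin.sum_univ_succAbove _ j]
      simp only [Fin.insertNth_zero', Fin.sum_cons, hj]
      convert this using 3
      · rename_i a
        congr 1
        ext l
        refine Fin.cases ?_ (fun l => ?_) l
        · rw [Fin.insertNth_apply_below (by simp)]
          simp
        · rcases Fin.eq_self_or_eq_succAbove j l with rfl | ⟨l, rfl⟩
          · simp only [Fin.insertNth_apply_same, Fin.cons_succ]; ring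
          · have h := Fin.insertNth_apply_succAbove (α := fun _ => ℝ) j.succ
              (1 - (a + ∑ i, y i)) (Fin.cons a y) l.succ
            rw [Fin.succ_succAbove_succ, Fin.cons_succ] at h
            rw [h, Fin.cons_succ, Fin.insertNth_apply_succAbove]
      · ring_nf

/-- The integral of a partial derivative over the simplex is the difference of the integrals over
the facets `∑ y = 1` and `y i = 0`. -/
theorem integral_fderiv_single {n : ℕ} (i : Fin (n + 1)) {g : (Fin (n + 1) → ℝ) → ℝ}
    (hg : ContDiff ℝ 1 g) :
    ∫ y in coordSimplex (n + 1), fderiv ℝ g y (Pi.single i 1) =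
      (∫ y in coordSimplex n, g (Fin.cons (1 - ∑ j, y j) y)) -
        ∫ y in coordSimplex n, g (i.insertNth 0 y) := by
  have hins : Continuous fun p : ℝ × (Fin n → ℝ) =>
      (i.insertNth p.1 p.2 : Fin (n + 1) → ℝ) := by fun_prop
  have hs : Continuous fun y : Fin n → ℝ => 1 - ∑ j, y j := by fun_prop
  have hc : Continuous fun y => fderiv ℝ g y (Pi.single i 1) :=
    (hg.continuous_fderiv one_ne_zero).clm_apply continuous_const
  rw [← integral_insertNth_one_sub_sum i hg.continuous, integral_coordSimplex_succ i hc,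
    ← integral_sub]
  · refine setIntegral_congr_fun (measurableSet_coordSimplex n) fun y _ => ?_
    have hcy : Continuous fun a : ℝ => fderiv ℝ g (i.insertNth a y) (Pi.single i 1) :=
      hc.comp (hins.comp (continuous_id.prodMk continuous_const))
    refine intervalIntegral.integral_eq_sub_of_hasDerivAt
      (f := fun a => g (i.insertNth a y)) (fun a _ => ?_) (hcy.intervalIntegrable _ _)
    have h1 : HasDerivAt (fun a : ℝ => (i.insertNth a y : Fin (n + 1) → ℝ)) (Pi.single i 1) a := by
      rw [hasDerivAt_pi]
      intro l
      refine (Fin.succAboveCases (α := fun l => HasDerivAt (fun a : ℝ => (i.insertNth a y :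
        Fin (n + 1) → ℝ) l) ((Pi.single i 1 : Fin (n + 1) → ℝ) l) a) i ?_ (fun l => ?_) l)
      · simpa using hasDerivAt_id' a
      · simpa [Pi.single_apply, Fin.succAbove_ne] using hasDerivAt_const a (y l)
    exact ((hg.differentiable one_ne_zero) _).hasFDerivAt.comp_hasDerivAt a h1
  · exact (hg.continuous.comp (hins.comp (hs.prodMk continuous_id))).integrableOn_coordSimplex
  · exact (hg.continuous.comp
      (hins.comp (continuous_const.prodMk continuous_id))).integrableOn_coordSimplex

/-! ### Stokes' theorem on the simplex -/

/-- The alternating sum of the faces of a tuple, evaluated by an alternating map, is the value on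
the edges from the first vertex. -/
theorem _root_.AlternatingMap.map_succ_sub_zero {M N : Type*} [AddCommGroup M] [Module ℝ M]
    [AddCommGroup N] [Module ℝ N] {n : ℕ} (φ : M [⋀^Fin n]→ₗ[ℝ] N) (v : Fin (n + 1) → M) :
    φ (fun m => v m.succ - v 0) = ∑ i : Fin (n + 1), (-1 : ℤ) ^ (i : ℕ) • φ (i.removeNth v) := by
  -- The sum is the value of the wedge `ℓ ∧ φ` on the vectors `(1, v i)`, with `ℓ` the first
  -- coordinate; it does not change when `(1, v 0)` is subtracted from the other vectors.
  let f : (ℝ × M) →ₗ[ℝ] (ℝ × M) [⋀^Fin n]→ₗ[ℝ] N :=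
    (LinearMap.fst ℝ ℝ M).smulRight (φ.compLinearMap (LinearMap.snd ℝ ℝ M))
  let Ψ := AlternatingMap.alternatizeUncurryFin f
  let x : ℝ × M := (1, v 0)
  let u : Fin n → ℝ × M := fun m => (0, v m.succ - v 0)
  have h1 : Ψ (Fin.cons x u) = φ (fun m => v m.succ - v 0) := by
    rw [AlternatingMap.alternatizeUncurryFin_apply, Fin.sum_univ_succ, Finset.sum_eq_zero]
    · simp [f, x, u]
    · intro i _
      simp [f, u]
  have h2 : Ψ (fun i => (1, v i)) = ∑ i : Fin (n + 1), (-1 : ℤ) ^ (i : ℕ) • φ (i.removeNth v) := by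
    rw [AlternatingMap.alternatizeUncurryFin_apply]
    refine Finset.sum_congr rfl fun i _ => ?_
    simp [f]
    rfl
  have h3 : Ψ (fun i => (1, v i)) = Ψ (Fin.cons x u) := by
    have h4 : (fun i => ((1 : ℝ), v i)) = Fin.cons x (u + fun _ => x) := by
      ext1 i
      refine Fin.cases rfl (fun m => ?_) i
      simp [u, x]
    rw [h4]
    change (Ψ.curryLeft x).toMultilinearMap (u + fun _ => x) = (Ψ.curryLeft x).toMultilinearMap u
    rw [MultilinearMap.map_add_univ, Finset.sum_eq_single Finset.univ]
    · simp
    · intro s _ hs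
      obtain ⟨j, hj⟩ : ∃ j, j ∉ s := by
        by_contra! h
        exact hs (Finset.eq_univ_iff_forall.2 h)
      refine Ψ.map_eq_zero_of_eq _ (i := 0) (j := j.succ) ?_ (Fin.succ_ne_zero j).symm
      simp [hj]
    · simp
  rw [← h1, ← h3, h2]

theorem sum_param {n : ℕ} (y : Fin n → ℝ) : ∑ i, param y i = 1 := by
  simp [param, Fin.sum_cons]

theorem contDiff_param {n : ℕ} {k : ℕ∞ω} : ContDiff ℝ k (param (n := n)) := by
  rw [contDiff_pi]
  intro i
  refine Fin.cases ?_ (fun i => ?_) i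
  · simp only [param, Fin.cons_zero]; fun_prop
  · simp only [param, Fin.cons_succ]; fun_prop

theorem param_mem_stdSimplex {n : ℕ} {y : Fin n → ℝ} (hy : y ∈ coordSimplex n) :
    param y ∈ stdSimplex ℝ (Fin (n + 1)) := by
  refine ⟨fun i => ?_, sum_param y⟩
  refine Fin.cases ?_ (fun i => ?_) i
  · simp only [param, Fin.cons_zero]; linarith [hy.2]
  · simpa [param] using hy.1 i

/-- The inclusion of the `a`-th facet of the standard simplex. -/
def face {n : ℕ} (a : Fin (n + 1)) : (Fin n → ℝ) → Fin (n + 1) → ℝ := fun t => a.insertNth 0 t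

theorem contDiff_face {n : ℕ} (a : Fin (n + 1)) {k : ℕ∞ω} : ContDiff ℝ k (face a) := by
  rw [contDiff_pi]
  intro i
  rcases Fin.eq_self_or_eq_succAbove a i with rfl | ⟨i, rfl⟩
  · simp only [face, Fin.insertNth_apply_same]; fun_prop
  · simp only [face, Fin.insertNth_apply_succAbove]; fun_prop

/-- The inclusion of the `a`-th facet in the coordinates given by `param`. -/
def coordFace {n : ℕ} (a : Fin (n + 2)) (y : Fin n → ℝ) : Fin (n + 1) → ℝ :=
  Fin.tail (face a (param y))

theorem param_coordFace {n : ℕ} (a : Fin (n + 2)) (y : Fin n → ℝ) :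
    param (coordFace a y) = face a (param y) := by
  have h : ∑ i, face a (param y) i = 1 := by
    rw [Fin.sum_univ_succAbove _ a]
    simp [face, sum_param]
  rw [Fin.sum_univ_succ] at h
  rw [param, coordFace, ← Fin.cons_self_tail (face a (param y))]
  congr 1
  simp only [Fin.tail_cons]
  simp only [Fin.tail]
  linarith

theorem coordFace_zero {n : ℕ} (y : Fin n → ℝ) : coordFace 0 y = Fin.cons (1 - ∑ j, y j) y := by
  simp [coordFace, face, param]

theorem coordFace_succ {n : ℕ} (i : Fin (n + 1)) (y : Fin n → ℝ) :
    coordFace i.succ y = i.insertNth 0 y := by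
  ext l
  rcases Fin.eq_self_or_eq_succAbove i l with rfl | ⟨l, rfl⟩
  · simp [coordFace, face, Fin.tail]
  · simp [coordFace, face, Fin.tail, param]

theorem contDiff_coordFace {n : ℕ} (a : Fin (n + 2)) {k : ℕ∞ω} : ContDiff ℝ k (coordFace a) := by
  rw [contDiff_pi]
  exact fun i => contDiff_pi.1 ((contDiff_face a).comp contDiff_param) i.succ

theorem fderiv_coordFace_zero {n : ℕ} (y : Fin n → ℝ) (m : Fin n) :
    fderiv ℝ (coordFace 0) y (Pi.single m 1) = Pi.single m.succ 1 - Pi.single 0 1 := by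
  have h : HasFDerivAt (𝕜 := ℝ) (coordFace 0)
      (ContinuousLinearMap.pi (Fin.cons (-∑ j, ContinuousLinearMap.proj j)
        fun j => ContinuousLinearMap.proj (R := ℝ) (φ := fun _ : Fin n => ℝ) j)) y := by
    rw [hasFDerivAt_pi']
    intro i
    refine Fin.cases ?_ (fun i => ?_) i
    · simp only [coordFace_zero, Fin.cons_zero]
      have := (HasFDerivAt.fun_sum (u := Finset.univ) fun j _ =>
        hasFDerivAt_apply (𝕜 := ℝ) j y).const_sub 1
      exact this
    · simp only [coordFace_zero, Fin.cons_succ]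
      exact hasFDerivAt_apply i y
  rw [h.fderiv]
  ext i
  refine Fin.cases ?_ (fun i => ?_) i
  · simp
  · simp [Pi.single_apply]

theorem fderiv_coordFace_succ {n : ℕ} (i : Fin (n + 1)) (y : Fin n → ℝ) (m : Fin n) :
    fderiv ℝ (coordFace i.succ) y (Pi.single m 1) = Pi.single (i.succAbove m) 1 := by
  have h : HasFDerivAt (𝕜 := ℝ) (coordFace i.succ)
      (ContinuousLinearMap.pi (i.insertNth (0 : (Fin n → ℝ) →L[ℝ] ℝ)
        fun j => ContinuousLinearMap.proj (R := ℝ) (φ := fun _ : Fin n => ℝ) j)) y := by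
    rw [hasFDerivAt_pi']
    intro l
    rcases Fin.eq_self_or_eq_succAbove i l with rfl | ⟨l, rfl⟩
    · simp only [coordFace_succ, Fin.insertNth_apply_same]
      exact (hasFDerivAt_const (0 : ℝ) y).congr_fderiv (by ext; simp)
    · simp only [coordFace_succ, Fin.insertNth_apply_succAbove]
      exact (hasFDerivAt_apply (𝕜 := ℝ) l y).congr_fderiv (by ext; simp)
  rw [h.fderiv]
  ext l
  rcases Fin.eq_self_or_eq_succAbove i l with rfl | ⟨l, rfl⟩
  · simp [(Fin.succAbove_ne _ _).symm]
  · simp [Pi.single_apply]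

/-- **Stokes' theorem** on the simplex. -/
theorem integral_extDeriv_coordSimplex {n : ℕ}
    {η : (Fin (n + 1) → ℝ) → (Fin (n + 1) → ℝ) [⋀^Fin n]→L[ℝ] ℝ} (hη : ContDiff ℝ 1 η) :
    ∫ y in coordSimplex (n + 1), extDeriv η y (fun i => Pi.single i 1) =
      ∑ a : Fin (n + 2), (-1) ^ (a : ℕ) * ∫ y in coordSimplex n,
        η (coordFace a y) fun m => fderiv ℝ (coordFace a) y (Pi.single m 1) := by
  set e : Fin (n + 1) → Fin (n + 1) → ℝ := fun i => Pi.single i 1 with he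
  have hg : ∀ i : Fin (n + 1), ContDiff ℝ 1 fun y => η y (i.removeNth e) := fun i =>
    ((ContinuousAlternatingMap.apply ℝ _ ℝ (i.removeNth e)).contDiff).comp hη
  have hc0 : Continuous fun y : Fin n → ℝ => (Fin.cons (1 - ∑ j, y j) y : Fin (n + 1) → ℝ) := by
    have := (contDiff_coordFace (n := n) 0 (k := 0)).continuous
    rwa [show coordFace (n := n) 0 = _ from funext coordFace_zero] at this
  have h0 : ∀ y : Fin n → ℝ,
      η (coordFace 0 y) (fun m => fderiv ℝ (coordFace 0) y (Pi.single m 1)) =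
        ∑ i : Fin (n + 1), (-1) ^ (i : ℕ) * η (Fin.cons (1 - ∑ j, y j) y) (i.removeNth e) := by
    intro y
    simp only [fderiv_coordFace_zero, coordFace_zero]
    have := (η (Fin.cons (1 - ∑ j, y j) y)).toAlternatingMap.map_succ_sub_zero e
    simpa [he] using this
  have hint : ∀ i : Fin (n + 1), IntegrableOn (fun y : Fin n → ℝ =>
      (-1 : ℝ) ^ (i : ℕ) * η (Fin.cons (1 - ∑ j, y j) y) (i.removeNth e)) (coordSimplex n) :=
    fun i => (continuous_const.mul ((hg i).continuous.comp hc0)).integrableOn_coordSimplex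
  rw [Fin.sum_univ_succ]
  simp only [h0, Fin.val_zero, pow_zero, one_mul]
  rw [integral_finsetSum _ fun i _ => hint i, ← Finset.sum_add_distrib]
  simp only [extDeriv_apply (hη.differentiable one_ne_zero _)]
  rw [integral_finsetSum]
  · refine Finset.sum_congr rfl fun i _ => ?_
    simp only [fderiv_coordFace_succ, coordFace_succ, zsmul_eq_mul, Int.cast_pow,
      Int.cast_neg, Int.cast_one]
    rw [integral_const_mul, integral_const_mul, integral_fderiv_single i (hg i)]
    simp only [Fin.val_succ, pow_succ]
    have : i.removeNth e = fun m => Pi.single (i.succAbove m) 1 := rfl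
    simp only [this]
    ring
  · intro i _
    refine Continuous.integrableOn_coordSimplex ?_
    exact Continuous.const_smul (((hg i).continuous_fderiv one_ne_zero).clm_apply
      continuous_const) ((-1 : ℤ) ^ (i : ℕ))

/-! ### Constant forms and their primitives -/

/-- The constant form `dx_{I 0} ∧ … ∧ dx_{I (m-1)}` on `ℝ^r`. -/
def detForm {r m : ℕ} (I : Fin m → Fin r) : (Fin r → ℝ) [⋀^Fin m]→L[ℝ] ℝ :=
  { (Matrix.detRowAlternating (R := ℝ) (n := Fin m)).compLinearMap (LinearMap.funLeft ℝ ℝ I) with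
    cont := by
      change Continuous fun w : Fin m → Fin r → ℝ => (Matrix.of fun b a => w b (I a)).det
      fun_prop }

theorem detForm_apply {r m : ℕ} (I : Fin m → Fin r) (w : Fin m → Fin r → ℝ) :
    detForm I w = (Matrix.of fun b a => w b (I a)).det := rfl

/-- The primitive `(x_{I 0} - c) dx_{I 1} ∧ … ∧ dx_{I m}` of `detForm I`. -/
def prim {r m : ℕ} (I : Fin (m + 1) → Fin r) (c : ℝ) (x : Fin r → ℝ) :
    (Fin r → ℝ) [⋀^Fin m]→L[ℝ] ℝ :=
  (x (I 0) - c) • detForm fun a => I a.succ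

theorem contDiff_prim {r m : ℕ} (I : Fin (m + 1) → Fin r) (c : ℝ) {k : ℕ∞ω} :
    ContDiff ℝ k (prim I c) := by
  unfold prim
  fun_prop

theorem extDeriv_prim {r m : ℕ} (I : Fin (m + 1) → Fin r) (c : ℝ) (x : Fin r → ℝ) :
    extDeriv (prim I c) x = detForm I := by
  ext w
  rw [extDeriv_apply ((contDiff_prim I c (k := 1)).differentiable one_ne_zero _), detForm_apply,
    Matrix.det_succ_column_zero]
  refine Finset.sum_congr rfl fun i _ => ?_
  have h : HasFDerivAt (fun x : Fin r → ℝ => prim I c x (i.removeNth w))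
      ((detForm (fun a => I a.succ) (i.removeNth w)) •
        ContinuousLinearMap.proj (R := ℝ) (φ := fun _ : Fin r => ℝ) (I 0)) x := by
    have h1 : HasFDerivAt (fun x : Fin r → ℝ => x (I 0) - c)
      (ContinuousLinearMap.proj (R := ℝ) (φ := fun _ : Fin r => ℝ) (I 0)) x :=
      (hasFDerivAt_apply (𝕜 := ℝ) (I 0) x).sub_const c
    exact h1.mul_const (detForm (fun a => I a.succ) (i.removeNth w))
  rw [h.fderiv]
  simp only [_root_.smul_apply, ContinuousLinearMap.proj_apply, smul_eq_mul,
    zsmul_eq_mul, Int.cast_pow, Int.cast_neg, Int.cast_one, Matrix.of_apply]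
  rw [mul_assoc, mul_comm (w i (I 0))]
  rfl

/-! ### Integrals over parametrised simplices -/

/-- The integral of `detForm I` over a simplex in `ℝ^r`. -/
def formIntegral {r m : ℕ} (I : Fin m → Fin r) (s : (Fin (m + 1) → ℝ) → Fin r → ℝ) : ℝ :=
  ∫ y in coordSimplex m, detForm I (partialDeriv s y)

/-- The integral of `prim I c` over a simplex in `ℝ^r`. -/
def primIntegral {r m : ℕ} (I : Fin (m + 1) → Fin r) (c : ℝ)
    (s : (Fin (m + 1) → ℝ) → Fin r → ℝ) : ℝ :=
  ∫ y in coordSimplex m, prim I c (s (param y)) (partialDeriv s y)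

/-- The integral over a simplex `s` of the contraction of `detForm I` with a vector field `v` along
`s`. -/
def formIntegralVar {r m : ℕ} (I : Fin (m + 1) → Fin r) (s v : (Fin (m + 1) → ℝ) → Fin r → ℝ) : ℝ :=
  ∫ y in coordSimplex m,
    detForm I (Fin.cons (v (param y)) (partialDeriv s y) : Fin (m + 1) → Fin r → ℝ)

/-- The integral over a simplex `s` of the contraction of `prim I c` with a vector field `v` along
`s`. -/
def primIntegralVar {r m : ℕ} (I : Fin (m + 2) → Fin r) (c : ℝ)
    (s v : (Fin (m + 1) → ℝ) → Fin r → ℝ) : ℝ :=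
  ∫ y in coordSimplex m,
    prim I c (s (param y)) (Fin.cons (v (param y)) (partialDeriv s y) : Fin (m + 1) → Fin r → ℝ)

theorem continuous_partialDeriv {r n : ℕ} {s : (Fin (n + 1) → ℝ) → Fin r → ℝ}
    (hs : ContDiff ℝ ∞ s) : Continuous (partialDeriv s) := by
  refine continuous_pi fun m => ?_
  have : ContDiff ℝ ∞ fun y => s (param y) := hs.comp contDiff_param
  exact (this.continuous_fderiv (by simp)).clm_apply continuous_const

theorem continuous_cons_partialDeriv {r m : ℕ} {s v : (Fin (m + 1) → ℝ) → Fin r → ℝ}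
    (hs : ContDiff ℝ ∞ s) (hv : Continuous v) :
    Continuous fun y => (Fin.cons (v (param y)) (partialDeriv s y) : Fin (m + 1) → Fin r → ℝ) := by
  refine continuous_pi fun i => ?_
  refine Fin.cases ?_ (fun i => ?_) i
  · exact hv.comp (contDiff_param (k := 0)).continuous
  · simpa [Function.comp_def] using (continuous_apply i).comp (continuous_partialDeriv hs)

theorem partialDeriv_comp_face {r n : ℕ} {s : (Fin (n + 2) → ℝ) → Fin r → ℝ}
    (hs : ContDiff ℝ ∞ s) (a : Fin (n + 2)) (y : Fin n → ℝ) (m : Fin n) :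
    partialDeriv (s ∘ face a) y m =
      fderiv ℝ (fun y => s (param y)) (coordFace a y)
        (fderiv ℝ (coordFace a) y (Pi.single m 1)) := by
  have h : (fun y => (s ∘ face a) (param y)) = (fun y => s (param y)) ∘ coordFace a := by
    ext1 y
    simp [param_coordFace]
  rw [partialDeriv, h, fderiv_comp]
  · rfl
  · exact ((hs.comp contDiff_param).differentiable (by simp)) _
  · exact ((contDiff_coordFace a (k := 1)).differentiable one_ne_zero) _

theorem integrableOn_form {r m : ℕ} (I : Fin m → Fin r) {s : (Fin (m + 1) → ℝ) → Fin r → ℝ}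
    (hs : ContDiff ℝ ∞ s) :
    IntegrableOn (fun y => detForm I (partialDeriv s y)) (coordSimplex m) :=
  ((detForm I).cont.comp (continuous_partialDeriv hs)).integrableOn_coordSimplex

theorem integrableOn_prim {r m : ℕ} (I : Fin (m + 1) → Fin r) (c : ℝ)
    {s : (Fin (m + 1) → ℝ) → Fin r → ℝ} (hs : ContDiff ℝ ∞ s) :
    IntegrableOn (fun y => prim I c (s (param y)) (partialDeriv s y)) (coordSimplex m) := by
  have h1 : Continuous fun y => s (param y) :=
    hs.continuous.comp (contDiff_param (k := 0)).continuous
  have h2 : Continuous fun y => (s (param y) (I 0) - c) *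
      detForm (fun a => I a.succ) (partialDeriv s y) :=
    (((continuous_apply (I 0)).comp h1).sub continuous_const).mul
      ((detForm _).cont.comp (continuous_partialDeriv hs))
  exact h2.integrableOn_coordSimplex

theorem primIntegral_sub {r m : ℕ} (I : Fin (m + 1) → Fin r) (c c' : ℝ)
    {s : (Fin (m + 1) → ℝ) → Fin r → ℝ} (hs : ContDiff ℝ ∞ s) :
    primIntegral I c s = primIntegral I c' s - (c - c') * formIntegral (fun a => I a.succ) s := by
  rw [primIntegral, primIntegral, formIntegral, ← integral_const_mul, ← integral_sub
    (integrableOn_prim I c' hs) ((integrableOn_form _ hs).const_mul _)]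
  refine setIntegral_congr_fun (measurableSet_coordSimplex m) fun y _ => ?_
  simp only [prim, ContinuousAlternatingMap.smul_apply, smul_eq_mul]
  ring

/-- In finite dimension, a family of alternating forms is smooth if its values are. -/
theorem contDiffOn_of_apply {E G : Type*} [NormedAddCommGroup E] [NormedSpace ℝ E]
    [FiniteDimensional ℝ E] [NormedAddCommGroup G] [NormedSpace ℝ G] {n : ℕ} {k : ℕ∞ω}
    {g : G → E [⋀^Fin n]→L[ℝ] ℝ} {s : Set G}
    (h : ∀ w, ContDiffOn ℝ k (fun x => g x w) s) : ContDiffOn ℝ k g s := by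
  let b := Module.finBasis ℝ E
  let ev : (E [⋀^Fin n]→L[ℝ] ℝ) →ₗ[ℝ] ((Fin n → Fin (Module.finrank ℝ E)) → ℝ) :=
    { toFun := fun φ a => φ fun i => b (a i)
      map_add' := fun _ _ => rfl
      map_smul' := fun _ _ => rfl }
  have hev : LinearMap.ker ev = ⊥ := by
    rw [LinearMap.ker_eq_bot]
    intro φ ψ hφ
    refine ContinuousAlternatingMap.toAlternatingMap_injective (b.ext_alternating fun a _ => ?_)
    exact congrFun hφ a
  obtain ⟨L, hL⟩ := ev.exists_leftInverse_of_injective hev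
  have : g = fun x => LinearMap.toContinuousLinearMap L (ev (g x)) := by
    ext1 x
    exact (LinearMap.congr_fun hL (g x)).symm
  rw [this]
  exact (LinearMap.toContinuousLinearMap L).contDiff.comp_contDiffOn
    (contDiffOn_pi.2 fun a => h _)

theorem contDiffOn_detForm {G : Type*} [NormedAddCommGroup G] [NormedSpace ℝ G] {r m : ℕ}
    {k : ℕ∞ω} (I : Fin m → Fin r) {w : Fin m → G → Fin r → ℝ} {s : Set G}
    (h : ∀ i, ContDiffOn ℝ k (w i) s) :
    ContDiffOn ℝ k (fun x => detForm I fun i => w i x) s := by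
  simp only [detForm_apply, Matrix.det_apply, Matrix.of_apply]
  refine ContDiffOn.sum fun σ _ => ContDiffOn.const_smul _ (contDiffOn_prod fun i _ => ?_)
  exact contDiffOn_pi.1 (h _) _

/-- The pullback of `prim I c` along a smooth map. -/
def pullbackPrim {E : Type*} [NormedAddCommGroup E] [NormedSpace ℝ E] {r m : ℕ}
    (I : Fin (m + 1) → Fin r) (c : ℝ) (f : E → Fin r → ℝ) (x : E) : E [⋀^Fin m]→L[ℝ] ℝ :=
  (prim I c (f x)).compContinuousLinearMap (fderiv ℝ f x)

theorem pullbackPrim_apply {E : Type*} [NormedAddCommGroup E] [NormedSpace ℝ E] {r m : ℕ}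
    (I : Fin (m + 1) → Fin r) (c : ℝ) (f : E → Fin r → ℝ) (x : E) (w : Fin m → E) :
    pullbackPrim I c f x w = prim I c (f x) fun i => fderiv ℝ f x (w i) := rfl

theorem contDiffOn_pullbackPrim {E : Type*} [NormedAddCommGroup E] [NormedSpace ℝ E]
    [FiniteDimensional ℝ E] {r m : ℕ} (I : Fin (m + 1) → Fin r) (c : ℝ) {f : E → Fin r → ℝ}
    {s : Set E} (hf : ContDiffOn ℝ ∞ f s) (hs : IsOpen s) :
    ContDiffOn ℝ ∞ (pullbackPrim I c f) s := by
  have h1 : ContDiffOn ℝ ∞ (fderiv ℝ f) s := hf.fderiv_of_isOpen hs (by simp)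
  refine contDiffOn_of_apply fun w => ?_
  simp only [pullbackPrim_apply, prim, ContinuousAlternatingMap.smul_apply, smul_eq_mul]
  exact ((contDiffOn_pi.1 hf (I 0)).sub contDiffOn_const).mul
    (contDiffOn_detForm _ fun i => h1.clm_apply contDiffOn_const)

theorem extDeriv_pullbackPrim {E : Type*} [NormedAddCommGroup E] [NormedSpace ℝ E] {r m : ℕ}
    (I : Fin (m + 1) → Fin r) (c : ℝ) {f : E → Fin r → ℝ} {x : E} (hf : ContDiffAt ℝ ∞ f x)
    (w : Fin (m + 1) → E) :
    extDeriv (pullbackPrim I c f) x w = detForm I fun i => fderiv ℝ f x (w i) := by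
  unfold pullbackPrim
  rw [extDeriv_pullback ((contDiff_prim I c (k := 1)).differentiable one_ne_zero _) hf
    (by simpa using WithTop.coe_le_coe.2 (le_top : (2 : ℕ∞) ≤ ⊤)), extDeriv_prim]
  rfl

/-- Stokes' theorem for the primitive `prim I c`. -/
theorem formIntegral_eq_sum_primIntegral {r m : ℕ} (I : Fin (m + 1) → Fin r) (c : ℝ)
    {s : (Fin (m + 2) → ℝ) → Fin r → ℝ} (hs : ContDiff ℝ ∞ s) :
    formIntegral I s = ∑ a : Fin (m + 2), (-1) ^ (a : ℕ) * primIntegral I c (s ∘ face a) := by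
  have hf : ContDiff ℝ ∞ fun y => s (param y) := hs.comp contDiff_param
  have hη := contDiffOn_pullbackPrim I c hf.contDiffOn isOpen_univ
  rw [contDiffOn_univ] at hη
  have := integral_extDeriv_coordSimplex (hη.of_le (by simp))
  convert this using 1
  · refine setIntegral_congr_fun (measurableSet_coordSimplex _) fun y _ => ?_
    exact (extDeriv_pullbackPrim I c hf.contDiffAt _).symm
  · refine Finset.sum_congr rfl fun a _ => ?_
    congr 1
    refine setIntegral_congr_fun (measurableSet_coordSimplex _) fun y _ => ?_
    simp only [pullbackPrim_apply, param_coordFace]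
    refine congrArg _ (funext fun m => ?_)
    exact partialDeriv_comp_face hs a y m

/-! ### A primitive of the period cochain modulo integers -/

/-- The `k`-th vertex of the standard simplex (zero if there is none). -/
def vtx {n : ℕ} (k : ℕ) : Fin n → ℝ := fun j => if (j : ℕ) = k then 1 else 0

theorem face_zero_vtx {n : ℕ} (k : ℕ) : face 0 (vtx k : Fin n → ℝ) = vtx (k + 1) := by
  ext j
  refine Fin.cases ?_ (fun j => ?_) j <;> simp [face, vtx]

theorem face_succ_vtx_zero {n : ℕ} (a : Fin (n + 1)) :
    face a.succ (vtx 0 : Fin (n + 1) → ℝ) = vtx 0 := by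
  ext j
  rcases Fin.eq_self_or_eq_succAbove a.succ j with rfl | ⟨j, rfl⟩
  · simp [face, vtx]
  · simp only [face, vtx, Fin.insertNth_apply_succAbove]
    refine Fin.cases ?_ (fun j => ?_) j <;> simp [Fin.succ_succAbove_succ]

theorem face_succ_cons {n : ℕ} (a : Fin (n + 1)) (t : Fin n → ℝ) (c : ℝ) :
    face a.succ (Fin.cons c t) = Fin.cons c (face a t) := by
  ext j
  refine Fin.cases ?_ (fun j => ?_) j
  · simp [face, Fin.insertNth_apply_below]
  · rcases Fin.eq_self_or_eq_succAbove a j with rfl | ⟨j, rfl⟩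
    · simp [face]
    · have h := Fin.insertNth_apply_succAbove (α := fun _ => ℝ) a.succ 0 (Fin.cons c t) j.succ
      rw [Fin.succ_succAbove_succ] at h
      simp [face, h]

theorem vtx_succ_eq_cons {n : ℕ} (k : ℕ) : (vtx (k + 1) : Fin (n + 1) → ℝ) = Fin.cons 0 (vtx k) := by
  ext j
  refine Fin.cases ?_ (fun j => ?_) j <;> simp [vtx]

theorem face_one_vtx_one {n : ℕ} : face 1 (vtx 1 : Fin (n + 1) → ℝ) = vtx 2 := by
  rw [← Fin.succ_zero_eq_one, vtx_succ_eq_cons, face_succ_cons, face_zero_vtx, ← vtx_succ_eq_cons]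

theorem face_succ_succ_vtx_one {n : ℕ} (a : Fin (n + 1)) :
    face a.succ.succ (vtx 1 : Fin (n + 2) → ℝ) = vtx 1 := by
  rw [vtx_succ_eq_cons, face_succ_cons, face_succ_vtx_zero, ← vtx_succ_eq_cons]

theorem face_succ_face_zero {n : ℕ} (a : Fin (n + 1)) (t : Fin n → ℝ) :
    face a.succ (face 0 t) = face 0 (face a t) := by
  have h : ∀ {m : ℕ} (t : Fin m → ℝ), face 0 t = Fin.cons 0 t := fun t => by simp [face]
  rw [h, h, face_succ_cons]

/-- The value of the coboundary of the integer-valued function `f` on the first edge of a simplex. -/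
def jump {V : Type*} {n : ℕ} (f : V → ℤ) (s : (Fin n → ℝ) → V) : ℝ :=
  f (s (vtx 1)) - f (s (vtx 0))

/-- The Leibniz rule for the cup product of the `1`-cocycle `jump f` with a cochain. -/
theorem sum_jump_mul {V : Type*} {m : ℕ} (f : V → ℤ) (T : ((Fin m → ℝ) → V) → ℝ)
    (s : (Fin (m + 2) → ℝ) → V) :
    ∑ a : Fin (m + 2), (-1) ^ (a : ℕ) * (jump f (s ∘ face a) * T (s ∘ face a ∘ face 0)) =
      -(jump f s * ∑ a : Fin (m + 1), (-1) ^ (a : ℕ) * T (s ∘ face 0 ∘ face a)) := by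
  have hc : ∀ a : Fin (m + 1), face a.succ ∘ face 0 = face 0 ∘ face a := fun a =>
    funext fun t => face_succ_face_zero a t
  rw [Fin.sum_univ_succ, Fin.sum_univ_succ, Fin.sum_univ_succ]
  simp only [hc, Fin.succ_zero_eq_one, Fin.val_zero, Fin.val_one, Fin.val_succ, jump,
    Function.comp_apply, face_one_vtx_one, face_zero_vtx, zero_add, pow_succ, pow_zero]
  have h1 : ∀ b : Fin m, face (n := m + 1) b.succ.succ (vtx 1) = vtx 1 := by
    cases m with
    | zero => exact fun b => b.elim0
    | succ m => exact fun b => face_succ_succ_vtx_one b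
  have h0 : ∀ b : Fin (m + 1), face (n := m + 1) b.succ (vtx 0) = vtx 0 :=
    fun b => face_succ_vtx_zero b
  have h01 : face (n := m + 1) 1 (vtx 0) = vtx 0 := h0 0
  have hc1 : face (n := m + 1) 1 ∘ face 0 = face 0 ∘ face 0 := hc 0
  simp only [h1, h0, h01, hc1]
  have : ∀ b : Fin m, (-1 : ℝ) ^ (b : ℕ) * -1 * -1 *
      ((f (s (vtx 1)) - f (s (vtx 0)) : ℝ) * T (s ∘ face 0 ∘ face b.succ)) =
      -(f (s (vtx 1)) - f (s (vtx 0)) : ℝ) *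
        ((-1 : ℝ) ^ (b : ℕ) * -1 * T (s ∘ face 0 ∘ face b.succ)) := fun b => by ring
  simp only [this, ← Finset.mul_sum]
  ring

/-- The `i`-th coordinate, shifted by `θ i` and rounded down.  It commutes with integral
translations. -/
def rounded {r : ℕ} (θ : Fin r → ℝ) (i : Fin r) (x : Fin r → ℝ) : ℤ := ⌊x i + θ i⌋

/-- A cochain on simplices of dimension `m - 1` in `ℝ^r` (given as maps on `Fin m → ℝ`), invariant
under integral translations, whose coboundary is the cochain `formIntegral I` modulo integers.  The
recursion integrates the primitive `prim I c` with the constant `c` given by the rounded first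
vertex; the change of `c` from one face to another is compensated by the second term, in which only
the face opposite to the first vertex occurs. -/
def cochain {r : ℕ} (θ : Fin r → ℝ) :
    ∀ {m : ℕ}, (Fin m → Fin r) → ((Fin m → ℝ) → Fin r → ℝ) → ℝ
  | 0, _, _ => 0
  | _ + 1, I, s => primIntegral I (rounded θ (I 0) (s (vtx 0))) s -
      jump (rounded θ (I 0)) s * cochain θ (fun a => I a.succ) (s ∘ face 0)

/-- Stokes' theorem for `prim I c`, with `c` depending on the first vertex.  Only the face opposite to
the first vertex of `s` has another first vertex. -/
theorem sum_primIntegral_vtx {r m : ℕ} (I : Fin (m + 1) → Fin r) (f : (Fin r → ℝ) → ℤ)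
    {s : (Fin (m + 2) → ℝ) → Fin r → ℝ} (hs : ContDiff ℝ ∞ s) :
    ∑ a : Fin (m + 2), (-1) ^ (a : ℕ) *
        primIntegral I (f ((s ∘ face a) (vtx 0))) (s ∘ face a) =
      formIntegral I s - jump f s * formIntegral (fun a => I a.succ) (s ∘ face 0) := by
  rw [formIntegral_eq_sum_primIntegral I (f (s (vtx 0))) hs]
  simp only [Fin.sum_univ_succ (n := m + 1)]
  simp only [Function.comp_apply, face_zero_vtx, face_succ_vtx_zero, zero_add]
  rw [primIntegral_sub I (f (s (vtx 1))) (f (s (vtx 0))) (hs.comp (contDiff_face 0)), jump]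
  simp
  ring

/-- The coboundary of `cochain θ I` is `formIntegral I` modulo integers. -/
theorem formIntegral_eq_sum_cochain_add_int {r : ℕ} (θ : Fin r → ℝ) {m : ℕ} (I : Fin m → Fin r)
    {s : (Fin (m + 1) → ℝ) → Fin r → ℝ} (hs : ContDiff ℝ ∞ s) :
    ∃ N : ℤ, formIntegral I s =
      ∑ a : Fin (m + 1), (-1) ^ (a : ℕ) * cochain θ I (s ∘ face a) + N := by
  induction m with
  | zero =>
    -- the integral of the constant `1` over a point
    refine ⟨1, ?_⟩
    have : coordSimplex 0 = Set.univ := by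
      ext y; simp [coordSimplex]
    simp [formIntegral, cochain, detForm_apply, this, Measure.real, volume_pi]
  | succ m ih =>
    obtain ⟨N, hN⟩ := ih (fun a => I a.succ) (hs.comp (contDiff_face 0))
    refine ⟨(rounded θ (I 0) (s (vtx 1)) - rounded θ (I 0) (s (vtx 0))) * N, ?_⟩
    have h1 := sum_primIntegral_vtx I (rounded θ (I 0)) hs
    have h2 := sum_jump_mul (rounded θ (I 0)) (cochain θ fun a => I a.succ) s
    simp only [cochain, mul_sub, Finset.sum_sub_distrib, Function.comp_assoc] at hN ⊢
    rw [h1, h2, hN]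
    simp only [jump]
    push_cast
    ring

/-! ### Smooth families of simplices and integrals depending on parameters -/

section Parameters

variable {E : Type*} [NormedAddCommGroup E] [NormedSpace ℝ E]

/-- The velocity of a family of maps in the direction `X` of the parameter space. -/
def velocity {A F : Type*} [NormedAddCommGroup F] [NormedSpace ℝ F] (L : E → A → F) (x X : E)
    (t : A) : F :=
  fderiv ℝ (fun x' => L x' t) x X

variable {r : ℕ} {V : Set E} {n : ℕ} {L : E → (Fin (n + 1) → ℝ) → Fin r → ℝ}

theorem contDiffOn_uncurry_param (hL : ContDiffOn ℝ ∞ (Function.uncurry L) (V ×ˢ Set.univ)) :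
    ContDiffOn ℝ ∞ (fun z : E × (Fin n → ℝ) => L z.1 (param z.2)) (V ×ˢ Set.univ) := by
  have h : ContDiff ℝ ∞ fun z : E × (Fin n → ℝ) => (z.1, param z.2) :=
    contDiff_fst.prodMk (contDiff_param.comp contDiff_snd)
  exact hL.comp h.contDiffOn fun z hz => ⟨hz.1, trivial⟩

theorem contDiff_of_uncurry {A F : Type*} [NormedAddCommGroup A] [NormedSpace ℝ A]
    [NormedAddCommGroup F] [NormedSpace ℝ F] {L : E → A → F}
    (hL : ContDiffOn ℝ ∞ (Function.uncurry L) (V ×ˢ Set.univ)) {x : E} (hx : x ∈ V) :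
    ContDiff ℝ ∞ (L x) := by
  have h : ContDiff ℝ ∞ fun t : A => (x, t) := contDiff_prodMk_right x
  rw [← contDiffOn_univ] at h ⊢
  exact hL.comp h fun t _ => ⟨hx, trivial⟩

theorem continuous_velocity {A F : Type*} [NormedAddCommGroup A] [NormedSpace ℝ A]
    [NormedAddCommGroup F] [NormedSpace ℝ F] {L : E → A → F} (hV : IsOpen V)
    (hL : ContDiffOn ℝ ∞ (Function.uncurry L) (V ×ˢ Set.univ)) {x : E} (hx : x ∈ V) (X : E) :
    Continuous (velocity L x X) := by
  have h3 := (hL.continuousOn_fderiv_of_isOpen (hV.prod isOpen_univ) (by simp)).clm_apply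
    (continuousOn_const (c := (X, 0)))
  have h4 := h3.comp (f := fun t : A => (x, t)) (s := Set.univ) (by fun_prop)
    fun y _ => ⟨hx, trivial⟩
  rw [continuousOn_univ] at h4
  convert h4 using 1
  ext1 t
  have hd : HasFDerivAt (Function.uncurry L) (fderiv ℝ (Function.uncurry L) (x, t)) (x, t) :=
    ((hL.contDiffAt ((hV.prod isOpen_univ).mem_nhds ⟨hx, trivial⟩)).differentiableAt
      (by simp)).hasFDerivAt
  have h := HasFDerivAt.comp (f := fun x' => (x', t)) x hd (hasFDerivAt_prodMk_left x t)
  have h' : HasFDerivAt (fun x' => L x' t) _ x := h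
  rw [velocity, h'.fderiv]
  rfl

theorem hasFDerivAt_of_uncurry {A F : Type*} [NormedAddCommGroup A] [NormedSpace ℝ A]
    [NormedAddCommGroup F] [NormedSpace ℝ F] {L : E → A → F} (hV : IsOpen V)
    (hL : ContDiffOn ℝ ∞ (Function.uncurry L) (V ×ˢ Set.univ)) {x : E} (hx : x ∈ V) (t : A) :
    HasFDerivAt (fun x' => L x' t) (fderiv ℝ (fun x' => L x' t) x) x := by
  have hd : DifferentiableAt ℝ (Function.uncurry L) (x, t) :=
    (hL.contDiffAt ((hV.prod isOpen_univ).mem_nhds ⟨hx, trivial⟩)).differentiableAt (by simp)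
  have h := DifferentiableAt.comp (f := fun x' => (x', t)) x hd (by fun_prop)
  exact DifferentiableAt.hasFDerivAt h

theorem contDiffOn_uncurry_comp_face {p : ℕ} {L : E → (Fin (p + 1) → ℝ) → Fin r → ℝ}
    (hL : ContDiffOn ℝ ∞ (Function.uncurry L) (V ×ˢ Set.univ)) (a : Fin (p + 1)) :
    ContDiffOn ℝ ∞ (Function.uncurry fun x => L x ∘ face a) (V ×ˢ Set.univ) := by
  have h : ContDiff ℝ ∞ fun z : E × (Fin p → ℝ) => (z.1, face a z.2) :=
    contDiff_fst.prodMk ((contDiff_face a).comp contDiff_snd)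
  exact hL.comp h.contDiffOn fun z hz => ⟨hz.1, trivial⟩

theorem hasFDerivAt_uncurry_param (hV : IsOpen V)
    (hL : ContDiffOn ℝ ∞ (Function.uncurry L) (V ×ˢ Set.univ)) {x : E} (hx : x ∈ V)
    (y : Fin n → ℝ) :
    HasFDerivAt (fun z : E × (Fin n → ℝ) => L z.1 (param z.2))
      (fderiv ℝ (fun z : E × (Fin n → ℝ) => L z.1 (param z.2)) (x, y)) (x, y) :=
  (((contDiffOn_uncurry_param hL).contDiffAt
    ((hV.prod isOpen_univ).mem_nhds ⟨hx, trivial⟩)).differentiableAt (by simp)).hasFDerivAt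

theorem fderiv_uncurry_param_inr (hV : IsOpen V)
    (hL : ContDiffOn ℝ ∞ (Function.uncurry L) (V ×ˢ Set.univ)) {x : E} (hx : x ∈ V)
    (y w : Fin n → ℝ) :
    fderiv ℝ (fun z : E × (Fin n → ℝ) => L z.1 (param z.2)) (x, y) (0, w) =
      fderiv ℝ (fun y' => L x (param y')) y w := by
  have h := (hasFDerivAt_uncurry_param hV hL hx y).comp y (hasFDerivAt_prodMk_right x y)
  have h' : HasFDerivAt (fun y' => L x (param y')) _ y := h
  rw [h'.fderiv]
  rfl

theorem fderiv_uncurry_param_inl (hV : IsOpen V)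
    (hL : ContDiffOn ℝ ∞ (Function.uncurry L) (V ×ˢ Set.univ)) {x : E} (hx : x ∈ V)
    (y : Fin n → ℝ) (X : E) :
    fderiv ℝ (fun z : E × (Fin n → ℝ) => L z.1 (param z.2)) (x, y) (X, 0) =
      velocity L x X (param y) := by
  have h := HasFDerivAt.comp (f := fun x' => (x', y)) x
    (hasFDerivAt_uncurry_param hV hL hx y) (hasFDerivAt_prodMk_left x y)
  have h' : HasFDerivAt (fun x' => L x' (param y)) _ x := h
  rw [velocity, h'.fderiv]
  rfl

/-- The integral of `prim I c` over a member of a family, in terms of the pullback to the product of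
the parameter space and the simplex. -/
theorem primIntegral_eq_integral_pullbackPrim (hV : IsOpen V)
    (hL : ContDiffOn ℝ ∞ (Function.uncurry L) (V ×ˢ Set.univ)) {x : E} (hx : x ∈ V)
    (I : Fin (n + 1) → Fin r) (c : ℝ) :
    primIntegral I c (L x) = ∫ y in coordSimplex n,
      pullbackPrim I c (fun z : E × (Fin n → ℝ) => L z.1 (param z.2)) (x, y)
        fun i => (0, Pi.single i 1) := by
  refine setIntegral_congr_fun (measurableSet_coordSimplex _) fun y _ => ?_
  simp only [pullbackPrim_apply, fderiv_uncurry_param_inr hV hL hx]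
  rfl

variable [FiniteDimensional ℝ E]

/-- Differentiation under the integral sign. -/
theorem hasFDerivAt_integral_coordSimplex {n : ℕ} {V : Set E} (hV : IsOpen V)
    {G : E × (Fin n → ℝ) → ℝ} (hG : ContDiffOn ℝ ∞ G (V ×ˢ Set.univ)) {x₀ : E} (hx₀ : x₀ ∈ V) :
    IntegrableOn (fun y => (fderiv ℝ G (x₀, y)).comp (ContinuousLinearMap.inl ℝ E (Fin n → ℝ)))
      (coordSimplex n) ∧
    HasFDerivAt (fun x => ∫ y in coordSimplex n, G (x, y))
      (∫ y in coordSimplex n,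
        (fderiv ℝ G (x₀, y)).comp (ContinuousLinearMap.inl ℝ E (Fin n → ℝ))) x₀ := by
  have hVo : IsOpen (V ×ˢ (Set.univ : Set (Fin n → ℝ))) := hV.prod isOpen_univ
  have hG' : ContinuousOn (fun z => (fderiv ℝ G z).comp (ContinuousLinearMap.inl ℝ E (Fin n → ℝ)))
      (V ×ˢ Set.univ) :=
    (hG.continuousOn_fderiv_of_isOpen hVo (by simp)).clm_comp continuousOn_const
  have hslice : ∀ x ∈ V, ContinuousOn (fun y : Fin n → ℝ => (x, y)) Set.univ ∧
      Set.MapsTo (fun y : Fin n → ℝ => (x, y)) Set.univ (V ×ˢ Set.univ) := fun x hx =>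
    ⟨(by fun_prop), fun y _ => ⟨hx, trivial⟩⟩
  have hc : ∀ x ∈ V, Continuous fun y : Fin n → ℝ => G (x, y) := fun x hx =>
    continuousOn_univ.1 (hG.continuousOn.comp (hslice x hx).1 (hslice x hx).2)
  have hc' : ∀ x ∈ V, Continuous fun y : Fin n → ℝ =>
      (fderiv ℝ G (x, y)).comp (ContinuousLinearMap.inl ℝ E (Fin n → ℝ)) := fun x hx =>
    continuousOn_univ.1 (hG'.comp (hslice x hx).1 (hslice x hx).2)
  obtain ⟨K, hK, hKx, hKV⟩ := exists_compact_subset hV hx₀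
  obtain ⟨C, hC⟩ := (hK.prod (isCompact_coordSimplex n)).exists_bound_of_continuousOn
    (hG'.mono (Set.prod_mono hKV (Set.subset_univ _)))
  refine ⟨(hc' x₀ hx₀).integrableOn_coordSimplex, ?_⟩
  refine hasFDerivAt_integral_of_dominated_of_fderiv_le (s := K) (bound := fun _ => C)
    (F' := fun x y => (fderiv ℝ G (x, y)).comp (ContinuousLinearMap.inl ℝ E (Fin n → ℝ)))
    (mem_interior_iff_mem_nhds.1 hKx) ?_ (hc x₀ hx₀).integrableOn_coordSimplex
    (hc' x₀ hx₀).aestronglyMeasurable ?_ ?_ ?_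
  · filter_upwards [hV.mem_nhds hx₀] with x hx using (hc x hx).aestronglyMeasurable
  · filter_upwards [ae_restrict_mem (measurableSet_coordSimplex n)] with y hy x hx using
      hC (x, y) ⟨hx, hy⟩
  · exact (continuous_const (y := C)).integrableOn_coordSimplex
  · refine ae_of_all _ fun y x hx => ?_
    have hd : HasFDerivAt G (fderiv ℝ G (x, y)) (x, y) :=
      ((hG.contDiffAt (hVo.mem_nhds ⟨hKV hx, trivial⟩)).differentiableAt (by simp)).hasFDerivAt
    exact hd.comp x (hasFDerivAt_prodMk_left x y)

theorem fderiv_integral_coordSimplex {n : ℕ} {V : Set E} (hV : IsOpen V)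
    {G : E × (Fin n → ℝ) → ℝ} (hG : ContDiffOn ℝ ∞ G (V ×ˢ Set.univ)) {x₀ : E} (hx₀ : x₀ ∈ V)
    (X : E) :
    fderiv ℝ (fun x => ∫ y in coordSimplex n, G (x, y)) x₀ X =
      ∫ y in coordSimplex n, fderiv ℝ G (x₀, y) (X, 0) := by
  obtain ⟨h1, h2⟩ := hasFDerivAt_integral_coordSimplex hV hG hx₀
  rw [h2.fderiv, ContinuousLinearMap.integral_apply h1]
  rfl

theorem contDiffOn_integral_coordSimplex {n : ℕ} {V : Set E} (hV : IsOpen V)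
    {G : E × (Fin n → ℝ) → ℝ} (hG : ContDiffOn ℝ ∞ G (V ×ˢ Set.univ)) :
    ContDiffOn ℝ ∞ (fun x => ∫ y in coordSimplex n, G (x, y)) V := by
  rw [contDiffOn_infty]
  intro k
  induction k generalizing G with
  | zero =>
    rw [Nat.cast_zero, contDiffOn_zero]
    exact fun x hx =>
      (hasFDerivAt_integral_coordSimplex hV hG hx).2.continuousAt.continuousWithinAt
  | succ k ih =>
    rw [Nat.cast_succ, contDiffOn_succ_iff_fderiv_apply hV.uniqueDiffOn]
    refine ⟨fun x hx => (hasFDerivAt_integral_coordSimplex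
      hV hG hx).2.differentiableAt.differentiableWithinAt, by simp, fun X => ?_⟩
    have h1 : ContDiffOn ℝ ∞ (fun z => fderiv ℝ G z (X, 0)) (V ×ˢ Set.univ) :=
      (hG.fderiv_of_isOpen (hV.prod isOpen_univ) (by simp)).clm_apply contDiffOn_const
    refine (ih h1).congr fun x hx => ?_
    rw [fderivWithin_of_isOpen hV hx, fderiv_integral_coordSimplex hV hG hx]

theorem contDiffOn_pullbackPrim_apply (hV : IsOpen V)
    (hL : ContDiffOn ℝ ∞ (Function.uncurry L) (V ×ˢ Set.univ)) {m : ℕ} (I : Fin (m + 1) → Fin r)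
    (c : ℝ) (w : Fin m → E × (Fin n → ℝ)) :
    ContDiffOn ℝ ∞ (fun z => pullbackPrim I c
      (fun z : E × (Fin n → ℝ) => L z.1 (param z.2)) z w) (V ×ˢ Set.univ) :=
  (ContinuousAlternatingMap.apply ℝ _ ℝ w).contDiff.comp_contDiffOn
    (contDiffOn_pullbackPrim I c (contDiffOn_uncurry_param hL) (hV.prod isOpen_univ))

theorem contDiffOn_primIntegral (hV : IsOpen V)
    (hL : ContDiffOn ℝ ∞ (Function.uncurry L) (V ×ˢ Set.univ)) (I : Fin (n + 1) → Fin r) (c : ℝ) :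
    ContDiffOn ℝ ∞ (fun x => primIntegral I c (L x)) V :=
  (contDiffOn_integral_coordSimplex hV
    (contDiffOn_pullbackPrim_apply hV hL I c fun i => (0, Pi.single i 1))).congr fun _ hx =>
      primIntegral_eq_integral_pullbackPrim hV hL hx I c

theorem fderiv_primIntegral (hV : IsOpen V)
    (hL : ContDiffOn ℝ ∞ (Function.uncurry L) (V ×ˢ Set.univ)) (I : Fin (n + 1) → Fin r) (c : ℝ)
    {x : E} (hx : x ∈ V) (X : E) :
    fderiv ℝ (fun x => primIntegral I c (L x)) x X = ∫ y in coordSimplex n,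
      fderiv ℝ (fun z => pullbackPrim I c
        (fun z : E × (Fin n → ℝ) => L z.1 (param z.2)) z fun i => (0, Pi.single i 1))
        (x, y) (X, 0) := by
  rw [← fderiv_integral_coordSimplex hV (contDiffOn_pullbackPrim_apply hV hL I c _) hx]
  refine congrArg (fun f : E →L[ℝ] ℝ => f X) (Filter.EventuallyEq.fderiv_eq ?_)
  filter_upwards [hV.mem_nhds hx] with x hx using
    primIntegral_eq_integral_pullbackPrim hV hL hx I c

/-- The exterior derivative of the pullback of `prim I c` along a family, on a direction `X` of the
parameter space and the coordinate directions of the simplex. -/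
theorem detForm_cons_velocity (hV : IsOpen V)
    (hL : ContDiffOn ℝ ∞ (Function.uncurry L) (V ×ˢ Set.univ)) (I : Fin (n + 1) → Fin r) (c : ℝ)
    {x : E} (hx : x ∈ V) (X : E) (y : Fin n → ℝ) :
    detForm I (Fin.cons (velocity L x X (param y)) (partialDeriv (L x) y) :
        Fin (n + 1) → Fin r → ℝ) =
      fderiv ℝ (fun z => pullbackPrim I c
        (fun z : E × (Fin n → ℝ) => L z.1 (param z.2)) z fun i => (0, Pi.single i 1))
        (x, y) (X, 0) +
      ∑ i : Fin n, (-1) ^ ((i : ℕ) + 1) * fderiv ℝ (fun z => pullbackPrim I c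
        (fun z : E × (Fin n → ℝ) => L z.1 (param z.2)) z
          (i.succ.removeNth (Fin.cons (X, 0) fun i => ((0 : E), Pi.single i 1) :
            Fin (n + 1) → E × (Fin n → ℝ)))) (x, y) (0, Pi.single i 1) := by
  have hxy : V ×ˢ Set.univ ∈ 𝓝 (x, y) := (hV.prod isOpen_univ).mem_nhds ⟨hx, trivial⟩
  have h := extDeriv_pullbackPrim I c ((contDiffOn_uncurry_param hL).contDiffAt hxy)
    (Fin.cons (X, 0) fun i => ((0 : E), Pi.single i 1))
  rw [extDeriv_apply (((contDiffOn_pullbackPrim I c (contDiffOn_uncurry_param hL)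
    (hV.prod isOpen_univ)).contDiffAt hxy).differentiableAt (by simp)), Fin.sum_univ_succ] at h
  simp only [Fin.cons_zero, Fin.cons_succ, Fin.val_zero, pow_zero, one_smul, zsmul_eq_mul,
    Int.cast_pow, Int.cast_neg, Int.cast_one, Fin.val_succ] at h
  rw [show Fin.removeNth (0 : Fin (n + 1)) (Fin.cons (X, 0) fun i => ((0 : E), Pi.single i 1) :
            Fin (n + 1) → E × (Fin n → ℝ)) = fun i => (0, Pi.single i 1) from rfl] at h
  rw [h]
  congr 1
  ext1 i
  refine Fin.cases ?_ (fun i => ?_) i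
  · simp only [Fin.cons_zero, fderiv_uncurry_param_inl hV hL hx]
  · simp only [Fin.cons_succ, fderiv_uncurry_param_inr hV hL hx]
    rfl

/-- The variation of the integral of `prim I c` over a point. -/
theorem fderiv_primIntegral_zero {L : E → (Fin (0 + 1) → ℝ) → Fin r → ℝ} (hV : IsOpen V)
    (hL : ContDiffOn ℝ ∞ (Function.uncurry L) (V ×ˢ Set.univ)) (I : Fin (0 + 1) → Fin r) (c : ℝ)
    {x : E} (hx : x ∈ V) (X : E) :
    fderiv ℝ (fun x => primIntegral I c (L x)) x X =
      formIntegralVar I (L x) (velocity L x X) := by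
  rw [fderiv_primIntegral hV hL I c hx X, formIntegralVar]
  refine setIntegral_congr_fun (measurableSet_coordSimplex _) fun y _ => ?_
  simp [detForm_cons_velocity hV hL I c hx X y]

/-- The formula for the variation of the integral of `prim I c`: the Lie derivative formula,
together with Stokes' theorem on the simplex. -/
theorem fderiv_primIntegral_succ {p : ℕ} {L : E → (Fin (p + 2) → ℝ) → Fin r → ℝ} (hV : IsOpen V)
    (hL : ContDiffOn ℝ ∞ (Function.uncurry L) (V ×ˢ Set.univ)) (I : Fin (p + 2) → Fin r) (c : ℝ)
    {x : E} (hx : x ∈ V) (X : E) :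
    fderiv ℝ (fun x => primIntegral I c (L x)) x X =
      formIntegralVar I (L x) (velocity L x X) +
        ∑ a : Fin (p + 2), (-1) ^ (a : ℕ) *
          primIntegralVar I c (L x ∘ face a) (velocity L x X ∘ face a) := by
  set Φ : E × (Fin (p + 1) → ℝ) → Fin r → ℝ := fun z => L z.1 (param z.2) with hΦ
  have hΦs : ContDiffOn ℝ ∞ Φ (V ×ˢ Set.univ) := contDiffOn_uncurry_param hL
  have hpr : ∀ w, ContDiff ℝ ∞ fun y : Fin (p + 1) → ℝ => pullbackPrim I c Φ (x, y) w := by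
    intro w
    have h : ContDiff ℝ ∞ fun t : Fin (p + 1) → ℝ => (x, t) := contDiff_prodMk_right x
    rw [← contDiffOn_univ] at h ⊢
    exact (contDiffOn_pullbackPrim_apply hV hL I c w).comp h fun t _ => ⟨hx, trivial⟩
  -- the contraction with `X` of the pullback of `prim I c`, restricted to the fibre over `x`
  let ζ : (Fin (p + 1) → ℝ) → (Fin (p + 1) → ℝ) [⋀^Fin p]→L[ℝ] ℝ := fun y =>
    ((pullbackPrim I c Φ (x, y)).curryLeft (X, 0)).compContinuousLinearMap
      (ContinuousLinearMap.inr ℝ E (Fin (p + 1) → ℝ))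
  have hζ : ∀ y w, ζ y w = pullbackPrim I c Φ (x, y) (Fin.cons (X, 0) fun i => (0, w i)) :=
    fun _ _ => rfl
  have hζs : ContDiff ℝ ∞ ζ := by
    rw [← contDiffOn_univ]
    refine contDiffOn_of_apply fun w => ?_
    simp only [hζ]
    exact (hpr _).contDiffOn
  -- By Stokes' theorem, the integral of `extDeriv ζ` gives the terms of the faces; it accounts for
  -- the summands of `detForm_cons_velocity` with derivatives along the simplex.
  have hst := integral_extDeriv_coordSimplex (hζs.of_le (by simp))
  have hface : ∀ a : Fin (p + 2), (∫ y in coordSimplex p,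
      ζ (coordFace a y) fun m => fderiv ℝ (coordFace a) y (Pi.single m 1)) =
      primIntegralVar I c (L x ∘ face a) (velocity L x X ∘ face a) := by
    intro a
    refine setIntegral_congr_fun (measurableSet_coordSimplex _) fun y _ => ?_
    simp only [hζ, pullbackPrim_apply, Function.comp_apply, ← param_coordFace, hΦ]
    congr 1
    ext1 i
    refine Fin.cases ?_ (fun i => ?_) i
    · simp only [Fin.cons_zero, fderiv_uncurry_param_inl hV hL hx]
    · simp only [Fin.cons_succ, fderiv_uncurry_param_inr hV hL hx]
      exact (partialDeriv_comp_face (contDiff_of_uncurry hL hx) a y i).symm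
  simp only [hface] at hst
  rw [← hst, fderiv_primIntegral hV hL I c hx X, formIntegralVar, ← integral_add]
  · refine setIntegral_congr_fun (measurableSet_coordSimplex _) fun y _ => ?_
    simp only [detForm_cons_velocity hV hL I c hx X y]
    rw [add_assoc, left_eq_add, extDeriv_apply ((hζs.differentiable (by simp)) y),
      ← Finset.sum_add_distrib]
    refine Finset.sum_eq_zero fun i _ => ?_
    have hd : HasFDerivAt (fun z => pullbackPrim I c Φ z
        (i.succ.removeNth (Fin.cons (X, 0) fun i => ((0 : E), Pi.single i 1) :
            Fin (p + 2) → E × (Fin (p + 1) → ℝ)))) _ (x, y) :=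
      (((contDiffOn_pullbackPrim_apply hV hL I c _).contDiffAt
        ((hV.prod isOpen_univ).mem_nhds ⟨hx, trivial⟩)).differentiableAt (by simp)).hasFDerivAt
    have hd' := hd.comp y (hasFDerivAt_prodMk_right x y)
    have hrem : (i.succ.removeNth (Fin.cons (X, 0) fun i => ((0 : E), Pi.single i 1) :
        Fin (p + 2) → E × (Fin (p + 1) → ℝ))) = Fin.cons (X, 0) fun j =>
          ((0 : E), i.removeNth (fun i => (Pi.single i 1 : Fin (p + 1) → ℝ)) j) := by
      ext1 j
      refine Fin.cases ?_ (fun j => ?_) j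
      · simp [Fin.removeNth]
      · simp [Fin.removeNth]
    have heq : (fun y => ζ y (i.removeNth fun i => (Pi.single i 1 : Fin (p + 1) → ℝ))) =
        (fun z => pullbackPrim I c Φ z (i.succ.removeNth (Fin.cons (X, 0)
          fun i => ((0 : E), Pi.single i 1) : Fin (p + 2) → E × (Fin (p + 1) → ℝ)))) ∘
            Prod.mk x := by
      ext1 y
      simp only [hζ, hrem, Function.comp_apply]
    rw [heq, hd'.fderiv]
    simp only [zsmul_eq_mul, Int.cast_pow, Int.cast_neg, Int.cast_one, pow_succ]
    simp
  · exact ((detForm I).cont.comp (continuous_cons_partialDeriv (contDiff_of_uncurry hL hx)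
      (continuous_velocity hV hL hx X))).integrableOn_coordSimplex
  · refine Continuous.integrableOn_coordSimplex ?_
    have h1 : ContDiff ℝ ∞ ζ := hζs
    have h2 : Continuous fun y => fderiv ℝ ζ y := h1.continuous_fderiv (by simp)
    exact (ContinuousAlternatingMap.apply ℝ _ ℝ _).continuous.comp
      ((ContinuousAlternatingMap.alternatizeUncurryFinCLM ℝ _ ℝ).continuous.comp h2)

end Parameters

/-! ### Invariance under integral translations -/

/-- The frontier of the simplex is negligible.  This is used for lifts of simplices, which determine
each other, and their derivatives, only on the standard simplex. -/
theorem setIntegral_coordSimplex_congr {n : ℕ} {f g : (Fin n → ℝ) → ℝ}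
    (h : ∀ y ∈ interior (coordSimplex n), f y = g y) :
    ∫ y in coordSimplex n, f y = ∫ y in coordSimplex n, g y := by
  refine setIntegral_congr_ae (measurableSet_coordSimplex n) ?_
  have h0 : ∀ᵐ y ∂(volume : Measure (Fin n → ℝ)), y ∉ frontier (coordSimplex n) :=
    measure_eq_zero_iff_ae_notMem.1 ((convex_coordSimplex n).addHaar_frontier volume)
  filter_upwards [h0] with y hy hyΔ
  refine h y ?_
  by_contra hyi
  exact hy ⟨subset_closure hyΔ, hyi⟩

/-- On the standard simplex, `s` and `s'` differ by a constant integral vector. -/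
def IntShift {r n : ℕ} (z : Fin r → ℤ) (s s' : (Fin n → ℝ) → Fin r → ℝ) : Prop :=
  ∀ t ∈ stdSimplex ℝ (Fin n), ∀ i, s t i = s' t i + z i

/-- On the standard simplex, `s` and `s'` agree modulo integral vectors. -/
def EqModInt {r n : ℕ} (s s' : (Fin n → ℝ) → Fin r → ℝ) : Prop :=
  ∀ t ∈ stdSimplex ℝ (Fin n), ∀ i, ∃ z : ℤ, s t i - s' t i = z

theorem isClosed_range_intCast : IsClosed (Set.range ((↑) : ℤ → ℝ)) :=
  Int.isClosedEmbedding_coe_real.isClosed_range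

/-- The difference is continuous with values in a discrete set, and the simplex is connected. -/
theorem EqModInt.exists_intShift {r n : ℕ} {s s' : (Fin n → ℝ) → Fin r → ℝ} (h : EqModInt s s')
    (hs : Continuous s) (hs' : Continuous s') : ∃ z, IntShift z s s' := by
  have hd : DiscreteTopology (Set.range ((↑) : ℤ → ℝ)) :=
    Int.isClosedEmbedding_coe_real.isEmbedding.toHomeomorph.symm.isEmbedding.discreteTopology
  have key : ∀ i, ∃ z : ℤ, ∀ t ∈ stdSimplex ℝ (Fin n), s t i - s' t i = z := by
    intro i
    obtain ⟨y, ⟨z, rfl⟩, hz⟩ := (convex_stdSimplex ℝ (Fin n)).isPreconnected.eqOn_const_of_mapsTo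
      (T := Set.range ((↑) : ℤ → ℝ)) (f := fun t => s t i - s' t i)
      ⟨hd⟩ (by fun_prop)
      (fun t ht => by
        obtain ⟨z, hz⟩ := h t ht i
        exact ⟨z, hz.symm⟩) ⟨0, 0, by simp⟩
    exact ⟨z, fun t ht => hz ht⟩
  choose z hz using key
  exact ⟨z, fun t ht i => by linarith [hz i t ht]⟩

theorem face_mem_stdSimplex {n : ℕ} (a : Fin (n + 1)) {t : Fin n → ℝ}
    (ht : t ∈ stdSimplex ℝ (Fin n)) : face a t ∈ stdSimplex ℝ (Fin (n + 1)) := by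
  refine ⟨fun i => ?_, ?_⟩
  · rcases Fin.eq_self_or_eq_succAbove a i with rfl | ⟨i, rfl⟩
    · simp [face]
    · simpa [face] using ht.1 i
  · rw [Fin.sum_univ_succAbove _ a]
    simpa [face] using ht.2

theorem vtx_mem_stdSimplex {n k : ℕ} (hk : k < n) : (vtx k : Fin n → ℝ) ∈ stdSimplex ℝ (Fin n) := by
  have : (vtx k : Fin n → ℝ) = Pi.single ⟨k, hk⟩ 1 := by
    ext j
    simp [vtx, Pi.single_apply, Fin.ext_iff]
  rw [this]
  exact single_mem_stdSimplex ℝ _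

theorem IntShift.comp_face {r n : ℕ} {z : Fin r → ℤ} {s s' : (Fin (n + 1) → ℝ) → Fin r → ℝ}
    (h : IntShift z s s') (a : Fin (n + 1)) : IntShift z (s ∘ face a) (s' ∘ face a) :=
  fun _ ht => h _ (face_mem_stdSimplex a ht)

theorem IntShift.rounded_vtx {r n k : ℕ} {z : Fin r → ℤ} {s s' : (Fin n → ℝ) → Fin r → ℝ}
    (h : IntShift z s s') (hk : k < n) (θ : Fin r → ℝ) (i : Fin r) :
    rounded θ i (s (vtx k)) = rounded θ i (s' (vtx k)) + z i := by
  rw [rounded, rounded, h _ (vtx_mem_stdSimplex hk), ← Int.floor_add_intCast]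
  congr 1
  ring

theorem IntShift.jump_eq {r n : ℕ} {z : Fin r → ℤ} {s s' : (Fin (n + 2) → ℝ) → Fin r → ℝ}
    (h : IntShift z s s') (θ : Fin r → ℝ) (i : Fin r) :
    jump (rounded θ i) s = jump (rounded θ i) s' := by
  rw [jump, jump, h.rounded_vtx (by omega), h.rounded_vtx (by omega)]
  push_cast
  ring

theorem IntShift.partialDeriv_eq {r n : ℕ} {z : Fin r → ℤ} {s s' : (Fin (n + 1) → ℝ) → Fin r → ℝ}
    (h : IntShift z s s') {y : Fin n → ℝ} (hy : y ∈ interior (coordSimplex n)) :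
    partialDeriv s y = partialDeriv s' y := by
  have h1 : (fun y => s (param y)) =ᶠ[𝓝 y] fun y => s' (param y) + fun i => (z i : ℝ) := by
    filter_upwards [mem_interior_iff_mem_nhds.1 hy] with y hy
    ext i
    exact h _ (param_mem_stdSimplex hy) i
  ext1 m
  rw [partialDeriv, partialDeriv, h1.fderiv_eq, fderiv_add_const]

theorem IntShift.formIntegral_eq {r m : ℕ} {z : Fin r → ℤ} {s s' : (Fin (m + 1) → ℝ) → Fin r → ℝ}
    (h : IntShift z s s') (I : Fin m → Fin r) : formIntegral I s = formIntegral I s' :=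
  setIntegral_coordSimplex_congr fun y hy => by rw [h.partialDeriv_eq hy]

theorem IntShift.primIntegral_eq {r m : ℕ} {z : Fin r → ℤ} {s s' : (Fin (m + 1) → ℝ) → Fin r → ℝ}
    (h : IntShift z s s') (I : Fin (m + 1) → Fin r) (c : ℝ) :
    primIntegral I (c + z (I 0)) s = primIntegral I c s' :=
  setIntegral_coordSimplex_congr fun y hy => by
    rw [h.partialDeriv_eq hy, prim, prim, h _ (param_mem_stdSimplex (interior_subset hy)),
      add_sub_add_right_eq_sub]

theorem IntShift.primIntegralVar_eq {r m : ℕ} {z : Fin r → ℤ}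
    {s s' v v' : (Fin (m + 1) → ℝ) → Fin r → ℝ} (h : IntShift z s s')
    (hv : Set.EqOn v v' (stdSimplex ℝ (Fin (m + 1)))) (I : Fin (m + 2) → Fin r) (c : ℝ) :
    primIntegralVar I (c + z (I 0)) s v = primIntegralVar I c s' v' :=
  setIntegral_coordSimplex_congr fun y hy => by
    rw [h.partialDeriv_eq hy, prim, prim, h _ (param_mem_stdSimplex (interior_subset hy)),
      add_sub_add_right_eq_sub, hv (param_mem_stdSimplex (interior_subset hy))]

theorem IntShift.cochain_eq {r m : ℕ} {z : Fin r → ℤ} {s s' : (Fin m → ℝ) → Fin r → ℝ}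
    (h : IntShift z s s') (θ : Fin r → ℝ) (I : Fin m → Fin r) :
    cochain θ I s = cochain θ I s' := by
  induction m with
  | zero => rfl
  | succ m ih =>
    have h1 : primIntegral I (rounded θ (I 0) (s (vtx 0))) s =
        primIntegral I (rounded θ (I 0) (s' (vtx 0))) s' := by
      rw [h.rounded_vtx (Nat.succ_pos m), Int.cast_add, h.primIntegral_eq]
    simp only [cochain, h1, ih (h.comp_face 0)]
    cases m with
    | zero => simp [cochain]
    | succ m => rw [h.jump_eq]

/-! ### The variation of the cochain -/

/-- The correction term in the variation of `cochain θ I`: a cochain on simplices `s` with a vector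
field `v`, whose coboundary is the difference of the variation of `cochain θ I` and
`formIntegralVar I`. -/
def cochainVar {r : ℕ} (θ : Fin r → ℝ) :
    ∀ {p : ℕ}, (Fin (p + 1) → Fin r) → (s v : (Fin p → ℝ) → Fin r → ℝ) → ℝ
  | 0, _, _, _ => 0
  | _ + 1, I, s, v => primIntegralVar I (rounded θ (I 0) (s (vtx 0))) s v +
      jump (rounded θ (I 0)) s * cochainVar θ (fun a => I a.succ) (s ∘ face 0) (v ∘ face 0)

theorem IntShift.cochainVar_eq {r p : ℕ} {z : Fin r → ℤ} {s s' v v' : (Fin p → ℝ) → Fin r → ℝ}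
    (h : IntShift z s s') (hv : Set.EqOn v v' (stdSimplex ℝ (Fin p))) (θ : Fin r → ℝ)
    (I : Fin (p + 1) → Fin r) : cochainVar θ I s v = cochainVar θ I s' v' := by
  induction p with
  | zero => rfl
  | succ p ih =>
    have h1 : primIntegralVar I (rounded θ (I 0) (s (vtx 0))) s v =
        primIntegralVar I (rounded θ (I 0) (s' (vtx 0))) s' v' := by
      rw [h.rounded_vtx (Nat.succ_pos p), Int.cast_add, h.primIntegralVar_eq hv]
    have h2 := ih (v := v ∘ face 0) (v' := v' ∘ face 0) (h.comp_face 0)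
      (fun t ht => hv (face_mem_stdSimplex 0 ht)) fun a => I a.succ
    simp only [cochainVar, h1, h2]
    cases p with
    | zero => simp [cochainVar]
    | succ m => rw [h.jump_eq]

theorem primIntegralVar_sub {r m : ℕ} (I : Fin (m + 2) → Fin r) (c c' : ℝ)
    {s v : (Fin (m + 1) → ℝ) → Fin r → ℝ} (hs : ContDiff ℝ ∞ s) (hv : Continuous v) :
    primIntegralVar I c s v =
      primIntegralVar I c' s v - (c - c') * formIntegralVar (fun a => I a.succ) s v := by
  have h1 : Continuous fun y => s (param y) :=
    hs.continuous.comp (contDiff_param (k := 0)).continuous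
  have h2 : Continuous fun y => detForm (fun a => I a.succ)
      (Fin.cons (v (param y)) (partialDeriv s y) : Fin (m + 1) → Fin r → ℝ) :=
    (detForm _).cont.comp (continuous_cons_partialDeriv hs hv)
  have h3 : Continuous fun y => prim I c' (s (param y))
      (Fin.cons (v (param y)) (partialDeriv s y) : Fin (m + 1) → Fin r → ℝ) :=
    (((continuous_apply (I 0)).comp h1).sub continuous_const).mul h2
  rw [primIntegralVar, primIntegralVar, formIntegralVar, ← integral_const_mul, ← integral_sub
    h3.integrableOn_coordSimplex (h2.integrableOn_coordSimplex.const_mul _)]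
  refine setIntegral_congr_fun (measurableSet_coordSimplex m) fun y _ => ?_
  simp only [prim, ContinuousAlternatingMap.smul_apply, smul_eq_mul]
  ring

section Families

variable {E : Type*} [NormedAddCommGroup E] [NormedSpace ℝ E] {r : ℕ} {V : Set E}

variable [FiniteDimensional ℝ E]

theorem contDiffOn_cochain {m : ℕ} {L : E → (Fin m → ℝ) → Fin r → ℝ} (hV : IsOpen V)
    (hL : ContDiffOn ℝ ∞ (Function.uncurry L) (V ×ˢ Set.univ)) (θ : Fin r → ℝ)
    {N : ℕ → Fin r → ℤ} (hN : ∀ x ∈ V, ∀ k i, rounded θ i (L x (vtx k)) = N k i)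
    (I : Fin m → Fin r) : ContDiffOn ℝ ∞ (fun x => cochain θ I (L x)) V := by
  induction m generalizing N with
  | zero => exact contDiffOn_const
  | succ m ih =>
    have h1 := ih (contDiffOn_uncurry_comp_face hL 0) (N := fun k => N (k + 1))
      (fun x hx k i => by rw [Function.comp_apply, face_zero_vtx, hN x hx]) (fun a => I a.succ)
    have h2 := contDiffOn_primIntegral hV hL I (N 0 (I 0))
    refine (h2.sub (contDiffOn_const (c := (N 1 (I 0) - N 0 (I 0) : ℝ)) |>.mul h1)).congr
      fun x hx => ?_
    simp only [cochain, jump, hN x hx]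

/-- As the rounded vertices are constant, only the integrals in the definition of `cochain` are
differentiated. -/
theorem fderiv_cochain_eq_sub {p : ℕ} {L : E → (Fin (p + 1) → ℝ) → Fin r → ℝ} (hV : IsOpen V)
    (hL : ContDiffOn ℝ ∞ (Function.uncurry L) (V ×ˢ Set.univ)) (θ : Fin r → ℝ)
    {N : ℕ → Fin r → ℤ} (hN : ∀ x ∈ V, ∀ k i, rounded θ i (L x (vtx k)) = N k i)
    (I : Fin (p + 1) → Fin r) {x : E} (hx : x ∈ V) (X : E) :
    fderiv ℝ (fun x => cochain θ I (L x)) x X =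
      fderiv ℝ (fun x => primIntegral I (N 0 (I 0)) (L x)) x X -
        jump (rounded θ (I 0)) (L x) *
          fderiv ℝ (fun x => cochain θ (fun a => I a.succ) (L x ∘ face 0)) x X := by
  have hN' : ∀ x ∈ V, ∀ k i, rounded θ i ((L x ∘ face 0) (vtx k)) = N (k + 1) i :=
    fun x hx k i => by rw [Function.comp_apply, face_zero_vtx, hN x hx]
  have h1 := contDiffOn_cochain hV (contDiffOn_uncurry_comp_face hL 0) θ hN' fun a => I a.succ
  have h2 := contDiffOn_primIntegral hV hL I (N 0 (I 0))
  have heq : (fun x => cochain θ I (L x)) =ᶠ[𝓝 x] fun x => primIntegral I (N 0 (I 0)) (L x) -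
      (N 1 (I 0) - N 0 (I 0) : ℝ) * cochain θ (fun a => I a.succ) (L x ∘ face 0) := by
    filter_upwards [hV.mem_nhds hx] with x hx
    simp only [cochain, jump, hN x hx]
  have hd1 := ((h1.contDiffAt (hV.mem_nhds hx)).differentiableAt (by simp)).hasFDerivAt
  have hd2 := ((h2.contDiffAt (hV.mem_nhds hx)).differentiableAt (by simp)).hasFDerivAt
  rw [heq.fderiv_eq, (hd2.fun_sub (hd1.const_mul (N 1 (I 0) - N 0 (I 0) : ℝ))).fderiv]
  simp only [_root_.sub_apply, _root_.smul_apply, smul_eq_mul, jump, hN x hx]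

theorem sum_primIntegralVar_vtx {p : ℕ} {s v : (Fin (p + 2) → ℝ) → Fin r → ℝ}
    (hs : ContDiff ℝ ∞ s) (hv : Continuous v) (f : (Fin r → ℝ) → ℤ) (I : Fin (p + 2) → Fin r) :
    ∑ a : Fin (p + 2), (-1) ^ (a : ℕ) *
        primIntegralVar I (f ((s ∘ face a) (vtx 0))) (s ∘ face a) (v ∘ face a) =
      ∑ a : Fin (p + 2), (-1) ^ (a : ℕ) *
        primIntegralVar I (f (s (vtx 0))) (s ∘ face a) (v ∘ face a) -
      jump f s * formIntegralVar (fun a => I a.succ) (s ∘ face 0) (v ∘ face 0) := by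
  simp only [Fin.sum_univ_succ (n := p + 1)]
  simp only [Function.comp_apply, face_zero_vtx, face_succ_vtx_zero, zero_add]
  rw [primIntegralVar_sub I (f (s (vtx 1))) (f (s (vtx 0))) (hs.comp (contDiff_face 0))
    (hv.comp (contDiff_face 0 (k := 0)).continuous), jump]
  simp
  ring

/-- The variation of `cochain θ I` along a family for which the rounded vertices are constant. -/
theorem fderiv_cochain {p : ℕ} {L : E → (Fin (p + 1) → ℝ) → Fin r → ℝ} (hV : IsOpen V)
    (hL : ContDiffOn ℝ ∞ (Function.uncurry L) (V ×ˢ Set.univ)) (θ : Fin r → ℝ)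
    {N : ℕ → Fin r → ℤ} (hN : ∀ x ∈ V, ∀ k i, rounded θ i (L x (vtx k)) = N k i)
    (I : Fin (p + 1) → Fin r) {x : E} (hx : x ∈ V) (X : E) :
    fderiv ℝ (fun x => cochain θ I (L x)) x X = formIntegralVar I (L x) (velocity L x X) +
      ∑ a : Fin (p + 1), (-1) ^ (a : ℕ) *
        cochainVar θ I (L x ∘ face a) (velocity L x X ∘ face a) := by
  induction p generalizing N with
  | zero =>
    rw [fderiv_cochain_eq_sub hV hL θ hN I hx, fderiv_primIntegral_zero hV hL I _ hx]
    simp [cochainVar, cochain]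
  | succ p ih =>
    have hN' : ∀ x ∈ V, ∀ k i, rounded θ i ((L x ∘ face 0) (vtx k)) = N (k + 1) i :=
      fun x hx k i => by rw [Function.comp_apply, face_zero_vtx, hN x hx]
    have h1 := ih (contDiffOn_uncurry_comp_face hL 0) hN' fun a => I a.succ
    have h2 := sum_primIntegralVar_vtx (contDiff_of_uncurry hL hx) (continuous_velocity hV hL hx X)
      (rounded θ (I 0)) I
    -- the Leibniz rule, for the simplex together with the vector field along it
    have h3 := sum_jump_mul (V := (Fin r → ℝ) × (Fin r → ℝ)) (fun p => rounded θ (I 0) p.1)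
      (fun τ => cochainVar θ (fun a => I a.succ) (fun t => (τ t).1) fun t => (τ t).2)
      (fun t => (L x t, velocity L x X t))
    rw [fderiv_cochain_eq_sub hV hL θ hN I hx, fderiv_primIntegral_succ hV hL I _ hx, h1]
    simp only [cochainVar, mul_add, Finset.sum_add_distrib]
    rw [h2, hN x hx 0]
    have h4 : velocity (fun x => L x ∘ face 0) x X = velocity L x X ∘ face 0 := rfl
    rw [h4]
    simp only [Function.comp_def, jump] at h3 ⊢
    rw [h3]
    ring

end Families

/-! ### Cancellation of the boundary terms -/

/-- A differentiable function that takes integral values at points arbitrarily close to `0` does so at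
`0`, and its derivative vanishes there. -/
theorem exists_int_and_deriv_eq_zero {g : ℝ → ℝ} {g' : ℝ} (hg : HasDerivAt g g' 0)
    (h : ∃ᶠ s in 𝓝[≠] 0, ∃ z : ℤ, g s = z) : (∃ z : ℤ, g 0 = z) ∧ g' = 0 := by
  have hc : Filter.Tendsto g (𝓝[≠] 0) (𝓝 (g 0)) := hg.continuousAt.tendsto.mono_left inf_le_left
  obtain ⟨z, hz⟩ : g 0 ∈ Set.range ((↑) : ℤ → ℝ) :=
    isClosed_range_intCast.mem_of_frequently_of_tendsto (h.mono fun s ⟨z, hz⟩ => ⟨z, hz.symm⟩) hc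
  refine ⟨⟨z, hz.symm⟩, ?_⟩
  have h1 : ∀ᶠ s in 𝓝[≠] (0 : ℝ), |g s - g 0| < 1 := by
    have := hc (Metric.ball_mem_nhds (g 0) one_pos)
    filter_upwards [this] with s hs using by simpa [Real.dist_eq] using hs
  have h2 : ∃ᶠ s in 𝓝[≠] (0 : ℝ), slope g 0 s ∈ ({0} : Set ℝ) := by
    refine (h.and_eventually h1).mono fun s hs => ?_
    obtain ⟨⟨w, hw⟩, hlt⟩ := hs
    rw [hw, ← hz, ← Int.cast_sub, ← Int.cast_abs, ← Int.cast_one, Int.cast_lt,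
      Int.abs_lt_one_iff] at hlt
    rw [Set.mem_singleton_iff, slope_def_field, hw, ← hz, ← Int.cast_sub, hlt]
    simp
  exact isClosed_singleton.mem_of_frequently_of_tendsto h2 (hasDerivAt_iff_tendsto_slope.1 hg)

section Cancellation

variable {E : Type*} [NormedAddCommGroup E] [NormedSpace ℝ E] {r : ℕ} {V : Set E}

/-- If a relation between simplices that depends only on which of them coincide modulo `ℤ^r` holds
for all parameters, then it holds for the values of `cochainVar` on the simplices with their
velocities.  Along some sequence of parameters converging to `x` in the direction `X`, the same
simplices coincide; these have the same position (modulo integers) and the same velocity at `x`. -/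
theorem sum_mul_cochainVar_eq_zero {P : Type*} [Fintype P] {p : ℕ}
    {ρ : P → E → (Fin p → ℝ) → Fin r → ℝ} (hV : IsOpen V)
    (hρ : ∀ q, ContDiffOn ℝ ∞ (Function.uncurry (ρ q)) (V ×ˢ Set.univ)) (m : P → ℝ)
    (hm : ∀ x ∈ V, ∀ F : P → ℝ, (∀ q q', EqModInt (ρ q x) (ρ q' x) → F q = F q') →
      ∑ q, m q * F q = 0)
    (θ : Fin r → ℝ) (I : Fin (p + 1) → Fin r) {x : E} (hx : x ∈ V) (X : E) :
    ∑ q, m q * cochainVar θ I (ρ q x) (velocity (ρ q) x X) = 0 := by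
  have hline : ∀ᶠ s : ℝ in 𝓝[≠] 0, x + s • X ∈ V := by
    have hc : ContinuousAt (fun s : ℝ => x + s • X) 0 := by fun_prop
    exact (hc.eventually (hV.mem_nhds (by simpa using hx))).filter_mono inf_le_left
  -- There are only finitely many patterns `π` of coincidences.
  obtain ⟨π, hπ⟩ : ∃ π : P → P → Prop,
      ∃ᶠ s : ℝ in 𝓝[≠] 0, (fun q q' => EqModInt (ρ q (x + s • X)) (ρ q' (x + s • X))) = π := by
    by_contra! h
    have h' := Filter.eventually_all.2 h
    obtain ⟨s, hs⟩ := h'.exists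
    exact hs _ rfl
  have key : ∀ q q', π q q' →
      cochainVar θ I (ρ q x) (velocity (ρ q) x X) =
        cochainVar θ I (ρ q' x) (velocity (ρ q') x X) := by
    intro q q' hqq
    have hfreq : ∃ᶠ s : ℝ in 𝓝[≠] 0, EqModInt (ρ q (x + s • X)) (ρ q' (x + s • X)) :=
      hπ.mono fun s hs => by
        have := congrFun (congrFun hs q) q'
        rw [this]
        exact hqq
    have hpt : ∀ t ∈ stdSimplex ℝ (Fin p), ∀ i, (∃ z : ℤ, ρ q x t i - ρ q' x t i = z) ∧
        velocity (ρ q) x X t i - velocity (ρ q') x X t i = 0 := by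
      intro t ht i
      have hl : HasDerivAt (fun s : ℝ => x + s • X) X 0 := by
        simpa using ((hasDerivAt_id (0 : ℝ)).smul_const X).const_add x
      have hd : ∀ q, HasDerivAt (fun s : ℝ => ρ q (x + s • X) t i) (velocity (ρ q) x X t i) 0 := by
        intro q
        have h1 := hasFDerivAt_of_uncurry hV (hρ q) hx t
        have h2 : HasFDerivAt (fun x' => ρ q x' t) (fderiv ℝ (fun x' => ρ q x' t) x)
          (x + (0 : ℝ) • X) := by simpa using h1
        exact hasDerivAt_pi.1 (h2.comp_hasDerivAt (0 : ℝ) hl) i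
      simpa using exists_int_and_deriv_eq_zero ((hd q).sub (hd q'))
        (hfreq.mono fun s hs => hs t ht i)
    obtain ⟨z, hz⟩ := EqModInt.exists_intShift (fun t ht i => (hpt t ht i).1)
      (contDiff_of_uncurry (hρ q) hx).continuous (contDiff_of_uncurry (hρ q') hx).continuous
    exact hz.cochainVar_eq (fun t ht => funext fun i => sub_eq_zero.1 (hpt t ht i).2) θ I
  obtain ⟨s, hs, hsV⟩ := (hπ.and_eventually hline).exists
  refine hm _ hsV _ fun q q' h => key q q' ?_
  rw [← hs]
  exact h

end Cancellation

/-! ### Coordinates on the fibres -/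

section Fibre

variable {B : Type u} [TopologicalSpace B] {r : ℕ} {S : LatticeSystem.{u, v, w} B r}

theorem ofCoords_apply (i : S.ι) (b : B) (x : Fin r → ℝ) :
    ofCoords S i b x = ∑ a, x a • frameR S i b a := by
  simp [ofCoords, Module.Basis.equivFun_symm_apply]

theorem equivFun_ofCoords (i : S.ι) (b : B) (x : Fin r → ℝ) :
    (frameR S i b).equivFun (ofCoords S i b x) = x := by
  exact (frameR S i b).equivFun.apply_symm_apply x

theorem frameR_repr_tmul (i : S.ι) (b : B) (a : S.Fiber b) (j : Fin r) :
    (frameR S i b).repr ((1 : ℝ) ⊗ₜ[ℤ] a) j = (S.frame i b).repr a j := by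
  simp [frameR, Module.Basis.baseChange_repr_tmul]

theorem ofCoords_mem_lattice {i : S.ι} {b : B} {x : Fin r → ℝ} :
    ofCoords S i b x ∈ lattice S b ↔ ∀ a, ∃ z : ℤ, x a = z := by
  constructor
  · intro h
    have key : ∀ y ∈ lattice S b, ∀ a, ∃ z : ℤ, (frameR S i b).equivFun y a = z := by
      intro y hy
      induction hy using AddSubgroup.closure_induction with
      | mem y hy =>
        obtain ⟨c, rfl⟩ := hy
        exact fun a => ⟨_, frameR_repr_tmul i b c a⟩
      | zero => exact fun a => ⟨0, by simp⟩
      | add y z _ _ hy hz =>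
        intro a
        obtain ⟨m, hm⟩ := hy a
        obtain ⟨n, hn⟩ := hz a
        exact ⟨m + n, by simp only [map_add, Pi.add_apply, hm, hn, Int.cast_add]⟩
      | neg y _ hy =>
        intro a
        obtain ⟨m, hm⟩ := hy a
        exact ⟨-m, by simp only [map_neg, Pi.neg_apply, hm, Int.cast_neg]⟩
    simpa only [equivFun_ofCoords] using key _ h
  · intro h
    rw [ofCoords_apply]
    refine AddSubgroup.sum_mem _ fun a _ => ?_
    obtain ⟨z, hz⟩ := h a
    rw [hz, Int.cast_smul_eq_zsmul]
    have ha : frameR S i b a ∈ lattice S b :=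
      AddSubgroup.subset_closure ⟨S.frame i b a, by simp [frameR]⟩
    exact AddSubgroup.zsmul_mem _ ha z

theorem mk_ofCoords_eq_iff {i : S.ι} {b : B} {x y : Fin r → ℝ} :
    (QuotientAddGroup.mk (ofCoords S i b x) : Torus S b) = QuotientAddGroup.mk (ofCoords S i b y) ↔
      ∀ a, ∃ z : ℤ, x a - y a = z := by
  rw [eq_comm, QuotientAddGroup.eq, ← map_neg, ← map_add, ofCoords_mem_lattice]
  simp only [Pi.add_apply, Pi.neg_apply, neg_add_eq_sub]

/-- The change of coordinates from the frame `i'` to the frame `i`. -/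
def transition (S : LatticeSystem.{u, v, w} B r) (i i' : S.ι) (b : B) :
    (Fin r → ℝ) →L[ℝ] (Fin r → ℝ) :=
  LinearMap.toContinuousLinearMap
    ((frameR S i b).equivFun.toLinearMap ∘ₗ (frameR S i' b).equivFun.symm.toLinearMap)

theorem transition_apply (i i' : S.ι) (b : B) (x : Fin r → ℝ) :
    transition S i i' b x = (frameR S i b).equivFun (ofCoords S i' b x) := rfl

theorem ofCoords_transition (i i' : S.ι) (b : B) (x : Fin r → ℝ) :
    ofCoords S i b (transition S i i' b x) = ofCoords S i' b x := by
  rw [transition_apply]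
  exact (frameR S i b).equivFun.symm_apply_apply _

/-- The form `dx_{I 0} ∧ … ∧ dx_{I (m-1)}` in the coordinates of the frame `i`. -/
def coordForm (S : LatticeSystem.{u, v, w} B r) (i : S.ι) (b : B) {m : ℕ} (I : Fin m → Fin r) :
    HR S b [⋀^Fin m]→ₗ[ℝ] ℝ :=
  (detForm I).toAlternatingMap.compLinearMap (frameR S i b).equivFun.toLinearMap

theorem coordForm_apply (i : S.ι) (b : B) {m : ℕ} (I : Fin m → Fin r) (y : Fin m → HR S b) :
    coordForm S i b I y = detForm I fun k => (frameR S i b).equivFun (y k) := rfl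

/-! ### Lifts of singular simplices -/

/-- `s` is a smooth lift of `σ` in the coordinates of the frame `i`. -/
def IsLiftIn {m : ℕ} {b : B} (i : S.ι) (σ : stdSimplex ℝ (Fin m) → Torus S b)
    (s : (Fin m → ℝ) → Fin r → ℝ) : Prop :=
  ContDiff ℝ ∞ s ∧ ∀ t : stdSimplex ℝ (Fin m), σ t = QuotientAddGroup.mk (ofCoords S i b (s t))

theorem IsLift.isLiftIn {n : ℕ} {b : B} {σ : stdSimplex ℝ (Fin (n + 1)) → Torus S b}
    {s : (Fin (n + 1) → ℝ) → Fin r → ℝ} (h : IsLift σ s) (i : S.ι) :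
    IsLiftIn i σ (transition S i (S.indexAt b) b ∘ s) :=
  ⟨(transition S i (S.indexAt b) b).contDiff.comp h.1, fun t => by
    rw [Function.comp_apply, ofCoords_transition, h.2 t]⟩

theorem IsLiftIn.isLift {n : ℕ} {b : B} {σ : stdSimplex ℝ (Fin (n + 1)) → Torus S b} {i : S.ι}
    {s : (Fin (n + 1) → ℝ) → Fin r → ℝ} (h : IsLiftIn i σ s) :
    IsLift σ (transition S (S.indexAt b) i b ∘ s) :=
  ⟨(transition S (S.indexAt b) i b).contDiff.comp h.1, fun t => by
    rw [Function.comp_apply, ofCoords_transition, h.2 t]⟩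

theorem IsLiftIn.eqModInt {m : ℕ} {b : B} {i : S.ι} {σ : stdSimplex ℝ (Fin m) → Torus S b}
    {s s' : (Fin m → ℝ) → Fin r → ℝ} (h : IsLiftIn i σ s) (h' : IsLiftIn i σ s') :
    EqModInt s s' := fun t ht =>
  mk_ofCoords_eq_iff.1 ((h.2 ⟨t, ht⟩).symm.trans (h'.2 ⟨t, ht⟩))

theorem IsLiftIn.exists_intShift {m : ℕ} {b : B} {i : S.ι} {σ : stdSimplex ℝ (Fin m) → Torus S b}
    {s s' : (Fin m → ℝ) → Fin r → ℝ} (h : IsLiftIn i σ s) (h' : IsLiftIn i σ s') :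
    ∃ z, IntShift z s s' :=
  (h.eqModInt h').exists_intShift h.1.continuous h'.1.continuous

theorem partialDeriv_clm_comp {n : ℕ} (T : (Fin r → ℝ) →L[ℝ] (Fin r → ℝ))
    {s : (Fin (n + 1) → ℝ) → Fin r → ℝ} (hs : ContDiff ℝ ∞ s) (y : Fin n → ℝ) (m : Fin n) :
    partialDeriv (T ∘ s) y m = T (partialDeriv s y m) := by
  have h : ContDiff ℝ ∞ fun y : Fin n → ℝ => s (param y) := hs.comp contDiff_param
  have h1 := T.hasFDerivAt.comp y ((h.differentiable (by simp)) y).hasFDerivAt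
  have h2 : HasFDerivAt (fun y : Fin n → ℝ => (T ∘ s) (param y)) _ y := h1
  rw [partialDeriv, h2.fderiv]
  rfl

theorem simplexIntegral_coordForm {n : ℕ} {b : B} {i : S.ι}
    {σ : stdSimplex ℝ (Fin (n + 1)) → Torus S b} {s : (Fin (n + 1) → ℝ) → Fin r → ℝ}
    (h : IsLiftIn i σ s) (I : Fin n → Fin r) :
    simplexIntegral σ (coordForm S i b I) = formIntegral I s := by
  have hex : ∃ s, IsLift σ s := ⟨_, h.isLift⟩
  rw [simplexIntegral, dif_pos hex]
  have hl := hex.choose_spec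
  obtain ⟨z, hz⟩ := (hl.isLiftIn i).exists_intShift h
  rw [← hz.formIntegral_eq I, formIntegral]
  refine setIntegral_congr_fun (measurableSet_coordSimplex _) fun y _ => ?_
  simp only [coordForm_apply, ← transition_apply]
  congr 1
  ext1 m
  exact (partialDeriv_clm_comp _ hl.1 y m).symm

/-- The value of `cochain θ I` on a singular simplex of the torus (zero if there is no smooth lift);
it does not depend on the lift. -/
def singularCochain (θ : Fin r → ℝ) {b : B} (i : S.ι) {m : ℕ} (I : Fin m → Fin r)
    (σ : stdSimplex ℝ (Fin m) → Torus S b) : ℝ :=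
  open Classical in if h : ∃ s, IsLiftIn i σ s then cochain θ I h.choose else 0

theorem singularCochain_eq (θ : Fin r → ℝ) {b : B} {i : S.ι} {m : ℕ} (I : Fin m → Fin r)
    {σ : stdSimplex ℝ (Fin m) → Torus S b} {s : (Fin m → ℝ) → Fin r → ℝ} (h : IsLiftIn i σ s) :
    singularCochain θ i I σ = cochain θ I s := by
  have hex : ∃ s, IsLiftIn i σ s := ⟨s, h⟩
  rw [singularCochain, dif_pos hex]
  obtain ⟨z, hz⟩ := hex.choose_spec.exists_intShift h
  exact hz.cochain_eq θ I

theorem coe_map_succAbove {n : ℕ} (j : Fin (n + 1)) (t : stdSimplex ℝ (Fin n)) :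
    (stdSimplex.map (Fin.succAbove j) t : Fin (n + 1) → ℝ) = face j t := by
  ext l
  rw [stdSimplex.map_coe, FunOnFinite.linearMap_apply_apply]
  rcases Fin.eq_self_or_eq_succAbove j l with rfl | ⟨l, rfl⟩
  · rw [face, Fin.insertNth_apply_same]
    refine Finset.sum_eq_zero fun a ha => ?_
    simp [Fin.succAbove_ne] at ha
  · rw [face, Fin.insertNth_apply_succAbove]
    simp [Finset.filter_eq']

theorem IsLiftIn.comp_face {n : ℕ} {b : B} {i : S.ι}
    {σ : stdSimplex ℝ (Fin (n + 1)) → Torus S b} {s : (Fin (n + 1) → ℝ) → Fin r → ℝ}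
    (h : IsLiftIn i σ s) (j : Fin (n + 1)) :
    IsLiftIn i (fun t => σ (stdSimplex.map (Fin.succAbove j) t)) (s ∘ face j) :=
  ⟨h.1.comp (contDiff_face j), fun t => by
    simp only [h.2, Function.comp_apply, coe_map_succAbove]⟩

/-! ### Singular chains -/

/-- The value of `cochain θ I` on a singular chain of the torus. -/
def chainCochain (θ : Fin r → ℝ) {b : B} (i : S.ι) {n : ℕ} (I : Fin (n + 1) → Fin r) :
    Chain S n b →+ ℝ :=
  Finsupp.liftAddHom fun σ => (AddMonoidHom.mulRight (singularCochain θ i I σ)).comp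
    (Int.castAddHom ℝ)

theorem chainCochain_single (θ : Fin r → ℝ) {b : B} (i : S.ι) {n : ℕ} (I : Fin (n + 1) → Fin r)
    (σ : stdSimplex ℝ (Fin (n + 1)) → Torus S b) (m : ℤ) :
    chainCochain θ i I (Finsupp.single σ m) = m * singularCochain θ i I σ := by
  simp [chainCochain]

/-- The boundary as a homomorphism. -/
def boundaryHom (n : ℕ) (b : B) : Chain S (n + 1) b →+ Chain S n b :=
  Finsupp.liftAddHom fun σ => ∑ j : Fin (n + 2),
    (Finsupp.singleAddHom fun t => σ (stdSimplex.map (Fin.succAbove j) t)).comp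
      (AddMonoidHom.mulLeft ((-1) ^ (j : ℕ)))

theorem boundaryHom_apply {n : ℕ} {b : B} (c : Chain S (n + 1) b) :
    boundaryHom n b c = boundary c := by
  rw [boundaryHom, Finsupp.liftAddHom_apply, boundary]
  refine Finsupp.sum_congr fun σ _ => ?_
  simp

theorem boundary_single {n : ℕ} {b : B} (σ : stdSimplex ℝ (Fin (n + 2)) → Torus S b) (m : ℤ) :
    boundary (Finsupp.single σ m) = ∑ j : Fin (n + 2),
      Finsupp.single (fun t => σ (stdSimplex.map (Fin.succAbove j) t)) ((-1) ^ (j : ℕ) * m) := by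
  rw [boundary, Finsupp.sum_single_index]
  simp

/-- Modulo integers, the integral of a coordinate form over a chain depends only on the boundary. -/
theorem chainIntegral_coordForm_eq {θ : Fin r → ℝ} {n : ℕ} {b : B} (i : S.ι)
    (I : Fin (n + 1) → Fin r) {G : Chain S (n + 1) b} (hG : IsSmoothChain G) :
    ∃ N : ℤ, chainIntegral G (coordForm S i b I) = chainCochain θ i I (boundary G) + N := by
  have key : ∀ σ ∈ G.support, ∃ N : ℤ, simplexIntegral σ (coordForm S i b I) =
      ∑ j : Fin (n + 2), (-1) ^ (j : ℕ) *
        singularCochain θ i I (fun t => σ (stdSimplex.map (Fin.succAbove j) t)) + N := by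
    intro σ hσ
    obtain ⟨s, hs⟩ := hG σ hσ
    have hs' := hs.isLiftIn i
    obtain ⟨N, hN⟩ := formIntegral_eq_sum_cochain_add_int θ I hs'.1
    refine ⟨N, ?_⟩
    rw [simplexIntegral_coordForm hs', hN]
    simp only [singularCochain_eq θ I (hs'.comp_face _)]
  choose! N hN using key
  refine ⟨G.sum fun σ m => m * N σ, ?_⟩
  rw [chainIntegral, boundary, Finsupp.sum, Finsupp.sum, Finsupp.sum, map_sum, Int.cast_sum,
    ← Finset.sum_add_distrib]
  refine Finset.sum_congr rfl fun σ hσ => ?_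
  rw [hN σ hσ, map_sum, mul_add, Finset.mul_sum]
  simp only [chainCochain_single]
  push_cast
  congr 1
  exact Finset.sum_congr rfl fun j _ => by ring

/-- Thin chains are zero as currents. -/
theorem IsThin.chainIntegral_eq_zero {n : ℕ} {b : B} {D : Chain S n b} (hD : IsThin D) (i : S.ι)
    (I : Fin n → Fin r) : chainIntegral D (coordForm S i b I) = 0 := by
  refine Finset.sum_eq_zero fun σ hσ => ?_
  obtain ⟨s, hs, hdep⟩ := hD σ hσ
  simp only [simplexIntegral_coordForm (hs.isLiftIn i), formIntegral]
  refine mul_eq_zero_of_right _ (setIntegral_eq_zero_of_forall_eq_zero fun y hy => ?_)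
  have h1 : partialDeriv (transition S i (S.indexAt b) b ∘ s) y =
      transition S i (S.indexAt b) b ∘ partialDeriv s y :=
    funext fun m => partialDeriv_clm_comp _ hs.1 y m
  rw [h1]
  refine (detForm I).toAlternatingMap.map_linearDependent _ fun hli => hdep y hy ?_
  exact hli.of_comp (transition S i (S.indexAt b) b).toLinearMap

theorem boundary_boundary {n : ℕ} {b : B} (D : Chain S (n + 2) b) : boundary (boundary D) = 0 := by
  rw [← boundaryHom_apply, ← boundaryHom_apply]
  induction D using Finsupp.induction_linear with
  | zero => simp
  | add f g hf hg => rw [map_add, map_add, hf, hg, add_zero]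
  | single σ m =>
    rw [boundaryHom_apply (n := n + 1), boundary_single, map_sum]
    simp only [boundaryHom_apply, boundary_single]
    rw [← Finset.sum_product', Finset.univ_product_univ]
    -- the `a`-th face of the `j`-th face is the face `a.predAbove j` of the face `j.succAbove a`
    refine Finset.sum_involution
      (fun p _ => (p.1.succAbove p.2, p.2.predAbove p.1)) ?_ ?_ (fun _ _ => Finset.mem_univ _) ?_
    · rintro ⟨j, a⟩ -
      have hmap : ∀ t : stdSimplex ℝ (Fin (n + 1)),
          stdSimplex.map (Fin.succAbove (j.succAbove a))
            (stdSimplex.map (Fin.succAbove (a.predAbove j)) t) =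
          stdSimplex.map (Fin.succAbove j) (stdSimplex.map (Fin.succAbove a) t) := by
        intro t
        rw [stdSimplex.map_comp_apply, stdSimplex.map_comp_apply]
        congr 1
        ext1 l
        exact Fin.succAbove_succAbove_succAbove_predAbove j a l
      simp only [hmap]
      rw [← Finsupp.single_add]
      have hs := Fin.neg_one_pow_succAbove_add_predAbove (R := ℤ) j a
      rw [pow_add, pow_add] at hs
      have : (-1 : ℤ) ^ (a : ℕ) * ((-1) ^ (j : ℕ) * m) +
          (-1) ^ (a.predAbove j : ℕ) * ((-1) ^ (j.succAbove a : ℕ) * m) = 0 := by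
        linear_combination m * hs
      rw [this, Finsupp.single_zero]
    · rintro ⟨j, a⟩ - - h
      exact Fin.succAbove_ne j a (congrArg Prod.fst h)
    · rintro ⟨j, a⟩ -
      simp [Fin.succAbove_succAbove_predAbove, Fin.predAbove_predAbove_succAbove]

end Fibre

/-! ### The Abel-Jacobi class of a local family in one fibre -/

section Pointwise

variable {E : Type x} [NormedAddCommGroup E] [NormedSpace ℝ E]
  {B : Type u} [TopologicalSpace B] [ChartedSpace E B] {r : ℕ} {S : LatticeSystem.{u, v, w} B r}

theorem LocalFamily.contDiff_lift {n : ℕ} (c : LocalFamily E S n) (j : Fin c.N) {b : B}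
    (hb : b ∈ c.U) : ContDiff ℝ ∞ (c.lift j b) := by
  rw [← contMDiff_iff_contDiff, ← contMDiffOn_univ]
  have h : ContMDiffOn (modelWithCornersSelf ℝ (Fin (n + 1) → ℝ))
      ((modelWithCornersSelf ℝ E).prod (modelWithCornersSelf ℝ (Fin (n + 1) → ℝ))) ∞
      (fun t : Fin (n + 1) → ℝ => (b, t)) Set.univ :=
    contMDiffOn_const.prodMk contMDiffOn_id
  exact (c.smooth_lift j).comp h fun t _ => ⟨hb, Set.mem_univ _⟩

theorem LocalFamily.isLiftIn {n : ℕ} (c : LocalFamily E S n) (j : Fin c.N) {b : B}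
    (hb : b ∈ c.U) :
    IsLiftIn c.i (fun t : stdSimplex ℝ (Fin (n + 1)) => c.simplex j b t) (c.lift j b) :=
  ⟨c.contDiff_lift j hb, fun _ => rfl⟩

theorem LocalFamily.chainCochain_chainAt {n : ℕ} (c : LocalFamily E S n) {b : B} (hb : b ∈ c.U)
    (θ : Fin r → ℝ) (I : Fin (n + 1) → Fin r) :
    chainCochain θ c.i I (c.chainAt b) = ∑ j, (c.coeff j : ℝ) * cochain θ I (c.lift j b) := by
  rw [LocalFamily.chainAt, map_sum]
  simp only [chainCochain_single, singularCochain_eq θ I (c.isLiftIn _ hb)]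

/-- The integral of a coordinate form over a chain bounding `Γ b`, in terms of a local family
representing `Γ`. -/
theorem LocalFamily.Represents.chainIntegral_eq {n : ℕ} {c : LocalFamily E S n}
    {Γ : ∀ b, Chain S n b} (hc : c.Represents Γ) {b : B} (hb : b ∈ c.U) (θ : Fin r → ℝ)
    (I : Fin (n + 1) → Fin r) {G : Chain S (n + 1) b} (hG : IsSmoothChain G)
    (hGΓ : boundary G = Γ b) :
    ∃ N : ℤ, chainIntegral G (coordForm S c.i b I) =
      ∑ j, (c.coeff j : ℝ) * cochain θ I (c.lift j b) + N := by
  obtain ⟨D, hD, hDΓ⟩ := hc b hb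
  obtain ⟨N, hN⟩ := chainIntegral_coordForm_eq (θ := θ) c.i I hG
  -- the boundary of a thin chain does not contribute
  obtain ⟨N', hN'⟩ := chainIntegral_coordForm_eq (θ := θ) c.i I
    (show IsSmoothChain D from fun σ hσ => (hD σ hσ).imp fun _ h => h.1)
  rw [hD.chainIntegral_eq_zero, ← hDΓ, map_sub, c.chainCochain_chainAt hb] at hN'
  refine ⟨N - N', ?_⟩
  rw [hN, hGΓ]
  push_cast
  linarith

/-- The faces of the simplices of a local family representing a family of cycles cancel. -/
theorem LocalFamily.Represents.sum_faces_eq_zero {n : ℕ} {c : LocalFamily E S (n + 1)}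
    {Γ : ∀ b, Chain S (n + 1) b} (hc : c.Represents Γ) {b : B} (hb : b ∈ c.U)
    (hΓ : boundary (Γ b) = 0) (F : Fin c.N × Fin (n + 2) → ℝ)
    (hF : ∀ q q', EqModInt (c.lift q.1 b ∘ face q.2) (c.lift q'.1 b ∘ face q'.2) → F q = F q') :
    ∑ q : Fin c.N × Fin (n + 2), (c.coeff q.1 : ℝ) * (-1) ^ (q.2 : ℕ) * F q = 0 := by
  obtain ⟨D, -, hDΓ⟩ := hc b hb
  have hcyc : boundaryHom n b (c.chainAt b) = 0 := by
    have h := congrArg (boundaryHom n b) hDΓ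
    rw [map_sub, boundaryHom_apply (Γ b), hΓ, boundaryHom_apply (boundary D),
      boundary_boundary, zero_sub, neg_eq_zero] at h
    exact h
  -- `F` is a function of the singular simplices `σ q`, so it extends to a homomorphism on chains.
  let σ : Fin c.N × Fin (n + 2) → stdSimplex ℝ (Fin (n + 1)) → Torus S b := fun q t =>
    c.simplex q.1 b (stdSimplex.map (Fin.succAbove q.2) t)
  have hσ : ∀ q, IsLiftIn c.i (σ q) (c.lift q.1 b ∘ face q.2) := fun q =>
    (c.isLiftIn q.1 hb).comp_face q.2
  have hfac : Function.FactorsThrough F σ := fun q q' h =>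
    hF q q' ((hσ q).eqModInt (h ▸ hσ q'))
  have h := congrArg (Finsupp.liftAddHom fun τ : stdSimplex ℝ (Fin (n + 1)) → Torus S b =>
    (AddMonoidHom.mulRight (Function.extend σ F 0 τ)).comp (Int.castAddHom ℝ)) hcyc
  rw [LocalFamily.chainAt, map_sum] at h
  simp only [boundaryHom_apply, boundary_single, map_sum, Finsupp.liftAddHom_apply_single,
    map_zero] at h
  rw [← Finset.sum_product', Finset.univ_product_univ] at h
  refine Eq.trans (Finset.sum_congr rfl fun q _ => ?_) h
  have hext := hfac.extend_apply (0 : (stdSimplex ℝ (Fin (n + 1)) → Torus S b) → ℝ) q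
  change _ = ((((-1) ^ (q.2 : ℕ) * c.coeff q.1 : ℤ) : ℝ)) * Function.extend σ F 0 (σ q)
  rw [hext]
  push_cast
  ring

end Pointwise

/-! ### Smoothness and derivative of the Abel-Jacobi coordinates -/

theorem eventually_floor_eq {A : Type*} [TopologicalSpace A] {f : A → ℝ} {a : A}
    (hf : ContinuousAt f a) (ha : ∀ z : ℤ, f a ≠ z) : ∀ᶠ x in 𝓝 a, ⌊f x⌋ = ⌊f a⌋ := by
  have h : Set.Ioo (⌊f a⌋ : ℝ) (⌊f a⌋ + 1) ∈ 𝓝 (f a) :=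
    Ioo_mem_nhds (lt_of_le_of_ne (Int.floor_le _) (ha _).symm) (Int.lt_floor_add_one _)
  filter_upwards [hf h] with x hx
  exact Int.floor_eq_iff.2 ⟨hx.1.le, hx.2⟩

theorem vtx_eq_zero_of_le {n k : ℕ} (h : n ≤ k) : (vtx k : Fin n → ℝ) = 0 := by
  ext j
  have := j.2
  simp only [vtx, Pi.zero_apply, ite_eq_right_iff, one_ne_zero, imp_false]
  omega

section Parameters

variable {E : Type*} [NormedAddCommGroup E] [NormedSpace ℝ E] {r : ℕ}

/-- For a suitable shift `θ` the rounded vertices of finitely many families of simplices are constant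
near a given parameter. -/
theorem exists_rounded_const {N m : ℕ} {Λ : Fin N → E → (Fin m → ℝ) → Fin r → ℝ} {V : Set E}
    (hV : IsOpen V) (hΛ : ∀ j, ContDiffOn ℝ ∞ (Function.uncurry (Λ j)) (V ×ˢ Set.univ))
    {x₀ : E} (hx₀ : x₀ ∈ V) :
    ∃ (θ : Fin r → ℝ) (W : Set E), IsOpen W ∧ W ⊆ V ∧ x₀ ∈ W ∧ ∀ j, ∀ x ∈ W, ∀ k i,
      rounded θ i (Λ j x (vtx k)) = rounded θ i (Λ j x₀ (vtx k)) := by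
  -- Only countably many shifts move a coordinate of a vertex to an integer.
  obtain ⟨τ, hτ⟩ : ∃ τ : ℝ, ∀ (z : ℤ) j k i, Λ j x₀ (vtx k) i + τ ≠ z := by
    obtain ⟨τ, hτ⟩ := ((Set.countable_range fun q : ℤ × Fin N × ℕ × Fin r =>
      (q.1 : ℝ) - Λ q.2.1 x₀ (vtx q.2.2.1) q.2.2.2).dense_compl ℝ).nonempty
    exact ⟨τ, fun z j k i h => hτ ⟨(z, j, k, i), by simp only; linarith⟩⟩
  have hcont : ∀ j (t : Fin m → ℝ) i, ContinuousAt (fun x => Λ j x t i + τ) x₀ := by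
    intro j t i
    have h1 : ContinuousAt (Function.uncurry (Λ j)) (x₀, t) :=
      (hΛ j).continuousOn.continuousAt ((hV.prod isOpen_univ).mem_nhds ⟨hx₀, Set.mem_univ _⟩)
    have h2 : ContinuousAt (fun x => Λ j x t) x₀ :=
      ContinuousAt.comp (g := Function.uncurry (Λ j)) (f := fun x => (x, t)) h1 (by fun_prop)
    exact ((continuous_apply i).continuousAt.comp h2).add continuousAt_const
  have hev : ∀ᶠ x in 𝓝 x₀, x ∈ V ∧ ∀ j (k : Fin (m + 1)) i,
      rounded (fun _ => τ) i (Λ j x (vtx k)) = rounded (fun _ => τ) i (Λ j x₀ (vtx k)) := by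
    refine (hV.eventually_mem hx₀).and (Filter.eventually_all.2 fun j =>
      Filter.eventually_all.2 fun k => Filter.eventually_all.2 fun i => ?_)
    exact eventually_floor_eq (hcont j (vtx k) i) fun z => hτ z j k i
  obtain ⟨W, hW, hWo, hxW⟩ := eventually_nhds_iff.1 hev
  refine ⟨fun _ => τ, W, hWo, fun x hx => (hW x hx).1, hxW, fun j x hx k i => ?_⟩
  -- All `vtx k` with `m ≤ k` are zero, so finitely many `k` suffice.
  rcases lt_or_ge k (m + 1) with hk | hk
  · exact (hW x hx).2 j ⟨k, hk⟩ i
  · have := (hW x hx).2 j (Fin.last m) i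
    rwa [Fin.val_last, vtx_eq_zero_of_le le_rfl, ← vtx_eq_zero_of_le (by omega : m ≤ k)] at this

variable [FiniteDimensional ℝ E]

/-- For a family of cycles the sum of the cochains `cochain θ I` is smooth in the parameter, and the
boundary terms of its derivative cancel. -/
theorem exists_contDiffOn_sum_cochain {N n : ℕ} {Λ : Fin N → E → (Fin (n + 1) → ℝ) → Fin r → ℝ}
    {V : Set E} (hV : IsOpen V)
    (hΛ : ∀ j, ContDiffOn ℝ ∞ (Function.uncurry (Λ j)) (V ×ˢ Set.univ)) (m : Fin N → ℝ)
    (hcyc : n ≠ 0 → ∀ x ∈ V, ∀ F : Fin N × Fin (n + 1) → ℝ,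
      (∀ q q', EqModInt (Λ q.1 x ∘ face q.2) (Λ q'.1 x ∘ face q'.2) → F q = F q') →
      ∑ q : Fin N × Fin (n + 1), m q.1 * (-1) ^ (q.2 : ℕ) * F q = 0)
    {x₀ : E} (hx₀ : x₀ ∈ V) :
    ∃ (θ : Fin r → ℝ) (W : Set E), IsOpen W ∧ W ⊆ V ∧ x₀ ∈ W ∧ ∀ I : Fin (n + 1) → Fin r,
      ContDiffOn ℝ ∞ (fun x => ∑ j, m j * cochain θ I (Λ j x)) W ∧
      ∀ X, fderiv ℝ (fun x => ∑ j, m j * cochain θ I (Λ j x)) x₀ X =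
        ∑ j, m j * formIntegralVar I (Λ j x₀) (velocity (Λ j) x₀ X) := by
  obtain ⟨θ, W, hWo, hWV, hxW, hN⟩ := exists_rounded_const hV hΛ hx₀
  have hΛW : ∀ j, ContDiffOn ℝ ∞ (Function.uncurry (Λ j)) (W ×ˢ Set.univ) := fun j =>
    (hΛ j).mono (Set.prod_mono hWV subset_rfl)
  have hsm : ∀ j (I : Fin (n + 1) → Fin r),
      ContDiffOn ℝ ∞ (fun x => cochain θ I (Λ j x)) W := fun j I =>
    contDiffOn_cochain hWo (hΛW j) θ (hN j) I
  refine ⟨θ, W, hWo, hWV, hxW, fun I => ⟨ContDiffOn.sum fun j _ => contDiffOn_const.mul (hsm j I),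
    fun X => ?_⟩⟩
  have hdiff : ∀ j, DifferentiableAt ℝ (fun x => cochain θ I (Λ j x)) x₀ := fun j =>
    ((hsm j I).contDiffAt (hWo.mem_nhds hxW)).differentiableAt (by simp)
  rw [fderiv_fun_sum fun j _ => (hdiff j).const_mul (m j), sum_apply]
  have hj : ∀ j, fderiv ℝ (fun x => m j * cochain θ I (Λ j x)) x₀ X =
      m j * formIntegralVar I (Λ j x₀) (velocity (Λ j) x₀ X) +
        ∑ a : Fin (n + 1), m j * (-1) ^ (a : ℕ) *
          cochainVar θ I (Λ j x₀ ∘ face a) (velocity (Λ j) x₀ X ∘ face a) := by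
    intro j
    rw [fderiv_const_mul (hdiff j), smul_apply, smul_eq_mul,
      fderiv_cochain hWo (hΛW j) θ (hN j) I hxW X, mul_add, Finset.mul_sum]
    simp only [mul_assoc]
  rw [Finset.sum_congr rfl fun j _ => hj j, Finset.sum_add_distrib, add_eq_left,
    ← Finset.sum_product', Finset.univ_product_univ]
  rcases n with _ | n
  · exact Finset.sum_eq_zero fun q _ => mul_zero _
  · have hρ : ∀ q : Fin N × Fin (n + 2),
        ContDiffOn ℝ ∞ (Function.uncurry fun x => Λ q.1 x ∘ face q.2) (W ×ˢ Set.univ) := fun q =>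
      contDiffOn_uncurry_comp_face (hΛW q.1) q.2
    have h := sum_mul_cochainVar_eq_zero (P := Fin N × Fin (n + 2)) (p := n + 1)
      (ρ := fun q x => Λ q.1 x ∘ face q.2) hWo hρ (fun q => m q.1 * (-1) ^ (q.2 : ℕ))
      (fun x hx F hF => hcyc (Nat.succ_ne_zero n) x (hWV hx) F hF) θ I hxW X
    exact h

end Parameters

/-! ### Coordinates on the exterior powers -/

section Wedge

variable {B : Type u} [TopologicalSpace B] {r : ℕ} {S : LatticeSystem.{u, v, w} B r}

theorem ofWedgeCoords_apply (i : S.ι) (m : ℕ) (b : B) (f : (Fin m → Fin r) → ℝ) :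
    ofWedgeCoords S i m b f =
      ∑ I, f I • exteriorPower.ιMulti ℝ m (fun k => frameR S i b (I k)) := by
  simp [ofWedgeCoords]

/-- The coordinate of an element of `⋀^m H_ℝ` given by `coordForm S i b I`. -/
def wedgeCoord (S : LatticeSystem.{u, v, w} B r) (i : S.ι) (b : B) {m : ℕ} (I : Fin m → Fin r) :
    WedgeR S m b →ₗ[ℝ] ℝ :=
  exteriorPower.alternatingMapLinearEquiv (coordForm S i b I)

theorem wedgeCoord_ιMulti (i : S.ι) (b : B) {m : ℕ} (I : Fin m → Fin r) (p : Fin m → HR S b) :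
    wedgeCoord S i b I (exteriorPower.ιMulti ℝ m p) = coordForm S i b I p :=
  exteriorPower.alternatingMapLinearEquiv_apply_ιMulti _ _

open Classical in
/-- The function `f`, with the redundant coordinates (at multi-indices that are not strictly
increasing) replaced by zero. -/
def strictPart {m : ℕ} (f : (Fin m → Fin r) → ℝ) (I : Fin m → Fin r) : ℝ :=
  if StrictMono I then f I else 0

/-- The coordinates at strictly increasing multi-indices determine an element of `⋀^m H_ℝ`. -/
theorem ofWedgeCoords_strictPart (i : S.ι) {m : ℕ} {b : B} (ξ : WedgeR S m b) :
    ofWedgeCoords S i m b (strictPart fun I => wedgeCoord S i b I ξ) = ξ := by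
  classical
  have hdual : ∀ s : Set.powersetCard (Fin r) m,
      exteriorPower.ιMultiDual ℝ m (frameR S i b) s =
        wedgeCoord S i b (Set.powersetCard.ofFinEmbEquiv.symm s) := by
    intro s
    refine exteriorPower.linearMap_ext ?_
    ext p
    simp only [LinearMap.compAlternatingMap_apply, exteriorPower.ιMultiDual_apply_ιMulti,
      wedgeCoord_ιMulti, coordForm_apply, detForm_apply]
    rfl
  have h := ((frameR S i b).exteriorPower m).sum_repr ξ
  rw [ofWedgeCoords_apply]
  refine Eq.trans ?_ h
  simp only [strictPart, ite_smul, zero_smul]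
  rw [← Finset.sum_filter]
  refine (Finset.sum_bij' (fun s _ => (Set.powersetCard.ofFinEmbEquiv.symm s : Fin m → Fin r))
    (fun I hI => Set.powersetCard.ofFinEmbEquiv
      (OrderEmbedding.ofStrictMono I (Finset.mem_filter.1 hI).2)) ?_ ?_ ?_ ?_ ?_).symm
  · intro s _
    simpa using (Set.powersetCard.ofFinEmbEquiv.symm s).strictMono
  · exact fun _ _ => Finset.mem_univ _
  · intro s _
    exact Set.powersetCard.ofFinEmbEquiv.apply_symm_apply s
  · intro I hI
    rw [Equiv.symm_apply_apply]
    rfl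
  · intro s _
    rw [exteriorPower.basis_repr_apply, hdual, exteriorPower.basis_apply]
    rfl

theorem ext_wedgeCoord (i : S.ι) {m : ℕ} {b : B} {ξ η : WedgeR S m b}
    (h : ∀ I : Fin m → Fin r, wedgeCoord S i b I ξ = wedgeCoord S i b I η) : ξ = η := by
  rw [← ofWedgeCoords_strictPart i ξ, ← ofWedgeCoords_strictPart i η]
  simp only [h]

theorem ofWedgeCoords_mem_wedgeLattice (i : S.ι) {m : ℕ} (b : B) {f : (Fin m → Fin r) → ℝ}
    (hf : ∀ I, ∃ z : ℤ, f I = z) : ofWedgeCoords S i m b f ∈ wedgeLattice S m b := by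
  rw [ofWedgeCoords_apply]
  refine AddSubgroup.sum_mem _ fun I _ => ?_
  obtain ⟨z, hz⟩ := hf I
  have h : exteriorPower.ιMulti ℝ m (fun k => frameR S i b (I k)) ∈ wedgeLattice S m b :=
    AddSubgroup.subset_closure ⟨fun k => S.frame i b (I k), by simp [frameR]⟩
  rw [hz]
  exact (Int.cast_smul_eq_zsmul ℝ z (exteriorPower.ιMulti ℝ m fun k => frameR S i b (I k))).symm ▸
    AddSubgroup.zsmul_mem _ h z

theorem coordForm_tmul (i : S.ι) (b : B) {m : ℕ} (I : Fin m → Fin r) (a : Fin m → S.Fiber b) :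
    coordForm S i b I (fun k => (1 : ℝ) ⊗ₜ[ℤ] a k) =
      ((Matrix.of fun k l => (S.frame i b).repr (a k) (I l)).det : ℤ) := by
  rw [coordForm_apply, detForm_apply, Int.cast_det]
  congr 1
  ext k l
  exact frameR_repr_tmul i b (a k) (I l)

theorem exists_wedgeCoord_eq_int (i : S.ι) {b : B} {m : ℕ} (I : Fin m → Fin r) {ξ : WedgeR S m b}
    (hξ : ξ ∈ wedgeLattice S m b) : ∃ z : ℤ, wedgeCoord S i b I ξ = z := by
  induction hξ using AddSubgroup.closure_induction with
  | mem y hy =>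
    obtain ⟨a, rfl⟩ := hy
    exact ⟨_, (wedgeCoord_ιMulti i b I _).trans (coordForm_tmul i b I a)⟩
  | zero => exact ⟨0, by simp⟩
  | add y z _ _ hy hz =>
    obtain ⟨p, hp⟩ := hy
    obtain ⟨q, hq⟩ := hz
    exact ⟨p + q, by rw [map_add, hp, hq, Int.cast_add]⟩
  | neg y _ hy =>
    obtain ⟨p, hp⟩ := hy
    exact ⟨-p, by rw [map_neg, hp, Int.cast_neg]⟩

/-- The coordinates with respect to one frame are given in terms of those with respect to another
frame by locally constant matrices. -/
theorem eventually_wedgeCoord_ofWedgeCoords {i i' : S.ι} {b : B} (hi : b ∈ S.dom i)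
    (hi' : b ∈ S.dom i') {m : ℕ} (I : Fin m → Fin r) :
    ∀ᶠ b' in 𝓝 b, wedgeCoord S i b' I ∘ₗ ofWedgeCoords S i' m b' =
      wedgeCoord S i b I ∘ₗ ofWedgeCoords S i' m b := by
  filter_upwards [S.locally_constant i i' b hi hi'] with b' hb'
  have hframe : ∀ b, (frameR S i' b : Fin r → HR S b) = fun c => (1 : ℝ) ⊗ₜ[ℤ] S.frame i' b c :=
    fun b => funext fun c => by simp [frameR]
  refine LinearMap.ext fun f => ?_
  simp only [LinearMap.comp_apply, ofWedgeCoords_apply, map_sum, map_smul, wedgeCoord_ιMulti,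
    hframe, coordForm_tmul, hb']

end Wedge

/-! ### The first variation -/

section FirstVariation

variable {E : Type x} [NormedAddCommGroup E] [NormedSpace ℝ E]
  {B : Type u} [TopologicalSpace B] [ChartedSpace E B] {r : ℕ} {S : LatticeSystem.{u, v, w} B r}

local notation "TB" => TangentSpace (modelWithCornersSelf ℝ E)

/-- For a map to a vector space, the manifold derivative is the derivative in the preferred chart. -/
theorem hasFDerivAt_comp_extChartAt_symm {F : Type*} [NormedAddCommGroup F] [NormedSpace ℝ F]
    {f : B → F} {b : B} {D : E →L[ℝ] F}
    (hf : HasMFDerivAt (modelWithCornersSelf ℝ E) (modelWithCornersSelf ℝ F) f b D) :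
    HasFDerivAt (f ∘ (extChartAt (modelWithCornersSelf ℝ E) b).symm) D
      (extChartAt (modelWithCornersSelf ℝ E) b b) := by
  have h := hf.2
  simp only [writtenInExtChartAt, extChartAt_model_space_eq_id, PartialEquiv.refl_coe,
    Function.id_comp, modelWithCornersSelf_coe, Set.range_id] at h
  exact hasFDerivWithinAt_univ.1 h

theorem IsSmoothLift.mdifferentiableAt {n : ℕ} {γ : ∀ b, WedgeTorus S n b} {i : S.ι} {U : Set B}
    {f : B → (Fin n → Fin r) → ℝ} (h : IsSmoothLift (E := E) γ i U f) {b : B} (hb : b ∈ U) :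
    MDifferentiableAt (modelWithCornersSelf ℝ E) (modelWithCornersSelf ℝ ((Fin n → Fin r) → ℝ))
      f b :=
  (h.2.2.1.contMDiffAt (h.1.mem_nhds hb)).mdifferentiableAt (by simp)

/-- Two smooth lifts of a section differ by a section of the lattice, so they have the same
derivative. -/
theorem IsSmoothLift.mfderiv_eq {n : ℕ} {γ : ∀ b, WedgeTorus S n b} {i i' : S.ι} {U U' : Set B}
    {f f' : B → (Fin n → Fin r) → ℝ} (h : IsSmoothLift (E := E) γ i U f)
    (h' : IsSmoothLift (E := E) γ i' U' f') {b : B} (hb : b ∈ U) (hb' : b ∈ U') (X : TB b) :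
    ofWedgeCoords S i n b (mfderiv (modelWithCornersSelf ℝ E)
        (modelWithCornersSelf ℝ ((Fin n → Fin r) → ℝ)) f b X : (Fin n → Fin r) → ℝ) =
      ofWedgeCoords S i' n b (mfderiv (modelWithCornersSelf ℝ E)
        (modelWithCornersSelf ℝ ((Fin n → Fin r) → ℝ)) f' b X : (Fin n → Fin r) → ℝ) := by
  refine ext_wedgeCoord i fun I => ?_
  let T := LinearMap.toContinuousLinearMap (wedgeCoord S i b I ∘ₗ ofWedgeCoords S i n b)
  let T' := LinearMap.toContinuousLinearMap (wedgeCoord S i b I ∘ₗ ofWedgeCoords S i' n b)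
  have hd := hasFDerivAt_comp_extChartAt_symm (h.mdifferentiableAt hb).hasMFDerivAt
  have hd' := hasFDerivAt_comp_extChartAt_symm (h'.mdifferentiableAt hb').hasMFDerivAt
  set φ := extChartAt (modelWithCornersSelf ℝ E) b with hφ
  have hG := (T.hasFDerivAt.comp (φ b) hd).sub (T'.hasFDerivAt.comp (φ b) hd')
  have hφc : Filter.Tendsto φ.symm (𝓝 (φ b)) (𝓝 b) := by
    have := (continuousAt_extChartAt_symm (I := modelWithCornersSelf ℝ E) b).tendsto
    rwa [extChartAt_to_inv] at this
  have hint : ∀ᶠ x in 𝓝 (φ b), ∃ z : ℤ, T (f (φ.symm x)) - T' (f' (φ.symm x)) = z := by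
    refine hφc.eventually (p := fun b' => ∃ z : ℤ, T (f b') - T' (f' b') = z) ?_
    filter_upwards [h.1.mem_nhds hb, h'.1.mem_nhds hb',
      eventually_wedgeCoord_ofWedgeCoords (h.2.1 hb) (h.2.1 hb) I,
      eventually_wedgeCoord_ofWedgeCoords (h.2.1 hb) (h'.2.1 hb') I] with b' hbU hbU' hT hT'
    have hmem := QuotientAddGroup.eq.1 ((h'.2.2.2 b' hbU').symm.trans (h.2.2.2 b' hbU))
    obtain ⟨z, hz⟩ := exists_wedgeCoord_eq_int i I hmem
    refine ⟨z, ?_⟩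
    change (wedgeCoord S i b I ∘ₗ ofWedgeCoords S i n b) (f b') -
      (wedgeCoord S i b I ∘ₗ ofWedgeCoords S i' n b) (f' b') = z
    rw [← hz, ← hT, ← hT', map_add, map_neg]
    simp only [LinearMap.comp_apply]
    ring
  -- an integer-valued function that is continuous at a point is constant near it
  have hconst : (fun x => T (f (φ.symm x)) - T' (f' (φ.symm x))) =ᶠ[𝓝 (φ b)]
      fun _ => T (f (φ.symm (φ b))) - T' (f' (φ.symm (φ b))) := by
    obtain ⟨z₀, hz₀⟩ := hint.self_of_nhds
    have hclose := hG.continuousAt (Metric.ball_mem_nhds _ one_pos)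
    filter_upwards [hint, hclose] with x hx hlt
    obtain ⟨z, hz⟩ := hx
    have hlt' : |(T (f (φ.symm x)) - T' (f' (φ.symm x))) -
      (T (f (φ.symm (φ b))) - T' (f' (φ.symm (φ b))))| < 1 := hlt
    rw [hz, hz₀, ← Int.cast_sub, ← Int.cast_abs, ← Int.cast_one, Int.cast_lt,
      Int.abs_lt_one_iff, sub_eq_zero] at hlt'
    rw [hz, hz₀, hlt']
  have h0 := hG.unique ((hasFDerivAt_const _ _).congr_of_eventuallyEq hconst)
  have h1 := congrArg (fun D : E →L[ℝ] ℝ => D X) h0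
  exact sub_eq_zero.1 h1

theorem IsSmoothLift.firstVariation_eq {n : ℕ} {γ : ∀ b, WedgeTorus S n b} {i : S.ι} {U : Set B}
    {f : B → (Fin n → Fin r) → ℝ} (h : IsSmoothLift (E := E) γ i U f) {b : B} (hb : b ∈ U)
    (X : TB b) :
    firstVariation E γ b X = ofWedgeCoords S i n b (mfderiv (modelWithCornersSelf ℝ E)
      (modelWithCornersSelf ℝ ((Fin n → Fin r) → ℝ)) f b X : (Fin n → Fin r) → ℝ) := by
  have hex : ∃ (i : S.ι) (f : B → (Fin n → Fin r) → ℝ),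
      ∃ U, b ∈ U ∧ IsSmoothLift (E := E) γ i U f := ⟨i, f, U, hb, h⟩
  obtain ⟨hbU, hU⟩ := hex.choose_spec.choose_spec.choose_spec
  rw [firstVariation, dif_pos hex]
  exact hU.mfderiv_eq h hbU hb X

end FirstVariation

/-! ### The Abel-Jacobi section of a family of cycles -/

section AbelJacobi

variable {E : Type x} [NormedAddCommGroup E] [NormedSpace ℝ E]
  {B : Type u} [TopologicalSpace B] [ChartedSpace E B] {r : ℕ} {S : LatticeSystem.{u, v, w} B r}

local notation "TB" => TangentSpace (modelWithCornersSelf ℝ E)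

/-- The coordinates of `LocalFamily.baseDeriv`. -/
def LocalFamily.baseVelocity {n : ℕ} (c : LocalFamily E S n) (j : Fin c.N) (b : B) (X : TB b)
    (t : Fin (n + 1) → ℝ) : Fin r → ℝ :=
  mfderiv (modelWithCornersSelf ℝ E) (modelWithCornersSelf ℝ (Fin r → ℝ))
    (fun b' => c.lift j b' t) b X

theorem LocalFamily.mdifferentiableAt_lift {n : ℕ} (c : LocalFamily E S n) (j : Fin c.N) {b : B}
    (hb : b ∈ c.U) (t : Fin (n + 1) → ℝ) :
    MDifferentiableAt (modelWithCornersSelf ℝ E) (modelWithCornersSelf ℝ (Fin r → ℝ))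
      (fun b' => c.lift j b' t) b := by
  have h : ContMDiffOn (modelWithCornersSelf ℝ E)
      ((modelWithCornersSelf ℝ E).prod (modelWithCornersSelf ℝ (Fin (n + 1) → ℝ))) ∞
      (fun b' : B => (b', t)) c.U :=
    contMDiffOn_id.prodMk contMDiffOn_const
  have h' := (c.smooth_lift j).comp h fun b' hb' => ⟨hb', Set.mem_univ _⟩
  exact (h'.contMDiffAt (c.isOpen_U.mem_nhds hb)).mdifferentiableAt (by simp)

variable (E) in
/-- The lifts of a local family in the chart at `b`. -/
def LocalFamily.chartLift {n : ℕ} (c : LocalFamily E S n) (b : B) (j : Fin c.N) (x : E) :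
    (Fin (n + 1) → ℝ) → Fin r → ℝ :=
  c.lift j ((extChartAt (modelWithCornersSelf ℝ E) b).symm x)

/-- The domain of `LocalFamily.chartLift`. -/
def LocalFamily.chartDomain {n : ℕ} (c : LocalFamily E S n) (b : B) : Set E :=
  (extChartAt (modelWithCornersSelf ℝ E) b).target ∩
    (extChartAt (modelWithCornersSelf ℝ E) b).symm ⁻¹' c.U

theorem LocalFamily.isOpen_chartDomain {n : ℕ} (c : LocalFamily E S n) (b : B) :
    IsOpen (c.chartDomain b) :=
  (continuousOn_extChartAt_symm b).isOpen_inter_preimage (isOpen_extChartAt_target b) c.isOpen_U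

theorem LocalFamily.chartLift_apply_self {n : ℕ} (c : LocalFamily E S n) (b : B) (j : Fin c.N) :
    c.chartLift E b j (extChartAt (modelWithCornersSelf ℝ E) b b) = c.lift j b := by
  rw [LocalFamily.chartLift, extChartAt_to_inv]

theorem LocalFamily.velocity_chartLift {n : ℕ} (c : LocalFamily E S n) {b : B} (hb : b ∈ c.U)
    (j : Fin c.N) (X : E) :
    velocity (c.chartLift E b j) (extChartAt (modelWithCornersSelf ℝ E) b b) X =
      c.baseVelocity j b X := by
  refine funext fun t => ?_
  have h := (hasFDerivAt_comp_extChartAt_symm (c.mdifferentiableAt_lift j hb t).hasMFDerivAt).fderiv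
  exact congrArg (fun D : E →L[ℝ] (Fin r → ℝ) => D (X : E)) h

theorem LocalFamily.contDiffOn_chartLift [IsManifold (modelWithCornersSelf ℝ E) ∞ B] {n : ℕ}
    (c : LocalFamily E S n) (b : B) (j : Fin c.N) :
    ContDiffOn ℝ ∞ (Function.uncurry (c.chartLift E b j)) (c.chartDomain b ×ˢ Set.univ) := by
  rw [← contMDiffOn_iff_contDiffOn]
  have h1 : ContMDiffOn (modelWithCornersSelf ℝ (E × (Fin (n + 1) → ℝ)))
      (modelWithCornersSelf ℝ E) ∞
      (fun p : E × (Fin (n + 1) → ℝ) => (extChartAt (modelWithCornersSelf ℝ E) b).symm p.1)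
      (c.chartDomain b ×ˢ Set.univ) :=
    (contMDiffOn_extChartAt_symm (n := ∞) b).comp contDiff_fst.contMDiff.contMDiffOn
      fun p hp => hp.1.1
  have h2 : ContMDiffOn (modelWithCornersSelf ℝ (E × (Fin (n + 1) → ℝ)))
      (modelWithCornersSelf ℝ (Fin (n + 1) → ℝ)) ∞
      (fun p : E × (Fin (n + 1) → ℝ) => p.2) (c.chartDomain b ×ˢ Set.univ) :=
    contDiff_snd.contMDiff.contMDiffOn
  exact (c.smooth_lift j).comp (h1.prodMk h2) fun p hp => ⟨hp.1.2, Set.mem_univ _⟩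

/-- Near each point of its domain, a local family representing a family of cycles gives a smooth lift
of the section of Abel-Jacobi classes, whose derivative is the integral of the contraction of the
coordinate forms with the velocity. -/
theorem LocalFamily.Represents.exists_isSmoothLift [FiniteDimensional ℝ E]
    [IsManifold (modelWithCornersSelf ℝ E) ∞ B] {n : ℕ} {c : LocalFamily E S n}
    {Γ : ∀ b, Chain S n b} (hc : c.Represents Γ) (hΓ : ∀ b, IsCycle (Γ b))
    {γ : ∀ b, WedgeTorus S (n + 1) b} (hγ : ∀ b, IsAbelJacobiClass (Γ b) (γ b)) {b₀ : B}
    (hb₀ : b₀ ∈ c.U) :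
    ∃ U f, b₀ ∈ U ∧ IsSmoothLift (E := E) γ c.i U f ∧ ∀ X : TB b₀,
      (mfderiv (modelWithCornersSelf ℝ E) (modelWithCornersSelf ℝ ((Fin (n + 1) → Fin r) → ℝ))
        f b₀ X : (Fin (n + 1) → Fin r) → ℝ) =
      strictPart fun I => ∑ j, (c.coeff j : ℝ) *
        formIntegralVar I (c.lift j b₀) (c.baseVelocity j b₀ X) := by
  classical
  set φ := extChartAt (modelWithCornersSelf ℝ E) b₀ with hφ
  have hx₀ : φ b₀ ∈ c.chartDomain b₀ :=
    ⟨mem_extChartAt_target b₀, by rw [Set.mem_preimage, extChartAt_to_inv]; exact hb₀⟩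
  obtain ⟨θ, W, hWo, hWV, hxW, hW⟩ := exists_contDiffOn_sum_cochain (c.isOpen_chartDomain b₀)
    (c.contDiffOn_chartLift b₀) (fun j => (c.coeff j : ℝ)) (by
      intro hn x hx F hF
      obtain ⟨n, rfl⟩ := Nat.exists_eq_succ_of_ne_zero hn
      exact hc.sum_faces_eq_zero hx.2 (hΓ _) F hF) hx₀
  let f : B → (Fin (n + 1) → Fin r) → ℝ := fun b => strictPart fun I =>
    ∑ j, (c.coeff j : ℝ) * cochain θ I (c.lift j b)
  have hUo : IsOpen (φ.source ∩ φ ⁻¹' W) :=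
    (continuousOn_extChartAt b₀).isOpen_inter_preimage (isOpen_extChartAt_source b₀) hWo
  have hbU : b₀ ∈ φ.source ∩ φ ⁻¹' W := ⟨mem_extChartAt_source b₀, hxW⟩
  have hUc : φ.source ∩ φ ⁻¹' W ⊆ c.U := fun b hb => by
    have := (hWV hb.2).2
    rwa [Set.mem_preimage, φ.left_inv hb.1] at this
  have hlift : IsSmoothLift (E := E) γ c.i (φ.source ∩ φ ⁻¹' W) f := by
    refine ⟨hUo, hUc.trans c.subset_dom, contMDiffOn_pi_space.2 fun I => ?_, fun b hb => ?_⟩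
    · by_cases hI : StrictMono I
      · have h1 : ContMDiffOn (modelWithCornersSelf ℝ E) (modelWithCornersSelf ℝ ℝ) ∞
            ((fun x => ∑ j, (c.coeff j : ℝ) * cochain θ I (c.chartLift E b₀ j x)) ∘ φ)
            (φ.source ∩ φ ⁻¹' W) :=
          (hW I).1.contMDiffOn.comp ((contMDiffOn_extChartAt (n := ∞)).mono fun b hb => by
            simpa [hφ] using hb.1) fun b hb => hb.2
        refine h1.congr fun b hb => ?_
        simp only [f, strictPart, if_pos hI, Function.comp_apply, LocalFamily.chartLift]
        rw [← hφ, φ.left_inv hb.1]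
      · refine contMDiffOn_const (c := (0 : ℝ)) |>.congr fun b hb => ?_
        simp only [f, strictPart, if_neg hI]
    · -- the coordinates of `γ b` and `f b` differ by integers
      obtain ⟨G, hG, hGΓ, ξ, hξ, hξG⟩ := hγ b
      rw [hξ, QuotientAddGroup.eq]
      conv in ξ => rw [← ofWedgeCoords_strictPart c.i ξ]
      rw [← map_neg, ← map_add]
      refine ofWedgeCoords_mem_wedgeLattice c.i b fun I => ?_
      simp only [f, strictPart, Pi.add_apply, Pi.neg_apply]
      split_ifs
      · obtain ⟨N, hN⟩ := hc.chainIntegral_eq (hUc hb) θ I hG hGΓ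
        refine ⟨-N, ?_⟩
        rw [wedgeCoord, hξG, hN]
        push_cast
        ring
      · exact ⟨0, by simp⟩
  refine ⟨_, f, hbU, hlift, fun X => funext fun I => ?_⟩
  have hd := hasFDerivAt_pi'.1 (hasFDerivAt_comp_extChartAt_symm (hlift.mdifferentiableAt hbU).hasMFDerivAt) I
  have hX := congrArg (fun D : E →L[ℝ] ℝ => D X) hd.fderiv
  refine Eq.trans hX.symm ?_
  by_cases hI : StrictMono I
  · simp only [f, strictPart, if_pos hI, Function.comp_apply]
    refine ((hW I).2 X).trans (Finset.sum_congr rfl fun j _ => ?_)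
    rw [c.chartLift_apply_self]
    exact congrArg (fun v => (c.coeff j : ℝ) * formIntegralVar I (c.lift j b₀) v)
      (c.velocity_chartLift hb₀ j X)
  · simp only [f, strictPart, if_neg hI, Function.comp_apply, fderiv_fun_const]
    rfl

end AbelJacobi

/-! ### Exterior products of forms pulled back along two projections -/

section DomCoprod

variable {W H N₁ N₂ : Type*} [AddCommGroup W] [Module ℝ W] [AddCommGroup H] [Module ℝ H]
  [AddCommGroup N₁] [Module ℝ N₁] [AddCommGroup N₂] [Module ℝ N₂]

section General

variable {α β : Type*} [Fintype α] [Fintype β] [DecidableEq α] [DecidableEq β]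
  (a : H [⋀^α]→ₗ[ℝ] N₁) (b : H [⋀^β]→ₗ[ℝ] N₂) (P Q : W →ₗ[ℝ] H)

theorem domCoprod_summand_apply (σ : Equiv.Perm (α ⊕ β)) (z : α ⊕ β → W) :
    AlternatingMap.domCoprod.summand (a.compLinearMap P) (b.compLinearMap Q) (Quotient.mk'' σ) z =
      Equiv.Perm.sign σ • (a (fun i => P (z (σ (Sum.inl i)))) ⊗ₜ[ℝ]
        b (fun i => Q (z (σ (Sum.inr i))))) := rfl

/-- There are not enough factors on the left for all vectors annihilated on the right. -/
theorem domCoprod_eq_zero_of_right {κ : Type*} [Fintype κ] (z : α ⊕ β → W) (f : κ → α ⊕ β)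
    (hf : Function.Injective f) (hcard : Fintype.card α < Fintype.card κ)
    (hz : ∀ k, Q (z (f k)) = 0) :
    (a.compLinearMap P).domCoprod (b.compLinearMap Q) z = 0 := by
  rw [AlternatingMap.domCoprod_apply, sum_apply]
  refine Finset.sum_eq_zero fun σ _ => ?_
  induction σ using Quotient.inductionOn' with | _ σ
  rw [domCoprod_summand_apply]
  obtain ⟨k, i, hki⟩ : ∃ k i, σ (Sum.inr i) = f k := by
    by_contra! h
    have hl : ∀ k, ∃ i, σ (Sum.inl i) = f k := by
      intro k
      rcases hs : σ.symm (f k) with i | i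
      · exact ⟨i, by rw [← hs, Equiv.apply_symm_apply]⟩
      · exact absurd (by rw [← hs, Equiv.apply_symm_apply]) (h k i)
    choose t ht using hl
    have htinj : Function.Injective t := fun k k' hkk => hf (by rw [← ht, ← ht, hkk])
    exact absurd (Fintype.card_le_of_injective t htinj) (not_le.2 hcard)
  rw [b.map_coord_zero i (by rw [hki, hz]), TensorProduct.tmul_zero, smul_zero]

/-- There are not enough factors on the right for all vectors annihilated on the left. -/
theorem domCoprod_eq_zero_of_left {κ : Type*} [Fintype κ] (z : α ⊕ β → W) (f : κ → α ⊕ β)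
    (hf : Function.Injective f) (hcard : Fintype.card β < Fintype.card κ)
    (hz : ∀ k, P (z (f k)) = 0) :
    (a.compLinearMap P).domCoprod (b.compLinearMap Q) z = 0 := by
  rw [AlternatingMap.domCoprod_apply, sum_apply]
  refine Finset.sum_eq_zero fun σ _ => ?_
  induction σ using Quotient.inductionOn' with | _ σ
  rw [domCoprod_summand_apply]
  obtain ⟨k, i, hki⟩ : ∃ k i, σ (Sum.inl i) = f k := by
    by_contra! h
    have hl : ∀ k, ∃ i, σ (Sum.inr i) = f k := by
      intro k
      rcases hs : σ.symm (f k) with i | i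
      · exact absurd (by rw [← hs, Equiv.apply_symm_apply]) (h k i)
      · exact ⟨i, by rw [← hs, Equiv.apply_symm_apply]⟩
    choose t ht using hl
    have htinj : Function.Injective t := fun k k' hkk => hf (by rw [← ht, ← ht, hkk])
    exact absurd (Fintype.card_le_of_injective t htinj) (not_le.2 hcard)
  rw [a.map_coord_zero i (by rw [hki, hz]), TensorProduct.zero_tmul, smul_zero]

/-- If the vectors of the second block are annihilated on the left, only the identity shuffle
contributes. -/
theorem domCoprod_sumElim (p : α → W) (q : β → W)
    (hq : ∀ i, P (q i) = 0) :
    (a.compLinearMap P).domCoprod (b.compLinearMap Q) (Sum.elim p q) =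
      a (fun i => P (p i)) ⊗ₜ[ℝ] b (fun i => Q (q i)) := by
  rw [AlternatingMap.domCoprod_apply, sum_apply]
  refine (Finset.sum_eq_single (Quotient.mk'' (1 : Equiv.Perm (α ⊕ β))) ?_ ?_).trans ?_
  · intro σ _ hσ
    induction σ using Quotient.inductionOn' with | _ σ
    rw [domCoprod_summand_apply]
    obtain ⟨i, j, hij⟩ : ∃ i j, σ (Sum.inl i) = Sum.inr j := by
      by_contra! h
      refine hσ ?_
      have hmaps : Set.MapsTo σ (Set.range Sum.inl) (Set.range Sum.inl) := by
        rintro _ ⟨i, rfl⟩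
        rcases hs : σ (Sum.inl i) with j | j
        · exact ⟨j, rfl⟩
        · exact absurd hs (h i j)
      refine Quotient.sound' (QuotientGroup.leftRel_apply.2 ?_)
      have hmem := Equiv.Perm.mem_sumCongrHom_range_of_perm_mapsTo_inl hmaps
      simpa using Subgroup.inv_mem _ hmem
    rw [a.map_coord_zero i (by rw [hij, Sum.elim_inr, hq]), TensorProduct.zero_tmul, smul_zero]
  · exact fun h => absurd (Finset.mem_univ _) h
  · rw [domCoprod_summand_apply]
    simp

end General

variable {n : ℕ} (a : H [⋀^Fin (n + 1)]→ₗ[ℝ] N₁) (b : H [⋀^Fin (n + 1)]→ₗ[ℝ] N₂) (P Q : W →ₗ[ℝ] H)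

/-- The exterior product of two forms of degree `n + 1`, with a convenient type of indices. -/
def wedgeTwo : W [⋀^Fin (n + n + 1 + 1)]→ₗ[ℝ] N₁ ⊗[ℝ] N₂ :=
  ((a.compLinearMap P).domCoprod (b.compLinearMap Q)).domDomCongr
    (finSumFinEquiv.trans (finCongr (by omega)))

theorem wedgeTwo_apply (z : Fin (n + n + 1 + 1) → W) :
    wedgeTwo a b P Q z = (a.compLinearMap P).domCoprod (b.compLinearMap Q)
      fun s => z (finCongr (by omega) (finSumFinEquiv s)) := rfl

theorem wedgeTwo_swap (x y : W) (z : Fin (n + n) → W) :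
    wedgeTwo a b P Q (Matrix.vecCons x (Matrix.vecCons y z)) =
      - wedgeTwo a b P Q (Matrix.vecCons y (Matrix.vecCons x z)) := by
  rw [← AlternatingMap.map_swap (wedgeTwo a b P Q) _
    (show (0 : Fin (n + n + 1 + 1)) ≠ 1 from Fin.zero_ne_one)]
  congr 1
  ext i
  refine Fin.cases ?_ (fun i => Fin.cases ?_ (fun i => ?_) i) i
  · simp [Equiv.swap_apply_left]
  · simp [Equiv.swap_apply_right]
  · have h1 : i.succ.succ ≠ (1 : Fin (n + n + 1 + 1)) := fun h =>
      Fin.succ_ne_zero i (Fin.succ_injective _ h)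
    rw [Function.comp_apply, Equiv.swap_apply_of_ne_of_ne (Fin.succ_ne_zero _) h1]
    simp

/-- If `x` belongs to the first block and `y` to the second one, moving `y` past the `n` vectors `p`
only contributes the sign `(-1)^n`, and then the identity shuffle is the only one left. -/
theorem wedgeTwo_cons_cons_append (hn : Even n) {x y : W} {p q : Fin n → W}
    (hy : P y = 0) (hq : ∀ i, P (q i) = 0) :
    wedgeTwo a b P Q (Matrix.vecCons x (Matrix.vecCons y (Fin.append p q))) =
      a (Fin.cons (P x) fun i => P (p i)) ⊗ₜ[ℝ] b (Fin.cons (Q y) fun i => Q (q i)) := by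
  have h1 := AlternatingMap.map_insertNth ((wedgeTwo a b P Q).curryLeft x)
    (⟨n, by omega⟩ : Fin (n + n + 1)) y (Fin.append p q)
  rw [AlternatingMap.curryLeft_apply_apply, AlternatingMap.curryLeft_apply_apply,
    hn.neg_one_pow, one_smul] at h1
  rw [← h1, wedgeTwo_apply]
  have h2 : (fun s : Fin (n + 1) ⊕ Fin (n + 1) => Matrix.vecCons x
      (Fin.insertNth (⟨n, by omega⟩ : Fin (n + n + 1)) y (Fin.append p q) : Fin (n + n + 1) → W)
      (finCongr (by omega) (finSumFinEquiv s))) = Sum.elim (Fin.cons x p) (Fin.cons y q) := by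
    ext s
    rcases s with s | s
    · refine Fin.cases ?_ (fun s => ?_) s
      · rfl
      · have : finCongr (by omega) (finSumFinEquiv (Sum.inl s.succ : Fin (n + 1) ⊕ Fin (n + 1))) =
            Fin.succ ((⟨n, by omega⟩ : Fin (n + n + 1)).succAbove (Fin.castAdd n s)) := by
          rw [Fin.succAbove_of_castSucc_lt _ _ (by simp [Fin.lt_def])]
          ext
          simp
        rw [this, Matrix.cons_val_succ, Fin.insertNth_apply_succAbove, Fin.append_left]
        rfl
    · refine Fin.cases ?_ (fun s => ?_) s
      · have : finCongr (by omega) (finSumFinEquiv (Sum.inr 0 : Fin (n + 1) ⊕ Fin (n + 1))) =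
            Fin.succ (⟨n, by omega⟩ : Fin (n + n + 1)) := by
          ext
          simp
        rw [this, Matrix.cons_val_succ, Fin.insertNth_apply_same]
        rfl
      · have : finCongr (by omega) (finSumFinEquiv (Sum.inr s.succ : Fin (n + 1) ⊕ Fin (n + 1))) =
            Fin.succ ((⟨n, by omega⟩ : Fin (n + n + 1)).succAbove (Fin.natAdd n s)) := by
          rw [Fin.succAbove_of_le_castSucc _ _ (by simp [Fin.le_def])]
          ext
          simp
          omega
        rw [this, Matrix.cons_val_succ, Fin.insertNth_apply_succAbove, Fin.append_right]
        rfl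
  rw [h2, domCoprod_sumElim]
  · congr 2 <;> ext i <;> refine Fin.cases ?_ (fun i => ?_) i <;> rfl
  · refine fun i => Fin.cases hy (fun i => hq i) i

theorem wedgeTwo_eq_zero_of_right {x y : W} {p q : Fin n → W} (hx : Q x = 0) (hy : Q y = 0)
    (hp : ∀ i, Q (p i) = 0) :
    wedgeTwo a b P Q (Matrix.vecCons x (Matrix.vecCons y (Fin.append p q))) = 0 := by
  rw [wedgeTwo_apply]
  let e : Fin (n + 1) ⊕ Fin (n + 1) ≃ Fin (n + n + 1 + 1) :=
    finSumFinEquiv.trans (finCongr (by omega))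
  let f : Fin (n + 2) → Fin (n + n + 1 + 1) :=
    Fin.cons 0 (Fin.cons 1 fun i : Fin n => (Fin.castAdd n i).succ.succ)
  have hf : ∀ i, (f i : ℕ) = i := fun i =>
    Fin.cases rfl (fun i => Fin.cases rfl (fun i => rfl) i) i
  refine domCoprod_eq_zero_of_right a b P Q _ (fun k => e.symm (f k))
    (e.symm.injective.comp fun i i' h => Fin.ext (by rw [← hf, ← hf, h])) (by simp) fun k => ?_
  have he : finCongr (by omega) (finSumFinEquiv (e.symm (f k))) = f k := e.apply_symm_apply _
  rw [he]
  refine Fin.cases hx (fun k => Fin.cases hy (fun k => ?_) k) k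
  simp only [f, Fin.cons_succ, Matrix.cons_val_succ, Fin.append_left, hp]

theorem wedgeTwo_eq_zero_of_left {x y : W} {p q : Fin n → W} (hx : P x = 0) (hy : P y = 0)
    (hq : ∀ i, P (q i) = 0) :
    wedgeTwo a b P Q (Matrix.vecCons x (Matrix.vecCons y (Fin.append p q))) = 0 := by
  rw [wedgeTwo_apply]
  let e : Fin (n + 1) ⊕ Fin (n + 1) ≃ Fin (n + n + 1 + 1) :=
    finSumFinEquiv.trans (finCongr (by omega))
  let f : Fin (n + 2) → Fin (n + n + 1 + 1) :=
    Fin.cons 0 (Fin.cons 1 fun i : Fin n => (Fin.natAdd n i).succ.succ)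
  have hf : ∀ i, (f i : ℕ) = if (i : ℕ) < 2 then (i : ℕ) else i + n := by
    intro i
    refine Fin.cases rfl (fun i => Fin.cases rfl (fun i => ?_) i) i
    simp only [f, Fin.cons_succ, Fin.val_succ, Fin.val_natAdd]
    split_ifs <;> omega
  have hinj : Function.Injective f := by
    intro i i' h
    have h1 := hf i
    rw [h, hf i'] at h1
    ext
    split_ifs at h1 <;> omega
  refine domCoprod_eq_zero_of_left a b P Q _ (fun k => e.symm (f k))
    (e.symm.injective.comp hinj) (by simp) fun k => ?_
  have he : finCongr (by omega) (finSumFinEquiv (e.symm (f k))) = f k := e.apply_symm_apply _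
  rw [he]
  refine Fin.cases hx (fun k => Fin.cases hy (fun k => ?_) k) k
  simp only [f, Fin.cons_succ, Matrix.cons_val_succ, Fin.append_right, hq]

/-- The value of the exterior product of forms on the two factors, each of odd degree, on two vectors
and on blocks of vectors tangent to the two factors.  The terms in which both `x` and `y` (or both
`x'` and `y'`) go to the same factor vanish. -/
theorem wedgeTwo_add_add (hn : Even n) {x x' y y' : W} {p q : Fin n → W} (hx : Q x = 0)
    (hx' : P x' = 0) (hy : Q y = 0) (hy' : P y' = 0) (hp : ∀ i, Q (p i) = 0)
    (hq : ∀ i, P (q i) = 0) :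
    wedgeTwo a b P Q (Matrix.vecCons (x + x') (Matrix.vecCons (y + y') (Fin.append p q))) =
      a (Fin.cons (P x) fun i => P (p i)) ⊗ₜ[ℝ] b (Fin.cons (Q y') fun i => Q (q i)) -
        a (Fin.cons (P y) fun i => P (p i)) ⊗ₜ[ℝ] b (Fin.cons (Q x') fun i => Q (q i)) := by
  have hadd : ∀ w : W, wedgeTwo a b P Q (Matrix.vecCons w (Matrix.vecCons (y + y')
      (Fin.append p q))) = wedgeTwo a b P Q (Matrix.vecCons w (Matrix.vecCons y
      (Fin.append p q))) + wedgeTwo a b P Q (Matrix.vecCons w (Matrix.vecCons y'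
      (Fin.append p q))) := fun w => by
    have := AlternatingMap.map_vecCons_add ((wedgeTwo a b P Q).curryLeft w) (Fin.append p q) y y'
    simpa only [AlternatingMap.curryLeft_apply_apply] using this
  rw [AlternatingMap.map_vecCons_add, hadd, hadd, wedgeTwo_eq_zero_of_right a b P Q hx hy hp,
    wedgeTwo_eq_zero_of_left a b P Q hx' hy' hq, wedgeTwo_swap a b P Q x' y,
    wedgeTwo_cons_cons_append a b P Q hn hy' hq,
    wedgeTwo_cons_cons_append a b P Q hn hx' hq]
  abel

end DomCoprod

/-! ### Products of simplices and the form on the fibre square -/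

theorem integrableOn_mul_mul {n : ℕ} {f g : (Fin n → ℝ) → ℝ} (hf : Continuous f)
    (hg : Continuous g) (a : ℝ) :
    IntegrableOn (fun z : (Fin n → ℝ) × (Fin n → ℝ) => f z.1 * (g z.2 * a))
      (coordSimplex n ×ˢ coordSimplex n) :=
  ((hf.comp continuous_fst).mul ((hg.comp continuous_snd).mul
    continuous_const)).continuousOn.integrableOn_compact
      ((isCompact_coordSimplex n).prod (isCompact_coordSimplex n))

theorem integrableOn_sum_mul_mul {n : ℕ} {K : Type*} [Fintype K] {f g : (Fin n → ℝ) → K → ℝ}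
    (hf : ∀ I, Continuous fun y => f y I) (hg : ∀ I, Continuous fun y => g y I) (Φ : K → K → ℝ) :
    IntegrableOn (fun z : (Fin n → ℝ) × (Fin n → ℝ) => ∑ I, ∑ J, f z.1 I * (g z.2 J * Φ I J))
      (coordSimplex n ×ˢ coordSimplex n) :=
  integrable_finsetSum _ fun I _ => integrable_finsetSum _ fun J _ =>
    integrableOn_mul_mul (hf I) (hg J) (Φ I J)

theorem setIntegral_sum_mul_mul {n : ℕ} {K : Type*} [Fintype K] {f g : (Fin n → ℝ) → K → ℝ}
    (hf : ∀ I, Continuous fun y => f y I) (hg : ∀ I, Continuous fun y => g y I) (Φ : K → K → ℝ) :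
    ∫ z in coordSimplex n ×ˢ coordSimplex n, ∑ I, ∑ J, f z.1 I * (g z.2 J * Φ I J) =
      ∑ I, ∑ J, (∫ y in coordSimplex n, f y I) * ((∫ y in coordSimplex n, g y J) * Φ I J) := by
  rw [integral_finsetSum _ fun I _ => integrable_finsetSum _ fun J _ =>
    integrableOn_mul_mul (hf I) (hg J) (Φ I J)]
  refine Finset.sum_congr rfl fun I _ => ?_
  rw [integral_finsetSum _ fun J _ => integrableOn_mul_mul (hf I) (hg J) (Φ I J)]
  refine Finset.sum_congr rfl fun J _ => ?_
  rw [Measure.volume_eq_prod, setIntegral_prod_mul (fun y => f y I) (fun y => g y J * Φ I J),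
    integral_mul_const]

section OmegaNat

variable {E : Type x} [NormedAddCommGroup E] [NormedSpace ℝ E]
  {B : Type u} [TopologicalSpace B] [ChartedSpace E B] {r : ℕ} {S : LatticeSystem.{u, v, w} B r}

local notation "TB" => TangentSpace (modelWithCornersSelf ℝ E)

/-- The arguments in the order of `FormOnSquare`, as a tuple with two vectors prepended. -/
theorem append_two_finCongr {W : Type*} {m : ℕ} (h : m + 1 + 1 = 2 + m) (x y : W) (z : Fin m → W)
    (i : Fin (m + 1 + 1)) :
    Fin.append ![x, y] z (finCongr h i) = Matrix.vecCons x (Matrix.vecCons y z) i := by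
  refine Fin.cases ?_ (fun i => Fin.cases ?_ (fun i => ?_) i) i
  · exact Fin.append_left ![x, y] z 0
  · exact Fin.append_left ![x, y] z 1
  · have : finCongr h i.succ.succ = Fin.natAdd 2 i := by
      ext
      simp
      omega
    rw [this, Fin.append_right]
    rfl

/-- The value of `ω_k^♮` on two vectors and on blocks of vectors tangent to the two factors: one half
of the contribution of the two shuffles that put one of the two vectors on each side. -/
theorem omegaNat_apply (M : ParallelPairing S) (k : ℕ) (b : B) (s t : Torus S b) (X Y : TB b)
    (x x' y y' : HR S b) (p q : Fin (2 * k) → HR S b) :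
    omegaNat E M k b s t (Fin.append ![(X, x, x'), (Y, y, y')]
      (Fin.append (fun m => ((0 : TB b), p m, (0 : HR S b)))
        (fun m => ((0 : TB b), (0 : HR S b), q m)))) =
      1 / 2 * (wedgePairing M (2 * k + 1) b
          (exteriorPower.ιMulti ℝ (2 * k + 1) (Fin.cons x p : Fin (2 * k + 1) → HR S b))
          (exteriorPower.ιMulti ℝ (2 * k + 1) (Fin.cons y' q : Fin (2 * k + 1) → HR S b)) -
        wedgePairing M (2 * k + 1) b
          (exteriorPower.ιMulti ℝ (2 * k + 1) (Fin.cons y p : Fin (2 * k + 1) → HR S b))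
          (exteriorPower.ιMulti ℝ (2 * k + 1) (Fin.cons x' q : Fin (2 * k + 1) → HR S b))) := by
  let P : ((TB b) × HR S b × HR S b) →ₗ[ℝ] HR S b :=
    LinearMap.fst ℝ (HR S b) (HR S b) ∘ₗ LinearMap.snd ℝ (TB b) (HR S b × HR S b)
  let Q : ((TB b) × HR S b × HR S b) →ₗ[ℝ] HR S b :=
    LinearMap.snd ℝ (HR S b) (HR S b) ∘ₗ LinearMap.snd ℝ (TB b) (HR S b × HR S b)
  let p' : Fin (2 * k) → (TB b) × HR S b × HR S b := fun m => (0, p m, 0)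
  let q' : Fin (2 * k) → (TB b) × HR S b × HR S b := fun m => (0, 0, q m)
  have h := wedgeTwo_add_add (exteriorPower.ιMulti ℝ (2 * k + 1) (M := HR S b))
    (exteriorPower.ιMulti ℝ (2 * k + 1) (M := HR S b)) P Q (even_two_mul k)
    (x := (X, x, 0)) (x' := (0, 0, x')) (y := (Y, y, 0)) (y' := (0, 0, y')) (p := p') (q := q')
    rfl rfl rfl rfl (fun _ => rfl) (fun _ => rfl)
  have hX : ((X, x, 0) : (TB b) × HR S b × HR S b) + (0, 0, x') = (X, x, x') := by simp
  have hY : ((Y, y, 0) : (TB b) × HR S b × HR S b) + (0, 0, y') = (Y, y, y') := by simp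
  rw [hX, hY] at h
  have h2 := congrArg (fun z => (1 / 2 : ℝ) * TensorProduct.lift (wedgePairing M (2 * k + 1) b) z) h
  simp only [map_sub, TensorProduct.lift.tmul] at h2
  refine Eq.trans ?_ h2
  rw [wedgeTwo_apply]
  simp only [← append_two_finCongr (show 2 * k + 2 * k + 1 + 1 = 2 + (2 * k + 2 * k) by omega)]
  rfl

end OmegaNat

/-! ### The fibre integral and the first variation -/

theorem bilin_sum_smul {K N : Type*} [Fintype K] [AddCommGroup N] [Module ℝ N]
    (Φ : N →ₗ[ℝ] N →ₗ[ℝ] ℝ) (f g : K → ℝ) (p q : K → N) :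
    Φ (∑ i, f i • p i) (∑ j, g j • q j) = ∑ i, ∑ j, f i * (g j * Φ (p i) (q j)) := by
  rw [LinearMap.map_sum₂]
  simp only [map_sum]
  refine Finset.sum_congr rfl fun i _ => Finset.sum_congr rfl fun j _ => ?_
  rw [LinearMap.map_smul₂, map_smul, smul_eq_mul, smul_eq_mul]

section FiberIntegral

variable {E : Type x} [NormedAddCommGroup E] [NormedSpace ℝ E]
  {B : Type u} [TopologicalSpace B] [ChartedSpace E B] {r : ℕ} {S : LatticeSystem.{u, v, w} B r}

local notation "TB" => TangentSpace (modelWithCornersSelf ℝ E)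

theorem bilin_ofWedgeCoords {m : ℕ} {b : B} (i : S.ι) (Φ : WedgeR S m b →ₗ[ℝ] WedgeR S m b →ₗ[ℝ] ℝ)
    (f g : (Fin m → Fin r) → ℝ) :
    Φ (ofWedgeCoords S i m b f) (ofWedgeCoords S i m b g) =
      ∑ I, ∑ J, f I * (g J * Φ (exteriorPower.ιMulti ℝ m (fun k => frameR S i b (I k)))
        (exteriorPower.ιMulti ℝ m (fun k => frameR S i b (J k)))) := by
  rw [ofWedgeCoords_apply, ofWedgeCoords_apply, bilin_sum_smul]

/-- The vector `X ∧ ∂₁ ∧ … ∧ ∂ₙ` tangent to a simplex moving in the direction `X`. -/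
def LocalFamily.tangentWedge {n : ℕ} (c : LocalFamily E S n) (j : Fin c.N) (b : B) (X : TB b)
    (y : Fin n → ℝ) : WedgeR S (n + 1) b :=
  exteriorPower.ιMulti ℝ (n + 1)
    (Fin.cons (c.baseDeriv j b (param y) X) (c.fiberDeriv j b y) : Fin (n + 1) → HR S b)

/-- The coordinates of `LocalFamily.tangentWedge`. -/
def LocalFamily.tangentCoord {n : ℕ} (c : LocalFamily E S n) (j : Fin c.N) (b : B) (X : TB b)
    (y : Fin n → ℝ) : (Fin (n + 1) → Fin r) → ℝ :=
  strictPart fun I => detForm I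
    (Fin.cons (c.baseVelocity j b X (param y)) (partialDeriv (c.lift j b) y) :
      Fin (n + 1) → Fin r → ℝ)

theorem LocalFamily.tangentWedge_eq {n : ℕ} (c : LocalFamily E S n) (j : Fin c.N) (b : B)
    (X : TB b) (y : Fin n → ℝ) :
    c.tangentWedge j b X y = ofWedgeCoords S c.i (n + 1) b (c.tangentCoord j b X y) := by
  rw [← ofWedgeCoords_strictPart c.i (c.tangentWedge j b X y), LocalFamily.tangentCoord]
  congr 2
  ext I
  rw [LocalFamily.tangentWedge, wedgeCoord_ιMulti, coordForm_apply]
  congr 1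
  refine funext fun k => Fin.cases ?_ (fun k => ?_) k
  · exact equivFun_ofCoords c.i b _
  · exact equivFun_ofCoords c.i b _

/-- The integral of `LocalFamily.tangentWedge` over the simplex. -/
def LocalFamily.tangentIntegral {n : ℕ} (c : LocalFamily E S n) (j : Fin c.N) (b : B) (X : TB b) :
    WedgeR S (n + 1) b :=
  ofWedgeCoords S c.i (n + 1) b fun I => ∫ y in coordSimplex n, c.tangentCoord j b X y I

variable [IsManifold (modelWithCornersSelf ℝ E) ∞ B]

theorem LocalFamily.continuous_baseVelocity {n : ℕ} (c : LocalFamily E S n) (j : Fin c.N) {b : B}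
    (hb : b ∈ c.U) (X : TB b) : Continuous (c.baseVelocity j b X) := by
  have hx : extChartAt (modelWithCornersSelf ℝ E) b b ∈ c.chartDomain b :=
    ⟨mem_extChartAt_target b, by rw [Set.mem_preimage, extChartAt_to_inv]; exact hb⟩
  have h := continuous_velocity (c.isOpen_chartDomain b) (c.contDiffOn_chartLift b j) hx X
  rwa [c.velocity_chartLift hb j X] at h

theorem LocalFamily.continuous_tangentCoord {n : ℕ} (c : LocalFamily E S n) (j : Fin c.N) {b : B}
    (hb : b ∈ c.U) (X : TB b) (I : Fin (n + 1) → Fin r) :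
    Continuous fun y => c.tangentCoord j b X y I := by
  unfold LocalFamily.tangentCoord strictPart
  split_ifs
  · exact (detForm I).cont.comp
      (continuous_cons_partialDeriv (c.contDiff_lift j hb) (c.continuous_baseVelocity j hb X))
  · exact continuous_const

theorem LocalFamily.integrableOn_tangentWedge {n : ℕ} (c : LocalFamily E S n) (j l : Fin c.N)
    {b : B} (hb : b ∈ c.U) (X Y : TB b) (Φ : WedgeR S (n + 1) b →ₗ[ℝ] WedgeR S (n + 1) b →ₗ[ℝ] ℝ) :
    IntegrableOn (fun z : (Fin n → ℝ) × (Fin n → ℝ) =>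
      Φ (c.tangentWedge j b X z.1) (c.tangentWedge l b Y z.2))
      (coordSimplex n ×ˢ coordSimplex n) := by
  simp only [c.tangentWedge_eq, bilin_ofWedgeCoords]
  exact integrableOn_sum_mul_mul (c.continuous_tangentCoord j hb X)
    (c.continuous_tangentCoord l hb Y) _

/-- Fubini's theorem for the product of two simplices. -/
theorem LocalFamily.setIntegral_tangentWedge {n : ℕ} (c : LocalFamily E S n) (j l : Fin c.N)
    {b : B} (hb : b ∈ c.U) (X Y : TB b) (Φ : WedgeR S (n + 1) b →ₗ[ℝ] WedgeR S (n + 1) b →ₗ[ℝ] ℝ) :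
    ∫ z in coordSimplex n ×ˢ coordSimplex n,
      Φ (c.tangentWedge j b X z.1) (c.tangentWedge l b Y z.2) =
    Φ (c.tangentIntegral j b X) (c.tangentIntegral l b Y) := by
  simp only [c.tangentWedge_eq, LocalFamily.tangentIntegral, bilin_ofWedgeCoords]
  exact setIntegral_sum_mul_mul (c.continuous_tangentCoord j hb X)
    (c.continuous_tangentCoord l hb Y) _

/-- The fibre integral of `ω_k^♮` pairs the integrals over the moving simplices. -/
theorem LocalFamily.fiberIntegral_omegaNat (M : ParallelPairing S) {k : ℕ}
    (c : LocalFamily E S (2 * k)) {b : B} (hb : b ∈ c.U) (X Y : TB b) :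
    c.fiberIntegral (omegaNat E M k) b X Y = wedgePairing M (2 * k + 1) b
      (∑ j, (c.coeff j : ℝ) • c.tangentIntegral j b X)
      (∑ j, (c.coeff j : ℝ) • c.tangentIntegral j b Y) := by
  have hpair : ∀ j l, ∫ z in coordSimplex (2 * k) ×ˢ coordSimplex (2 * k),
      omegaNat E M k b (c.simplex j b (param z.1)) (c.simplex l b (param z.2))
        (Fin.append
          ![(X, c.baseDeriv j b (param z.1) X, c.baseDeriv l b (param z.2) X),
            (Y, c.baseDeriv j b (param z.1) Y, c.baseDeriv l b (param z.2) Y)]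
          (Fin.append
            (fun m => ((0 : TB b), c.fiberDeriv j b z.1 m, (0 : HR S b)))
            (fun m => ((0 : TB b), (0 : HR S b), c.fiberDeriv l b z.2 m)))) =
      1 / 2 * (wedgePairing M (2 * k + 1) b (c.tangentIntegral j b X) (c.tangentIntegral l b Y) -
        wedgePairing M (2 * k + 1) b (c.tangentIntegral j b Y) (c.tangentIntegral l b X)) := by
    intro j l
    simp only [omegaNat_apply]
    rw [integral_const_mul]
    change 1 / 2 * (∫ z in coordSimplex (2 * k) ×ˢ coordSimplex (2 * k),
      (wedgePairing M (2 * k + 1) b (c.tangentWedge j b X z.1) (c.tangentWedge l b Y z.2) -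
        wedgePairing M (2 * k + 1) b (c.tangentWedge j b Y z.1) (c.tangentWedge l b X z.2))) = _
    rw [integral_sub (c.integrableOn_tangentWedge j l hb X Y _)
      (c.integrableOn_tangentWedge j l hb Y X _), c.setIntegral_tangentWedge j l hb,
      c.setIntegral_tangentWedge j l hb]
  have hanti : ∀ ξ η, wedgePairing M (2 * k + 1) b ξ η = - wedgePairing M (2 * k + 1) b η ξ :=
    fun ξ η => by
      conv_lhs => rw [wedgePairing_antisymm]
      rfl
  have hsum : ∀ X Y : TB b, wedgePairing M (2 * k + 1) b
      (∑ j, (c.coeff j : ℝ) • c.tangentIntegral j b X)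
      (∑ j, (c.coeff j : ℝ) • c.tangentIntegral j b Y) =
      ∑ j, ∑ l, (c.coeff j : ℝ) * (c.coeff l : ℝ) *
        wedgePairing M (2 * k + 1) b (c.tangentIntegral j b X) (c.tangentIntegral l b Y) := by
    intro X Y
    simp only [bilin_sum_smul, mul_assoc]
  rw [LocalFamily.fiberIntegral]
  simp only [hpair]
  have h := hanti (∑ j, (c.coeff j : ℝ) • c.tangentIntegral j b Y)
    (∑ j, (c.coeff j : ℝ) • c.tangentIntegral j b X)
  rw [hsum, hsum] at h
  rw [hsum]
  have hsplit : ∑ j, ∑ l, (c.coeff j : ℝ) * (c.coeff l : ℝ) * (1 / 2 *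
      (wedgePairing M (2 * k + 1) b (c.tangentIntegral j b X) (c.tangentIntegral l b Y) -
        wedgePairing M (2 * k + 1) b (c.tangentIntegral j b Y) (c.tangentIntegral l b X))) =
      1 / 2 * (∑ j, ∑ l, (c.coeff j : ℝ) * (c.coeff l : ℝ) *
        wedgePairing M (2 * k + 1) b (c.tangentIntegral j b X) (c.tangentIntegral l b Y) -
      ∑ j, ∑ l, (c.coeff j : ℝ) * (c.coeff l : ℝ) *
        wedgePairing M (2 * k + 1) b (c.tangentIntegral j b Y) (c.tangentIntegral l b X)) := by
    rw [← Finset.sum_sub_distrib, Finset.mul_sum]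
    refine Finset.sum_congr rfl fun j _ => ?_
    rw [← Finset.sum_sub_distrib, Finset.mul_sum]
    exact Finset.sum_congr rfl fun l _ => by ring
  rw [hsplit, h]
  ring

/-- The first variation of the Abel-Jacobi section is the sum of the integrals of
`LocalFamily.tangentWedge` over the moving simplices. -/
theorem LocalFamily.Represents.firstVariation_eq [FiniteDimensional ℝ E] {n : ℕ}
    {c : LocalFamily E S n} {Γ : ∀ b, Chain S n b} (hc : c.Represents Γ)
    (hΓ : ∀ b, IsCycle (Γ b)) {γ : ∀ b, WedgeTorus S (n + 1) b}
    (hγ : ∀ b, IsAbelJacobiClass (Γ b) (γ b)) {b : B} (hb : b ∈ c.U) (X : TB b) :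
    firstVariation E γ b X = ∑ j, (c.coeff j : ℝ) • c.tangentIntegral j b X := by
  obtain ⟨U, f, hbU, hf, hd⟩ := hc.exists_isSmoothLift hΓ hγ hb
  rw [hf.firstVariation_eq hbU X, hd X]
  simp only [LocalFamily.tangentIntegral, ← map_smul, ← map_sum]
  congr 1
  ext I
  simp only [Finset.sum_apply, Pi.smul_apply, smul_eq_mul, strictPart, LocalFamily.tangentCoord,
    formIntegralVar]
  split_ifs
  · rfl
  · simp

end FiberIntegral

end TorusBundle

end

theorem mainTheorem12 {E : Type*} [NormedAddCommGroup E] [NormedSpace ℝ E] [FiniteDimensional ℝ E]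
    {B : Type*} [TopologicalSpace B] [ChartedSpace E B]
    [IsManifold (modelWithCornersSelf ℝ E) ∞ B] {r : ℕ}
    (S : TorusBundle.LatticeSystem B r) (M : TorusBundle.ParallelPairing S) (k : ℕ)
    (Γ : TorusBundle.CycleFamily E S (2 * k)) (hΓ : Γ.IsHomologicallyTrivial)
    (γ : ∀ b, TorusBundle.WedgeTorus S (2 * k + 1) b)
    (hγ : ∀ b, TorusBundle.IsAbelJacobiClass (Γ.cycle b) (γ b)) :
    TorusBundle.IsSmoothSection E γ ∧
    TorusBundle.pullback γ (TorusBundle.omega E M k) = TorusBundle.contractSquare M k γ ∧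
    (∀ (b : B) (X Y : TangentSpace (modelWithCornersSelf ℝ E) b),
      TorusBundle.contractSquare M k γ b ![X, Y] =
        Γ.fiberIntegral (TorusBundle.omegaNat E M k) b X Y) ∧
    (∀ (b : B) (c : TorusBundle.LocalFamily E S (2 * k)), b ∈ c.U → c.Represents Γ.cycle →
      ∀ X Y : TangentSpace (modelWithCornersSelf ℝ E) b,
        c.fiberIntegral (TorusBundle.omegaNat E M k) b X Y =
          Γ.fiberIntegral (TorusBundle.omegaNat E M k) b X Y) := by
  have hlocal : ∀ (b : B) (c : TorusBundle.LocalFamily E S (2 * k)), b ∈ c.U →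
      c.Represents Γ.cycle → ∀ X Y : TangentSpace (modelWithCornersSelf ℝ E) b,
      c.fiberIntegral (TorusBundle.omegaNat E M k) b X Y =
        TorusBundle.contractSquare M k γ b ![X, Y] := by
    intro b c hb hc X Y
    rw [c.fiberIntegral_omegaNat M hb, ← hc.firstVariation_eq Γ.isCycle hγ hb,
      ← hc.firstVariation_eq Γ.isCycle hγ hb]
    rfl
  have hchoice := fun b => (Γ.exists_local b).choose_spec
  refine ⟨fun b => ?_, rfl, fun b X Y => ?_, fun b c hb hc X Y => ?_⟩
  · obtain ⟨U, f, hbU, hf, -⟩ := (hchoice b).2.exists_isSmoothLift Γ.isCycle hγ (hchoice b).1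
    exact ⟨_, U, f, hbU, hf⟩
  · exact (hlocal b _ (hchoice b).1 (hchoice b).2 X Y).symm
  · rw [hlocal b c hb hc]
    exact (hlocal b _ (hchoice b).1 (hchoice b).2 X Y).symm
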